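/- **Setting.** Let $T>0$, $p,k\in\mathbb N=\{0,1,2,\dots\}$, $J\subset\mathbb N^*$. For $j\ge 1$ put $\varphi_j(x)=\sqrt2\sin(j\pi x)$, $\lambda_j=(j\pi)^2$, $\psi_1(t)=e^{-i\lambda_1t}\varphi_1$, and let $A$ be the Dirichlet Laplacian $-\partial_x^2$ on $(0,1)$. For $\sigma\in\mathbb Z$ let $$\|\psi\|_{H^\sigma_{(0)}}=\Big(\sum_{j\ge1}|j^\sigma\langle\psi,\varphi_j\rangle|^2\Big)^{1/2},$$ and for $s>0$ let $H^s_{(0)}=D(A^{s/2})\subset L^2((0,1),\mathbb C)$ be the space of those $\psi\in L^2$ for which $\|\psi\|_{H^s_{(0)}}<\infty$, with this norm. Let $\mathcal H_J$ be the closed complex span in $L^2(0,1)$ of the $\varphi_j$, $j\in J$, and $\mathbb P_J$ the orthogonal projection on it. Let $\mathcal S$ be the unit sphere of $L^2(0,1)$, $T_{\mathcal S}\psi=\{\xi\in L^2(0,1):\operatorname{Re}\langle\xi,\psi\rangle=0\}$ and $\Pi_\psi\xi=\xi-\operatorname{Re}\langle\xi,\psi\rangle\psi$. Let $H^k_0=H^k_0((0,T),\mathbb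 R)$ be the closure of $C_c^\infty(0,T)$ in $H^k(0,T)$. For $u\in H^k_0$ let $u_0=u$, $u_{n+1}(t)=\int_0^tu_n(\tau)\,d\tau$, and put $\|u\|_{H^m_0}=\|u^{(m)}\|_{L^2(0,T)}$ for $0\le m\le k$ and $\|u\|_{H^{-n}_0}=|u_1(T)|+\|u_n\|_{L^2(0,T)}$ for $n\ge1$. Let $\mu\in H^{2(p+k)+3}((0,1),\mathbb R)$ satisfy $\mu^{(2n+1)}(0)=\mu^{(2n+1)}(1)=0$ for $n=0,\dots,p-1$, and suppose that there is $c>0$ with $|\langle\mu\varphi_1,\varphi_j\rangle|\ge c\,j^{-(2p+3)}$ for all $j\in J$. Let $\Theta_T$ be the end-point map $$\Theta_T(\psi_0,u)=\big(\psi_0,\ \Pi_{\psi_1(T)}\mathbb P_J[\psi(T)]\big),$$ where $\psi$ is the solution of $i\partial_t\psi=-\partial_x^2\psi-u(t)\mu(x)\psi$ on $(0,T)\times(0,1)$ with $\psi(t,0)=\psi(t,1)=0$ and $\psi(0)=\psi_0$. **Proposition.** As a map from $H^{2(p+k)+3}_{(0)}\times H^k_0$ to $H^{2(p+k)+3}_{(0)}\times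 H^{2(p+k)+3}_{(0)}$, $\Theta_T$ is (real) Fréchet differentiable at $(\varphi_1,0)$. Its differential restricts to a continuous real-linear map $$d\Theta_T(\varphi_1,0):[T_{\mathcal S}\varphi_1\cap H^{2(p+k)+3}_{(0)}]\times H^k_0\to[T_{\mathcal S}\varphi_1\cap H^{2(p+k)+3}_{(0)}]\times[T_{\mathcal S}\psi_1(T)\cap\mathcal H_J\cap H^{2(p+k)+3}_{(0)}],$$ and this map has a continuous linear right inverse $d\Theta_T(\varphi_1,0)^{-1}$ with the following property. There is a constant $C>0$ such that for all $\psi_0\in T_{\mathcal S}\varphi_1\cap H^{2(p+k)+3}_{(0)}$ and $\psi_f\in T_{\mathcal S}\psi_1(T)\cap\mathcal H_J\cap H^{2(p+k)+3}_{(0)}$ one has $d\Theta_T(\varphi_1,0)^{-1}(\psi_0,\psi_f)=(\psi_0,u)$ with a control $u\in H^k_0$ such that $$u_2(T)=\dots=u_{k+1}(T)=0$$ and $$\|u\|_{H^m_0}\le C\big(\|\psi_0\|_{H^{2(p+m)+3}_{(0)}}+\|\psi_f\|_{H^{2(p+m)+3}_{(0)}}\big)\qquad\text{for all } m=-(k+1),\dots,k.$$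 -/

import Mathlib

open MeasureTheory Set

open scoped ContDiff

noncomputable section

namespace BilinearSchrodinger

/-! ### Sobolev spaces on a bounded interval -/

/-- `θ` is a real test function on `(a, b)`, i.e. an element of `C_c^∞(a, b)`. -/
def IsTestFunction (a b : ℝ) (θ : ℝ → ℝ) : Prop :=
  ContDiff ℝ ∞ θ ∧ HasCompactSupport θ ∧ tsupport θ ⊆ Ioo a b

/-- `g` is the weak derivative of order `n` of `f` on `(a, b)`. -/
def IsWeakDeriv (a b : ℝ) (n : ℕ) (f g : ℝ → ℝ) : Prop :=
  ∀ θ : ℝ → ℝ, IsTestFunction a b θ →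
    ∫ x in Ioo a b, f x * iteratedDeriv n θ x = (-1) ^ n * ∫ x in Ioo a b, g x * θ x

/-- `f ∈ H^N((a, b), ℝ)`: `f` is square integrable on `(a, b)`, and so are its weak derivatives
up to order `N`. -/
def MemSobolev (a b : ℝ) (N : ℕ) (f : ℝ → ℝ) : Prop :=
  MemLp f 2 (volume.restrict (Ioo a b)) ∧
    ∀ n ≤ N, ∃ g : ℝ → ℝ, MemLp g 2 (volume.restrict (Ioo a b)) ∧ IsWeakDeriv a b n f g

/-- `f^{(n)}(a) = f^{(n)}(b) = 0`, where `f^{(n)}` is the representative, continuous on `[a, b]`,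
of the weak derivative of order `n` (it exists and is unique when `f ∈ H^{n+1}(a, b)`). -/
def DerivVanishesAtEndpoints (a b : ℝ) (n : ℕ) (f : ℝ → ℝ) : Prop :=
  ∃ g : ℝ → ℝ, ContinuousOn g (Icc a b) ∧ IsWeakDeriv a b n f g ∧ g a = 0 ∧ g b = 0

/-- The real Lebesgue space `L²((0, T), ℝ)`. -/
abbrev L2Time (T : ℝ) : Type := Lp ℝ 2 (volume.restrict (Ioo (0 : ℝ) T))

/-- `H^k_0((0, T), ℝ)`: the closure of `C_c^∞(0, T)` in the `H^k(0, T)`-norm. A function `u` of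
`H^k(0, T)` is represented by the tuple `(u, u', …, u^{(k)})` of its weak derivatives; this
identifies `H^k(0, T)` isometrically with a closed subspace of the Hilbert space
`L²(0, T)^{k+1}`, so that the norm of `H0 k T` is
`‖u‖_{H^k} = (‖u‖² + ‖u'‖² + … + ‖u^{(k)}‖²)^{1/2}`. -/
def H0 (k : ℕ) (T : ℝ) : Submodule ℝ (PiLp 2 fun _ : Fin (k + 1) => L2Time T) :=
  (Submodule.span ℝ
    {v | ∃ θ : ℝ → ℝ, IsTestFunction 0 T θ ∧
      ∀ i : Fin (k + 1), v i =ᵐ[volume.restrict (Ioo 0 T)] iteratedDeriv i θ}).topologicalClosure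

/-- The weak derivative `u^{(m)} ∈ L²(0, T)` of `u ∈ H^k_0(0, T)`, for `m ≤ k`. -/
def controlDeriv {k : ℕ} {T : ℝ} (u : H0 k T) (m : Fin (k + 1)) : L2Time T :=
  (u : PiLp 2 fun _ : Fin (k + 1) => L2Time T) m

/-- The function `t ↦ u(t)` underlying `u ∈ H^k_0(0, T)`. -/
def controlFun {k : ℕ} {T : ℝ} (u : H0 k T) : ℝ → ℝ := (controlDeriv u 0 : L2Time T)

/-- The iterated primitives `u_0 = u`, `u_{n+1}(t) = ∫_0^t u_n(τ) dτ`. -/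
def iterPrim (u : ℝ → ℝ) : ℕ → ℝ → ℝ
  | 0 => u
  | n + 1 => fun t => ∫ τ in (0 : ℝ)..t, iterPrim u n τ

/-- The negative norm `‖u‖_{H^{-n}(0,T)} = |u_1(T)| + ‖u_n‖_{L²(0,T)}`, for `n ≥ 1`. -/
def negNorm (T : ℝ) (n : ℕ) (u : ℝ → ℝ) : ℝ :=
  |iterPrim u 1 T| + Real.sqrt (∫ t in (0 : ℝ)..T, iterPrim u n t ^ 2)

/-! ### The spaces attached to the Dirichlet Laplacian on `(0, 1)` -/

/-- The complex Lebesgue space `L²((0, 1), ℂ)`. -/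
abbrev L2Space : Type := Lp ℂ 2 (volume.restrict (Ioo (0 : ℝ) 1))

/-- The eigenfunction `φ_j(x) = √2 sin(jπx)`. -/
def phi (j : ℕ+) (x : ℝ) : ℝ := Real.sqrt 2 * Real.sin ((j : ℝ) * Real.pi * x)

/-- The eigenvalue `λ_j = (jπ)²`. -/
def eigenvalue (j : ℕ+) : ℝ := ((j : ℝ) * Real.pi) ^ 2

lemma continuous_phi (j : ℕ+) : Continuous (phi j) := by
  unfold phi; fun_prop

lemma memLp_phi (j : ℕ+) :
    MemLp (fun x => (phi j x : ℂ)) 2 (volume.restrict (Ioo (0 : ℝ) 1)) := by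
  refine MemLp.of_bound (Complex.continuous_ofReal.comp (continuous_phi j)).aestronglyMeasurable
    (Real.sqrt 2) (Filter.Eventually.of_forall fun x => ?_)
  rw [Complex.norm_real, phi, norm_mul, Real.norm_of_nonneg (Real.sqrt_nonneg 2)]
  exact mul_le_of_le_one_right (Real.sqrt_nonneg 2) (Real.abs_sin_le_one _)

/-- The eigenfunction `φ_j` as an element of `L²((0, 1), ℂ)`. -/
def phiL2 (j : ℕ+) : L2Space := (memLp_phi j).toLp _

/-- The coefficient `⟨ψ, φ_j⟩ = ∫_0^1 ψ(x) φ_j(x) dx` (Mathlib's inner product is conjugate linear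
in its first argument). -/
def coeff (j : ℕ+) (ψ : L2Space) : ℂ := inner ℂ (phiL2 j) ψ

/-- `‖ψ‖_{H^σ_{(0)}(0,1)} = (∑_j |j^σ ⟨ψ, φ_j⟩|²)^{1/2}`, for an integer `σ` of any sign. -/
def hNorm (σ : ℤ) (ψ : L2Space) : ℝ :=
  Real.sqrt (∑' j : ℕ+, ((j : ℝ) ^ σ * ‖coeff j ψ‖) ^ 2)

lemma coeff_add (j : ℕ+) (ψ χ : L2Space) : coeff j (ψ + χ) = coeff j ψ + coeff j χ :=
  inner_add_right _ _ _

lemma coeff_smul (j : ℕ+) (c : ℂ) (ψ : L2Space) : coeff j (c • ψ) = c * coeff j ψ :=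
  inner_smul_right _ _ _

lemma coeff_zero (j : ℕ+) : coeff j 0 = 0 := inner_zero_right _

lemma coeff_eq (j : ℕ+) (ψ : L2Space) :
    coeff j ψ = ∫ x in Ioo (0 : ℝ) 1, (phi j x : ℂ) * ψ x := by
  rw [coeff, L2.inner_def]
  refine integral_congr_ae ?_
  filter_upwards [(memLp_phi j).coeFn_toLp] with x hx
  rw [phiL2, hx, RCLike.inner_apply, Complex.conj_ofReal, mul_comm]

/-- The set `H^s_{(0)}(0,1) = D(A^{s/2})` of all `ψ ∈ L²` with `∑_j |j^s ⟨ψ, φ_j⟩|² < ∞`. -/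
def HSub (s : ℕ) : Submodule ℂ L2Space where
  carrier := {ψ | Memℓp (fun j : ℕ+ => ((j : ℂ) ^ s) * coeff j ψ) 2}
  add_mem' := by
    intro a b ha hb
    simpa only [mem_ofPred_eq, coeff_add, mul_add] using! ha.add hb
  zero_mem' := by
    simpa only [mem_ofPred_eq, coeff_zero, mul_zero] using! zero_memℓp
  smul_mem' := by
    intro c a ha
    have h := ha.const_smul c
    simp only [mem_ofPred_eq, coeff_smul]
    convert h using 2 with j
    simp only [smul_eq_mul, Pi.smul_apply]; ring

/-- The space `H^s_{(0)}(0,1)`, which carries its own norm `hNorm s` (not the norm of `L²`). -/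
def HSp (s : ℕ) : Type := HSub s

instance (s : ℕ) : AddCommGroup (HSp s) := inferInstanceAs (AddCommGroup (HSub s))

instance (s : ℕ) : Module ℂ (HSp s) := inferInstanceAs (Module ℂ (HSub s))

/-- The inclusion of `H^s_{(0)}(0,1)` in `L²(0,1)`. -/
def HSp.toL2 {s : ℕ} : HSp s →ₗ[ℂ] L2Space := (HSub s).subtype

/-- The element of `H^s_{(0)}(0,1)` given by an element of `L²(0,1)` that lies in it. -/
def HSp.mk {s : ℕ} (ψ : L2Space) (h : ψ ∈ HSub s) : HSp s := (⟨ψ, h⟩ : HSub s)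

/-- The map `ψ ↦ (j^s ⟨ψ, φ_j⟩)_j` from `H^s_{(0)}(0,1)` to `ℓ²`. -/
def HSp.weightedCoeff (s : ℕ) : HSp s →ₗ[ℂ] lp (fun _ : ℕ+ => ℂ) 2 where
  toFun ψ := ⟨fun j : ℕ+ => ((j : ℂ) ^ s) * coeff j ψ.toL2, ψ.2⟩
  map_add' a b := by
    ext j
    simp only [map_add, coeff_add, mul_add, lp.coeFn_add, Pi.add_apply]
  map_smul' c a := by
    ext j
    simp only [map_smul, coeff_smul, RingHom.id_apply, lp.coeFn_smul, Pi.smul_apply, smul_eq_mul]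
    ring

lemma sin_moment_eq_zero {ψ : L2Space} (h : ∀ j, coeff j ψ = 0) (n : ℤ) :
    ∫ x in Ioo (0 : ℝ) 1, (Real.sin (n * Real.pi * x) : ℂ) * ψ x = 0 := by
  have key : ∀ j : ℕ+, ∫ x in Ioo (0 : ℝ) 1, (Real.sin ((j : ℝ) * Real.pi * x) : ℂ) * ψ x = 0 := by
    intro j
    have h1 := h j
    rw [coeff_eq] at h1
    have h2 : ∀ x : ℝ, (phi j x : ℂ) * ψ x =
        (Real.sqrt 2 : ℂ) * ((Real.sin ((j : ℝ) * Real.pi * x) : ℂ) * ψ x) := by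
      intro x; rw [phi]; push_cast; ring
    simp only [h2] at h1
    rw [integral_const_mul] at h1
    rcases mul_eq_zero.1 h1 with h3 | h3
    · exact absurd (Complex.ofReal_eq_zero.1 h3) (by positivity)
    · exact h3
  rcases lt_trichotomy n 0 with hn | hn | hn
  · have h1 := key ⟨n.natAbs, Int.natAbs_pos.2 hn.ne⟩
    have h2 : ((n.natAbs : ℕ) : ℝ) = -(n : ℝ) := by
      rw [← Int.cast_natCast, Int.ofNat_natAbs_of_nonpos hn.le]; push_cast; ring
    rw [← neg_eq_zero, ← integral_neg, ← h1]
    refine integral_congr_ae (Filter.Eventually.of_forall fun x => ?_)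
    simp only [PNat.mk_coe, h2, neg_mul, Real.sin_neg]
    push_cast; ring
  · subst hn; simp
  · have h1 := key ⟨n.natAbs, Int.natAbs_pos.2 hn.ne'⟩
    have h2 : ((n.natAbs : ℕ) : ℝ) = (n : ℝ) := by
      rw [← Int.cast_natCast, Int.natAbs_of_nonneg hn.le]
    simpa only [PNat.mk_coe, h2] using h1

lemma integrable_bdd_mul (ψ : L2Space) {g : ℝ → ℝ} (hg : Continuous g) {C : ℝ}
    (hC : ∀ x, |g x| ≤ C) :
    Integrable (fun x => (g x : ℂ) * ψ x) (volume.restrict (Ioo (0 : ℝ) 1)) := by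
  refine Integrable.bdd_mul (c := C) ((Lp.memLp ψ).integrable one_le_two)
    (Complex.continuous_ofReal.comp hg).aestronglyMeasurable
    (Filter.Eventually.of_forall fun x => ?_)
  simpa [Complex.norm_real] using hC x

lemma cos_pow_moment_eq_zero {ψ : L2Space} (h : ∀ j, coeff j ψ = 0) (m : ℕ) (n : ℤ) :
    ∫ x in Ioo (0 : ℝ) 1,
      ((Real.cos (Real.pi * x) ^ m * Real.sin (n * Real.pi * x) : ℝ) : ℂ) * ψ x = 0 := by
  induction m generalizing n with
  | zero => simpa using sin_moment_eq_zero h n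
  | succ m ih =>
    have hint : ∀ n : ℤ, Integrable (fun x => ((Real.cos (Real.pi * x) ^ m *
        Real.sin (n * Real.pi * x) : ℝ) : ℂ) * ψ x) (volume.restrict (Ioo (0 : ℝ) 1)) := by
      intro n
      refine integrable_bdd_mul ψ (C := 1) (by fun_prop) fun x => ?_
      rw [abs_mul, abs_pow]
      exact mul_le_one₀ (pow_le_one₀ (abs_nonneg _) (Real.abs_cos_le_one _)) (abs_nonneg _)
        (Real.abs_sin_le_one _)
    have h1 : ∀ x : ℝ, ((Real.cos (Real.pi * x) ^ (m + 1) * Real.sin (n * Real.pi * x) : ℝ) : ℂ)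
        * ψ x = (1 / 2 : ℂ) * (((Real.cos (Real.pi * x) ^ m *
          Real.sin ((n + 1 : ℤ) * Real.pi * x) : ℝ) : ℂ) * ψ x +
          ((Real.cos (Real.pi * x) ^ m *
          Real.sin ((n - 1 : ℤ) * Real.pi * x) : ℝ) : ℂ) * ψ x) := by
      intro x
      have e1 : Real.sin ((n + 1 : ℤ) * Real.pi * x) =
          Real.sin (n * Real.pi * x) * Real.cos (Real.pi * x) +
          Real.cos (n * Real.pi * x) * Real.sin (Real.pi * x) := by
        rw [← Real.sin_add]; push_cast; ring_nf
      have e2 : Real.sin ((n - 1 : ℤ) * Real.pi * x) =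
          Real.sin (n * Real.pi * x) * Real.cos (Real.pi * x) -
          Real.cos (n * Real.pi * x) * Real.sin (Real.pi * x) := by
        rw [← Real.sin_sub]; push_cast; ring_nf
      rw [e1, e2]; push_cast; ring
    simp only [h1]
    rw [integral_const_mul, integral_add (hint _) (hint _), ih, ih]
    simp

/-- The family `(φ_j)` is total in `L²(0,1)`. -/
lemma eq_zero_of_coeff_eq_zero {ψ : L2Space} (h : ∀ j, coeff j ψ = 0) : ψ = 0 := by
  set g : ℝ → ℂ := fun x => (Real.sin (Real.pi * x) : ℂ) * ψ x with hg
  have hgint : Integrable g (volume.restrict (Ioo (0 : ℝ) 1)) :=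
    integrable_bdd_mul ψ (g := fun x => Real.sin (Real.pi * x)) (C := 1) (by fun_prop)
      fun x => Real.abs_sin_le_one _
  have hpow : ∀ m : ℕ, Integrable (fun x => ((Real.cos (Real.pi * x) ^ m : ℝ) : ℂ) * g x)
      (volume.restrict (Ioo (0 : ℝ) 1)) := by
    intro m
    refine Integrable.bdd_mul (c := 1) hgint ?_ (Filter.Eventually.of_forall fun x => ?_)
    · exact (Continuous.aestronglyMeasurable (by fun_prop))
    · rw [Complex.norm_real, norm_pow]
      exact pow_le_one₀ (norm_nonneg _) (Real.abs_cos_le_one _)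
  have hpoly : ∀ P : Polynomial ℝ,
      Integrable (fun x => ((P.eval (Real.cos (Real.pi * x)) : ℝ) : ℂ) * g x)
        (volume.restrict (Ioo (0 : ℝ) 1)) ∧
      ∫ x in Ioo (0 : ℝ) 1, ((P.eval (Real.cos (Real.pi * x)) : ℝ) : ℂ) * g x = 0 := by
    intro P
    have e : ∀ x : ℝ, ((P.eval (Real.cos (Real.pi * x)) : ℝ) : ℂ) * g x =
        ∑ i ∈ Finset.range (P.natDegree + 1),
          (P.coeff i : ℂ) * (((Real.cos (Real.pi * x) ^ i : ℝ) : ℂ) * g x) := by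
      intro x
      rw [Polynomial.eval_eq_sum_range]; push_cast; rw [Finset.sum_mul]
      exact Finset.sum_congr rfl fun i _ => by ring
    simp only [e]
    refine ⟨integrable_finsetSum _ fun i _ => (hpow i).const_mul _, ?_⟩
    rw [integral_finsetSum _ fun i _ => (hpow i).const_mul _]
    refine Finset.sum_eq_zero fun i _ => ?_
    rw [integral_const_mul]
    have h0 := cos_pow_moment_eq_zero h i 1
    have h1 : ∫ x in Ioo (0 : ℝ) 1, ((Real.cos (Real.pi * x) ^ i : ℝ) : ℂ) * g x = 0 := by
      rw [← h0]
      refine integral_congr_ae (Filter.Eventually.of_forall fun x => ?_)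
      simp only [hg]; push_cast; rw [one_mul]; ring
    rw [h1, mul_zero]
  have hcont : ∀ θ : ℝ → ℝ, Continuous θ → ∫ x in Ioo (0 : ℝ) 1, (θ x : ℂ) * g x = 0 := by
    intro θ hθ
    have hbound : ∀ ε > 0, ‖∫ x in Ioo (0 : ℝ) 1, (θ x : ℂ) * g x‖ ≤
        ε * ∫ x in Ioo (0 : ℝ) 1, ‖g x‖ := by
      intro ε hε
      obtain ⟨P, hP⟩ := exists_polynomial_near_of_continuousOn (-1) 1
        (fun y => θ (Real.arccos y / Real.pi))
        (hθ.comp (Real.continuous_arccos.div_const _)).continuousOn ε hε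
      have hP' : ∀ x ∈ Ioo (0 : ℝ) 1, |θ x - P.eval (Real.cos (Real.pi * x))| ≤ ε := by
        intro x hx
        have := hP (Real.cos (Real.pi * x)) ⟨Real.neg_one_le_cos _, Real.cos_le_one _⟩
        rw [Real.arccos_cos (by have := hx.1; positivity)
          (by nlinarith [hx.2, Real.pi_pos]), mul_div_cancel_left₀ _ Real.pi_ne_zero,
          abs_sub_comm] at this
        exact this.le
      have hmeas : AEStronglyMeasurable (fun x => ((θ x - P.eval (Real.cos (Real.pi * x)) : ℝ) : ℂ))
          (volume.restrict (Ioo (0 : ℝ) 1)) := Continuous.aestronglyMeasurable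
        (Complex.continuous_ofReal.comp (hθ.sub (P.continuous.comp (by fun_prop))))
      have hdint : Integrable (fun x => ((θ x - P.eval (Real.cos (Real.pi * x)) : ℝ) : ℂ) * g x)
          (volume.restrict (Ioo (0 : ℝ) 1)) := by
        refine Integrable.bdd_mul (c := ε) hgint hmeas ?_
        filter_upwards [ae_restrict_mem measurableSet_Ioo] with x hx
        rw [Complex.norm_real]; exact hP' x hx
      have e : ∫ x in Ioo (0 : ℝ) 1, (θ x : ℂ) * g x =
          ∫ x in Ioo (0 : ℝ) 1, ((θ x - P.eval (Real.cos (Real.pi * x)) : ℝ) : ℂ) * g x := by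
        rw [← add_zero (∫ x in Ioo (0 : ℝ) 1,
          ((θ x - P.eval (Real.cos (Real.pi * x)) : ℝ) : ℂ) * g x), ← (hpoly P).2,
          ← integral_add hdint (hpoly P).1]
        refine integral_congr_ae (Filter.Eventually.of_forall fun x => ?_)
        simp only; push_cast; ring
      rw [e, ← integral_const_mul]
      refine norm_integral_le_of_norm_le (hgint.norm.const_mul ε) ?_
      filter_upwards [ae_restrict_mem measurableSet_Ioo] with x hx
      rw [norm_mul, Complex.norm_real]
      exact mul_le_mul_of_nonneg_right (hP' x hx) (norm_nonneg _)
    have hI : 0 ≤ ∫ x in Ioo (0 : ℝ) 1, ‖g x‖ := integral_nonneg fun _ => norm_nonneg _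
    rw [← norm_le_zero_iff]
    refine le_of_forall_pos_le_add fun δ hδ => ?_
    rw [zero_add]
    refine (hbound (δ / ((∫ x in Ioo (0 : ℝ) 1, ‖g x‖) + 1)) (by positivity)).trans ?_
    rw [div_mul_eq_mul_div]
    exact div_le_of_le_mul₀ (by positivity) hδ.le
      (mul_le_mul_of_nonneg_left (by linarith) hδ.le)
  have hae := ae_eq_zero_of_integral_contDiff_smul_eq_zero (μ := volume.restrict (Ioo (0 : ℝ) 1))
    hgint.locallyIntegrable fun θ hθ _ => by simpa using hcont θ hθ.continuous
  refine Lp.ext ?_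
  filter_upwards [hae, ae_restrict_mem measurableSet_Ioo, Lp.coeFn_zero ℂ 2
    (volume.restrict (Ioo (0 : ℝ) 1))] with x hx hx' h0
  rw [h0]
  have hs : 0 < Real.sin (Real.pi * x) := Real.sin_pos_of_pos_of_lt_pi
    (mul_pos Real.pi_pos hx'.1) (by nlinarith [hx'.2, Real.pi_pos])
  rcases mul_eq_zero.1 hx with h1 | h1
  · exact absurd (Complex.ofReal_eq_zero.1 h1) hs.ne'
  · exact h1

lemma HSp.weightedCoeff_injective (s : ℕ) : Function.Injective (HSp.weightedCoeff s) := by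
  rw [injective_iff_map_eq_zero]
  intro ψ hψ
  have h0 : ψ.toL2 = 0 := by
    refine eq_zero_of_coeff_eq_zero fun j => ?_
    have h1 : ((j : ℂ) ^ s) * coeff j ψ.toL2 = 0 :=
      congrFun (congrArg (fun v : lp (fun _ : ℕ+ => ℂ) 2 => (v : ℕ+ → ℂ)) hψ) j
    exact (mul_eq_zero.1 h1).resolve_left (pow_ne_zero _ (by exact_mod_cast j.ne_zero))
  exact Subtype.ext h0

instance (s : ℕ) : NormedAddCommGroup (HSp s) :=
  NormedAddCommGroup.induced _ _ (HSp.weightedCoeff s) (HSp.weightedCoeff_injective s)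

instance (s : ℕ) : NormedSpace ℂ (HSp s) := NormedSpace.induced ℂ _ _ (HSp.weightedCoeff s)

/-- The norm of `H^s_{(0)}(0,1)` is the one of the definition. -/
lemma HSp.norm_eq {s : ℕ} (ψ : HSp s) : ‖ψ‖ = hNorm s ψ.toL2 := by
  have h : ‖ψ‖ = ‖HSp.weightedCoeff s ψ‖ := rfl
  rw [h, lp.norm_eq_tsum_rpow (by norm_num), hNorm, Real.sqrt_eq_rpow]
  simp [HSp.weightedCoeff, norm_pow]

lemma coeff_phiL2_of_ne {j l : ℕ+} (h : j ≠ l) : coeff j (phiL2 l) = 0 := by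
  have hjl : ((j : ℝ) - l) ≠ 0 := sub_ne_zero.2 (by exact_mod_cast h)
  have hjl' : ((j : ℝ) + l) ≠ 0 := by positivity
  have e : coeff j (phiL2 l) = ((∫ x in (0 : ℝ)..1, phi j x * phi l x : ℝ) : ℂ) := by
    rw [coeff_eq, intervalIntegral.integral_of_le zero_le_one, integral_Ioc_eq_integral_Ioo,
      ← integral_complex_ofReal]
    refine integral_congr_ae ?_
    filter_upwards [(memLp_phi l).coeFn_toLp] with x hx
    rw [phiL2, hx]; push_cast; rfl
  have e2 : ∀ x : ℝ, phi j x * phi l x =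
      Real.cos ((((j : ℝ) - l) * Real.pi) * x) - Real.cos ((((j : ℝ) + l) * Real.pi) * x) := by
    intro x
    have h2 : Real.sqrt 2 * Real.sqrt 2 = 2 := Real.mul_self_sqrt (by norm_num)
    have a1 : (((j : ℝ) - l) * Real.pi) * x = (j : ℝ) * Real.pi * x - (l : ℝ) * Real.pi * x := by
      ring
    have a2 : (((j : ℝ) + l) * Real.pi) * x = (j : ℝ) * Real.pi * x + (l : ℝ) * Real.pi * x := by
      ring
    rw [a1, a2, Real.cos_sub, Real.cos_add, phi, phi]
    linear_combination (Real.sin ((j : ℝ) * Real.pi * x) * Real.sin ((l : ℝ) * Real.pi * x)) * h2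
  have s1 : Real.sin (((j : ℝ) - l) * Real.pi) = 0 := by
    have := Real.sin_int_mul_pi ((j : ℤ) - (l : ℤ)); push_cast at this; exact this
  have s2 : Real.sin (((j : ℝ) + l) * Real.pi) = 0 := by
    have := Real.sin_int_mul_pi ((j : ℤ) + (l : ℤ)); push_cast at this; exact this
  rw [e]
  simp only [e2]
  rw [intervalIntegral.integral_sub (Continuous.intervalIntegrable (by fun_prop) _ _)
    (Continuous.intervalIntegrable (by fun_prop) _ _),
    intervalIntegral.integral_comp_mul_left _ (mul_ne_zero hjl Real.pi_ne_zero),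
    intervalIntegral.integral_comp_mul_left _ (mul_ne_zero hjl' Real.pi_ne_zero)]
  simp [s1, s2]

lemma phiL2_mem_HSub (s : ℕ) (l : ℕ+) : phiL2 l ∈ HSub s := by
  refine memℓp_gen ?_
  refine summable_of_ne_finset_zero (s := {l}) fun j hj => ?_
  rw [Finset.mem_singleton] at hj
  simp [coeff_phiL2_of_ne hj]

/-- The eigenfunction `φ_j` as an element of `H^s_{(0)}(0,1)`. -/
def phiH (s : ℕ) (j : ℕ+) : HSp s := HSp.mk (phiL2 j) (phiL2_mem_HSub s j)

/-- `H_J`, the closure in `L²(0,1)` of the complex span of the `φ_j`, `j ∈ J`. -/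
def spanJ (J : Set ℕ+) : Submodule ℂ L2Space := (Submodule.span ℂ (phiL2 '' J)).topologicalClosure

instance (J : Set ℕ+) : CompleteSpace (spanJ J) :=
  inferInstanceAs (CompleteSpace (Submodule.span ℂ (phiL2 '' J)).topologicalClosure)

/-- `P_J`, the orthogonal projection of `L²(0,1)` on `H_J`. -/
def projJ (J : Set ℕ+) : L2Space →L[ℂ] L2Space := (spanJ J).starProjection

/-- The ground state at time `t`: `ψ_1(t) = e^{-iλ_1 t} φ_1`. -/
def psi1 (t : ℝ) : L2Space := Complex.exp (-(Complex.I * eigenvalue 1 * t)) • phiL2 1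

/-- `Π_ψ(ξ) = ξ - Re⟨ξ, ψ⟩ ψ`. -/
def projTangent (ψ ξ : L2Space) : L2Space := ξ - (((inner ℂ ψ ξ).re : ℝ) : ℂ) • ψ

/-- `T_S ψ ∩ H^s_{(0)}`, where `T_S ψ = {ξ ∈ L² : Re⟨ξ, ψ⟩ = 0}` is the tangent space at `ψ` of
the unit sphere of `L²(0,1)`; a real vector space with the norm of `H^s_{(0)}`. -/
def tangentSpace (s : ℕ) (ψ : L2Space) : Submodule ℝ (HSp s) where
  carrier := {ξ | (inner ℂ ψ ξ.toL2).re = 0}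
  add_mem' := by
    intro a b ha hb
    simp only [mem_ofPred_eq, map_add, inner_add_right, Complex.add_re] at *
    rw [ha, hb, add_zero]
  zero_mem' := by simp
  smul_mem' := by
    intro c a ha
    have e : HSp.toL2 (c • a) = (c : ℂ) • HSp.toL2 a := map_smul HSp.toL2 (c : ℂ) a
    simp only [mem_ofPred_eq] at *
    rw [e, inner_smul_right, Complex.re_ofReal_mul, ha, mul_zero]

/-- `T_S ψ ∩ H_J ∩ H^s_{(0)}`. -/
def tangentSpaceJ (s : ℕ) (J : Set ℕ+) (ψ : L2Space) : Submodule ℝ (HSp s) where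
  carrier := {ξ | (inner ℂ ψ ξ.toL2).re = 0 ∧ ξ.toL2 ∈ spanJ J}
  add_mem' := fun ha hb =>
    ⟨(tangentSpace s ψ).add_mem ha.1 hb.1, by rw [map_add]; exact (spanJ J).add_mem ha.2 hb.2⟩
  zero_mem' := ⟨(tangentSpace s ψ).zero_mem, by rw [map_zero]; exact (spanJ J).zero_mem⟩
  smul_mem' := by
    intro c a ha
    have e : HSp.toL2 (c • a) = (c : ℂ) • HSp.toL2 a := map_smul HSp.toL2 (c : ℂ) a
    exact ⟨(tangentSpace s ψ).smul_mem c ha.1, by rw [e]; exact (spanJ J).smul_mem _ ha.2⟩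

/-! ### The Schrödinger equation and the end-point map -/

/-- `ψ ∈ C([0, T], L²(0,1))` is the (mild) solution of
`i ∂_t ψ = -∂_x² ψ - u(t) μ(x) ψ`, `ψ(t, 0) = ψ(t, 1) = 0`, `ψ(0) = ψ₀`, that is
`ψ(t) = e^{-iAt} ψ₀ + i ∫_0^t e^{-iA(t-τ)} (u(τ) μ ψ(τ)) dτ` for all `t ∈ [0, T]`, where `A` is the
Dirichlet Laplacian. As `e^{-iAt}` multiplies the coefficient on `φ_j` by `e^{-iλ_j t}` and
`(φ_j)` is an orthonormal basis, the identity is written coefficient by coefficient. -/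
def IsSolution (T : ℝ) (μ u : ℝ → ℝ) (ψ₀ : L2Space) (ψ : ℝ → L2Space) : Prop :=
  ContinuousOn ψ (Icc 0 T) ∧
    ∀ t ∈ Icc (0 : ℝ) T, ∀ j : ℕ+,
      coeff j (ψ t) = Complex.exp (-(Complex.I * eigenvalue j * t)) * coeff j ψ₀ +
        Complex.I * ∫ τ in (0 : ℝ)..t,
          Complex.exp (-(Complex.I * eigenvalue j * (t - τ))) * (u τ : ℂ) *
            ∫ x in Ioo (0 : ℝ) 1, (μ x : ℂ) * ψ τ x * (phi j x : ℂ)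

open Classical in
/-- The final state `ψ(T; u, ψ₀)` of the solution. -/
def finalState (T : ℝ) (μ u : ℝ → ℝ) (ψ₀ : L2Space) : L2Space :=
  if h : ∃ ψ : ℝ → L2Space, IsSolution T μ u ψ₀ ψ then h.choose T else 0

open Classical in
/-- The end-point map in projection
`Θ_T(ψ₀, u) = (ψ₀, Π_{ψ_1(T)} (P_J [ψ(T; u, ψ₀)]))`, by the same formula for all
`ψ₀ ∈ H^s_{(0)}` and not only for those of unit `L²`-norm. Its differential on the tangent space of
the unit sphere is the restriction of the differential of this map. -/
def endPointMap (T : ℝ) (μ : ℝ → ℝ) (J : Set ℕ+) (s k : ℕ) (x : HSp s × H0 k T) :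
    HSp s × HSp s :=
  (x.1,
    if h : projTangent (psi1 T)
        (projJ J (finalState T μ (controlFun x.2) x.1.toL2)) ∈ HSub s
    then HSp.mk _ h else 0)

end BilinearSchrodinger

end

open BilinearSchrodinger

noncomputable section

namespace BilinearSchrodinger

open Filter Topology

/-! With N = 2p+3 and s = N+2k, the space H^s_{(0)} is identified with ℓ² through the coordinates
j^s⟨ψ, φ_j⟩, and the proof has two independent halves.

Differentiability. Multiplication by μ does not preserve H^N_{(0)}: the odd derivatives of order
2p+1 leave boundary traces. Integrating by parts 2p+3 times shows that the defect is only of rank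
two: j^N⟨μψ, φ_j⟩ equals a(ψ) + (-1)^j b(ψ) plus a square summable sequence
(`exists_conv_structure`, `isTame_wmul`). Time integration repairs the defect, because the
exponentials e^{iλ_j t} satisfy a Bessel inequality on (0,T); hence the Duhamel operator maps
continuous curves in H^N_{(0)} to such curves, with a bound by the L² norm of the control
(`IsTame.exists_bound_aux`). For u in H^k_0 the equation is solved simultaneously for Ψ, Ψ', …,
Ψ^{(k)}. Since u is a limit of test functions, the boundary terms at time T vanish, and the k-th
time derivative of the Duhamel term at T is (-iλ_j)^k times its value; this is the gain of 2k space
derivatives (`leibniz_mem_derivTuples`, `finalDuhamel_apply_of_mem`). For small u a contraction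
gives the solution (`exists_solution`). The final state is a bounded bilinear expression in u and Ψ,
so the remainder of its expansion at (φ_1, 0) is quadratic (`hasFDerivAt_endPointMap`).

Right inverse. The differential sends u to the moments ∫ e^{i(λ_j-λ_1)t} u dt multiplied by i⟨μφ_1,
φ_j⟩ and a phase. The lower bound on these gains for j in J turns controllability into a moment
problem with frequencies 0 and ±ν_j, where ν_j = λ_{j+1}-λ_1. Take a nonnegative test function χ of
integral one and look for controls built from χ(t)e^{-iν_n t}. Their Gram matrix is I + K with
entries χ̂(ν_l-ν_n). The gaps between frequencies grow and χ̂ decays rapidly, so K is compact and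
smooths in every weighted norm. I + K is injective: its kernel is finite dimensional and stable
under multiplication by the distinct numbers ν_n, so if nonzero it would contain a vector with a
single nonzero entry, which χ̂(0) = 1 excludes (`eq_zero_of_gram_eq_zero`). The Fredholm alternative
inverts I + K for any T > 0, and smoothing of K bounds the inverse in all the weights needed
(`exists_weighted_rightInverse`).

To obtain vanishing primitives and estimates from H^{-(k+1)} to H^k with one operator, the control
is the (k+1)-st derivative of such a superposition (`exists_control_synthesis`). The zero frequency,
that is u_1(T), is supplied by one fixed test function whose further iterated primitives vanish at T
(`exists_test_moments`, `exists_moment_solution`). It is a single real condition because the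
tangency conditions make the datum at j = 1 real (`ofReal_re_momentData_one`). -/

/-- The Hilbert space `ℓ²(ι, ℂ)`. -/
abbrev Seq (ι : Type*) : Type _ := lp (fun _ : ι => ℂ) 2

/-! ### Square summable sequences and diagonal operators -/

namespace Seq

variable {ι : Type*}

lemma hasSum_norm_sq (x : Seq ι) : HasSum (fun i => ‖x i‖ ^ 2) (‖x‖ ^ 2) := by
  have := lp.hasSum_norm (p := 2) (by norm_num) x
  simpa using this

lemma summable_norm_sq (x : Seq ι) : Summable fun i => ‖x i‖ ^ 2 := (hasSum_norm_sq x).summable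

lemma sum_norm_sq_le (x : Seq ι) (s : Finset ι) : ∑ i ∈ s, ‖x i‖ ^ 2 ≤ ‖x‖ ^ 2 :=
  sum_le_hasSum s (fun _ _ => by positivity) (hasSum_norm_sq x)

lemma norm_apply_le (x : Seq ι) (i : ι) : ‖x i‖ ≤ ‖x‖ := by
  have := sum_norm_sq_le x {i}
  rw [Finset.sum_singleton] at this
  exact le_of_sq_le_sq this (norm_nonneg _)

lemma memℓp_of_sum_le {f : ι → ℂ} {C : ℝ} (h : ∀ s : Finset ι, ∑ i ∈ s, ‖f i‖ ^ 2 ≤ C) :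
    Memℓp f 2 :=
  memℓp_gen' (C := C) fun s => by simpa using h s

/-- The element of `ℓ²` with given square summable coordinates. -/
def mk (f : ι → ℂ) (h : Memℓp f 2) : Seq ι := ⟨f, h⟩

@[simp] lemma mk_apply (f : ι → ℂ) (h : Memℓp f 2) (i : ι) : mk f h i = f i := rfl

lemma norm_le_of_sum_le {x : Seq ι} {C : ℝ} (hC : 0 ≤ C)
    (h : ∀ s : Finset ι, ∑ i ∈ s, ‖x i‖ ^ 2 ≤ C ^ 2) : ‖x‖ ≤ C :=
  le_of_sq_le_sq ((hasSum_norm_sq x).tsum_eq ▸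
    (summable_norm_sq x).tsum_le_of_sum_le h) hC

/-- The coordinate functional. -/
def eval (i : ι) : Seq ι →L[ℂ] ℂ :=
  LinearMap.mkContinuous
    { toFun := fun x => x i
      map_add' := fun _ _ => rfl
      map_smul' := fun _ _ => rfl } 1 fun x => by rw [one_mul]; exact norm_apply_le x i

lemma memℓp_mul {c : ι → ℂ} {C : ℝ} (hc : ∀ i, ‖c i‖ ≤ C) (x : Seq ι) :
    Memℓp (fun i => c i * x i) 2 := by
  refine memℓp_of_sum_le (C := C ^ 2 * ‖x‖ ^ 2) fun s => ?_
  refine le_trans ?_ (mul_le_mul_of_nonneg_left (sum_norm_sq_le x s) (sq_nonneg C))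
  rw [Finset.mul_sum]
  refine Finset.sum_le_sum fun i _ => ?_
  rw [norm_mul, mul_pow]
  exact mul_le_mul_of_nonneg_right (pow_le_pow_left₀ (norm_nonneg _) (hc i) 2) (sq_nonneg _)

/-- The diagonal operator with bounded entries `c i`. -/
def diag (c : ι → ℂ) (C : ℝ) (hc : ∀ i, ‖c i‖ ≤ C) : Seq ι →L[ℂ] Seq ι :=
  LinearMap.mkContinuous
    { toFun := fun x => mk (fun i => c i * x i) (memℓp_mul hc x)
      map_add' := fun x y => by ext i; simp [mul_add]
      map_smul' := fun a x => by ext i; simp; ring } (max C 0) fun x => by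
    refine norm_le_of_sum_le (by positivity) fun s => ?_
    rw [mul_pow]
    refine le_trans ?_ (mul_le_mul_of_nonneg_left (sum_norm_sq_le x s) (sq_nonneg _))
    rw [Finset.mul_sum]
    refine Finset.sum_le_sum fun i _ => ?_
    simp only [LinearMap.coe_mk, AddHom.coe_mk, mk_apply]
    rw [norm_mul, mul_pow]
    exact mul_le_mul_of_nonneg_right (pow_le_pow_left₀ (norm_nonneg _)
      ((hc i).trans (le_max_left _ _)) 2) (sq_nonneg _)

@[simp] lemma diag_apply (c : ι → ℂ) (C : ℝ) (hc : ∀ i, ‖c i‖ ≤ C) (x : Seq ι) (i : ι) :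
    diag c C hc x i = c i * x i := rfl

/-- Finitely many modes determine a continuous map on `ℓ²`. -/
lemma eq_of_single {F : Type*} [AddCommGroup F] [TopologicalSpace F] [T2Space F] [Module ℝ F]
    [DecidableEq ι] (A B : Seq ι →L[ℝ] F)
    (h : ∀ i (c : ℂ), A (lp.single 2 i c) = B (lp.single 2 i c)) : A = B := by
  ext x
  have hx := lp.hasSum_single (p := 2) (by norm_num) x
  have h1 := (hx.map A A.continuous).tsum_eq
  have h2 := (hx.map B B.continuous).tsum_eq
  have h3 : (A ∘ fun i => lp.single 2 i (x i)) = (B ∘ fun i => lp.single 2 i (x i)) := by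
    funext i; exact h i _
  rw [← h1, ← h2, h3]

end Seq

/-! ### The orthonormal basis of eigenfunctions -/

lemma coeff_phiL2_self (j : ℕ+) : coeff j (phiL2 j) = 1 := by
  have hj : (2 * (j : ℝ) * Real.pi) ≠ 0 := by positivity
  have e : coeff j (phiL2 j) = ((∫ x in (0 : ℝ)..1, phi j x * phi j x : ℝ) : ℂ) := by
    rw [coeff_eq, intervalIntegral.integral_of_le zero_le_one, integral_Ioc_eq_integral_Ioo,
      ← integral_complex_ofReal]
    refine integral_congr_ae ?_
    filter_upwards [(memLp_phi j).coeFn_toLp] with x hx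
    rw [phiL2, hx]; push_cast; rfl
  have e2 : ∀ x : ℝ, phi j x * phi j x = 1 - Real.cos ((2 * (j : ℝ) * Real.pi) * x) := by
    intro x
    have h2 : Real.sqrt 2 * Real.sqrt 2 = 2 := Real.mul_self_sqrt (by norm_num)
    have a1 : (2 * (j : ℝ) * Real.pi) * x = 2 * ((j : ℝ) * Real.pi * x) := by ring
    rw [a1, Real.cos_two_mul, phi]
    have := Real.sin_sq_add_cos_sq ((j : ℝ) * Real.pi * x)
    linear_combination (Real.sin ((j : ℝ) * Real.pi * x) * Real.sin ((j : ℝ) * Real.pi * x)) * h2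
      + 2 * this
  have s1 : Real.sin (2 * (j : ℝ) * Real.pi) = 0 := by
    have := Real.sin_nat_mul_pi (2 * (j : ℕ)); push_cast at this; exact this
  rw [e]
  simp only [e2]
  rw [intervalIntegral.integral_sub (Continuous.intervalIntegrable (by fun_prop) _ _)
    (Continuous.intervalIntegrable (by fun_prop) _ _),
    intervalIntegral.integral_comp_mul_left _ hj]
  simp [s1]

lemma coeff_phiL2 (j l : ℕ+) : coeff j (phiL2 l) = if j = l then 1 else 0 := by
  split_ifs with h
  · rw [h, coeff_phiL2_self]
  · exact coeff_phiL2_of_ne h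

lemma orthonormal_phiL2 : Orthonormal ℂ phiL2 := by
  classical
  rw [orthonormal_iff_ite]
  exact fun i j => coeff_phiL2 i j

/-- The Hilbert basis `(φ_j)` of `L²((0, 1), ℂ)`. -/
def phiBasis : HilbertBasis ℕ+ ℂ L2Space :=
  HilbertBasis.mkOfOrthogonalEqBot orthonormal_phiL2 (by
    rw [Submodule.eq_bot_iff]
    intro ψ hψ
    refine eq_zero_of_coeff_eq_zero fun j => ?_
    exact (Submodule.mem_orthogonal _ _).1 hψ _ (Submodule.subset_span ⟨j, rfl⟩))

@[simp] lemma phiBasis_apply (j : ℕ+) : phiBasis j = phiL2 j := by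
  rw [phiBasis, HilbertBasis.coe_mkOfOrthogonalEqBot]

lemma phiBasis_repr (ψ : L2Space) (j : ℕ+) : phiBasis.repr ψ j = coeff j ψ := by
  rw [HilbertBasis.repr_apply_apply, phiBasis_apply, coeff]

lemma coeff_repr_symm (x : Seq ℕ+) (j : ℕ+) : coeff j (phiBasis.repr.symm x) = x j := by
  rw [← phiBasis_repr, LinearIsometryEquiv.apply_symm_apply]

lemma ext_coeff {ψ χ : L2Space} (h : ∀ j, coeff j ψ = coeff j χ) : ψ = χ := by
  rw [← sub_eq_zero]
  refine eq_zero_of_coeff_eq_zero fun j => ?_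
  have := h j
  rw [coeff] at *
  rw [inner_sub_right, sub_eq_zero]; exact this

lemma norm_natCast_pow_inv_le (s : ℕ) (j : ℕ+) : ‖((j : ℂ) ^ s)⁻¹‖ ≤ 1 := by
  rw [norm_inv, norm_pow]
  refine inv_le_one_of_one_le₀ (one_le_pow₀ ?_)
  have : ((j : ℕ) : ℂ) = (((j : ℕ) : ℝ) : ℂ) := by push_cast; rfl
  rw [this, Complex.norm_real, Real.norm_of_nonneg (by positivity)]
  exact_mod_cast j.pos

lemma pnat_pow_ne_zero (s : ℕ) (j : ℕ+) : ((j : ℂ) ^ s) ≠ 0 :=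
  pow_ne_zero _ (by exact_mod_cast j.ne_zero)

/-- The element of `L²(0,1)` with coefficients `j^{-s} x_j`. -/
def ofWeighted (s : ℕ) : Seq ℕ+ →L[ℂ] L2Space :=
  (phiBasis.repr.symm.toContinuousLinearEquiv : Seq ℕ+ →L[ℂ] L2Space).comp
    (Seq.diag (fun j : ℕ+ => ((j : ℂ) ^ s)⁻¹) 1 (norm_natCast_pow_inv_le s))

@[simp] lemma coeff_ofWeighted (s : ℕ) (x : Seq ℕ+) (j : ℕ+) :
    coeff j (ofWeighted s x) = ((j : ℂ) ^ s)⁻¹ * x j := by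
  simp only [ofWeighted, ContinuousLinearMap.comp_apply]
  exact coeff_repr_symm _ j

lemma ofWeighted_mem (s : ℕ) (x : Seq ℕ+) : ofWeighted s x ∈ HSub s := by
  change Memℓp (fun j : ℕ+ => ((j : ℂ) ^ s) * coeff j (ofWeighted s x)) 2
  convert lp.memℓp x using 2 with j
  rw [coeff_ofWeighted, mul_inv_cancel_left₀ (pnat_pow_ne_zero s j)]

/-- `H^s_{(0)}` is isometric to `ℓ²` through the weighted coefficients. -/
def weightedEquiv (s : ℕ) : HSp s ≃ₗᵢ[ℂ] Seq ℕ+ where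
  toFun := HSp.weightedCoeff s
  invFun x := HSp.mk (ofWeighted s x) (ofWeighted_mem s x)
  map_add' := map_add _
  map_smul' := map_smul _
  left_inv ψ := by
    apply HSp.weightedCoeff_injective
    ext j
    change ((j : ℂ) ^ s) * coeff j (ofWeighted s _) = _
    rw [coeff_ofWeighted, mul_inv_cancel_left₀ (pnat_pow_ne_zero s j)]
  right_inv x := by
    ext j
    change ((j : ℂ) ^ s) * coeff j (ofWeighted s _) = _
    rw [coeff_ofWeighted, mul_inv_cancel_left₀ (pnat_pow_ne_zero s j)]
  norm_map' ψ := rfl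

lemma weightedEquiv_apply (s : ℕ) (ψ : HSp s) (j : ℕ+) :
    weightedEquiv s ψ j = ((j : ℂ) ^ s) * coeff j ψ.toL2 := rfl

/-! ### Bessel's inequality in time -/

/-- All these exponentials have 2/π as a period, since π²·(2/π) = 2π; the interval consists of m
such periods. -/
lemma integral_exp_period {m : ℕ} {n : ℤ} (hn : n ≠ 0) :
    ∫ τ in (0 : ℝ)..(2 * m / Real.pi), Complex.exp (Complex.I * (Real.pi ^ 2 * n) * τ) = 0 := by
  have hπ : (Real.pi : ℂ) ≠ 0 := by exact_mod_cast Real.pi_ne_zero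
  have h0 : Complex.I * (Real.pi ^ 2 * n) ≠ 0 :=
    mul_ne_zero Complex.I_ne_zero (mul_ne_zero (pow_ne_zero _ hπ) (by exact_mod_cast hn))
  rw [integral_exp_mul_complex h0]
  have : Complex.I * (Real.pi ^ 2 * n) * ((2 * m / Real.pi : ℝ) : ℂ) =
      ((n * m : ℤ) : ℂ) * (2 * Real.pi * Complex.I) := by
    push_cast; field_simp
  rw [this, Complex.exp_int_mul_two_pi_mul_I]
  simp

lemma norm_exp_I_mul (a b : ℝ) : ‖Complex.exp (Complex.I * a * b)‖ = 1 := by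
  have : Complex.I * a * b = ((a * b : ℝ) : ℂ) * Complex.I := by push_cast; ring
  rw [this, Complex.norm_exp_ofReal_mul_I]

/-- Bessel's inequality for the exponentials `e^{iπ²nt}`, `n ∈ ℤ`, on `(0, T)`. -/
lemma exists_time_bessel {ι : Type*} (g : ι → ℤ) (hg : Function.Injective g) (T : ℝ) :
    ∃ C : ℝ, 0 < C ∧ ∀ F : ℝ → ℂ, MemLp F 2 (volume.restrict (Ioo 0 T)) → ∀ s : Finset ι,
      ∑ i ∈ s, ‖∫ τ in Ioo 0 T, Complex.exp (Complex.I * (Real.pi ^ 2 * g i : ℝ) * τ) * F τ‖ ^ 2 ≤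
        C * ∫ τ in Ioo 0 T, ‖F τ‖ ^ 2 := by
  classical
  -- L is a whole number of common periods 2/π with L ≥ T, so the exponentials are orthogonal on
  -- (0,L); the extra period in M = m+1 keeps L positive for every T.
  obtain ⟨m, hm⟩ := exists_nat_ge (T * Real.pi / 2)
  set M : ℕ := m + 1
  set L : ℝ := 2 * M / Real.pi with hL
  have hL0 : 0 < L := by positivity
  have hTL : T ≤ L := by
    rw [hL, le_div_iff₀ Real.pi_pos]
    have : (M : ℝ) = m + 1 := by simp [M]
    linarith
  set ν := volume.restrict (Ioo (0 : ℝ) L)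
  -- The sign -g i compensates for the conjugation in the first argument of the inner product.
  have hmem : ∀ i, MemLp (fun τ : ℝ => ((Real.sqrt L)⁻¹ : ℂ) *
      Complex.exp (Complex.I * (Real.pi ^ 2 * (-g i : ℤ) : ℝ) * τ)) 2 ν := by
    intro i
    refine MemLp.of_bound (Continuous.aestronglyMeasurable (by fun_prop)) (Real.sqrt L)⁻¹
      (Filter.Eventually.of_forall fun x => ?_)
    rw [norm_mul, norm_exp_I_mul, mul_one, norm_inv, Complex.norm_real,
      Real.norm_of_nonneg (Real.sqrt_nonneg _)]
  set v : ι → Lp ℂ 2 ν := fun i => (hmem i).toLp _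
  have hin : ∀ (i : ι) (f : Lp ℂ 2 ν), inner ℂ (v i) f = ((Real.sqrt L)⁻¹ : ℂ) *
      ∫ τ, Complex.exp (Complex.I * (Real.pi ^ 2 * g i : ℝ) * τ) * f τ ∂ν := by
    intro i f
    rw [L2.inner_def, ← integral_const_mul]
    refine integral_congr_ae ?_
    filter_upwards [(hmem i).coeFn_toLp] with x hx
    rw [hx, RCLike.inner_apply, map_mul, ← Complex.exp_conj]
    simp only [map_mul, Complex.conj_I, Complex.conj_ofReal, map_inv₀]
    push_cast; ring_nf
  have hv : Orthonormal ℂ v := by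
    rw [orthonormal_iff_ite]
    intro i j
    rw [hin]
    have e1 : ∫ τ, Complex.exp (Complex.I * (Real.pi ^ 2 * g i : ℝ) * τ) * v j τ ∂ν =
        ((Real.sqrt L)⁻¹ : ℂ) * ∫ τ in (0 : ℝ)..L,
          Complex.exp (Complex.I * (Real.pi ^ 2 * (g i - g j : ℤ)) * τ) := by
      rw [intervalIntegral.integral_of_le hL0.le, integral_Ioc_eq_integral_Ioo,
        ← integral_const_mul]
      refine integral_congr_ae ?_
      filter_upwards [(hmem j).coeFn_toLp] with x hx
      rw [hx, mul_left_comm, ← Complex.exp_add]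
      congr 2; push_cast; ring
    rw [e1]
    split_ifs with h
    · subst h
      have : (Real.sqrt L : ℂ) * Real.sqrt L = L := by
        exact_mod_cast Real.mul_self_sqrt hL0.le
      have h0 : (Real.sqrt L : ℂ) ≠ 0 := by
        exact_mod_cast (Real.sqrt_pos.2 hL0).ne'
      simp only [sub_self, Int.cast_zero, mul_zero, zero_mul, Complex.exp_zero]
      rw [intervalIntegral.integral_const, sub_zero, Complex.real_smul, mul_one, ← this]
      field_simp
    · rw [integral_exp_period (sub_ne_zero.2 fun h' => h (hg h')), mul_zero, mul_zero]
  refine ⟨L, hL0, fun F hF s => ?_⟩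
  -- Extension by zero from (0,T) to (0,L) changes neither the norm nor the integrals.
  set F' : ℝ → ℂ := (Ioo 0 T).indicator F
  have hsub : Ioo (0 : ℝ) T ⊆ Ioo 0 L := Ioo_subset_Ioo_right hTL
  have hF' : MemLp F' 2 ν := by
    rw [memLp_indicator_iff_restrict measurableSet_Ioo, Measure.restrict_restrict measurableSet_Ioo,
      inter_eq_self_of_subset_left hsub]
    exact hF
  have key : ∀ G : ℝ → ℂ, ∫ τ, (Ioo 0 T).indicator G τ ∂ν = ∫ τ in Ioo 0 T, G τ := by
    intro G
    rw [integral_indicator measurableSet_Ioo, Measure.restrict_restrict measurableSet_Ioo,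
      inter_eq_self_of_subset_left hsub]
  have hb := hv.sum_inner_products_le (x := hF'.toLp _) (s := s)
  have hn : ‖hF'.toLp F'‖ ^ 2 = ∫ τ in Ioo 0 T, ‖F τ‖ ^ 2 := by
    have h1 := inner_self_eq_norm_sq_to_K (𝕜 := ℂ) (hF'.toLp F')
    rw [L2.inner_def] at h1
    have h2 : ∫ a, inner ℂ (hF'.toLp F' a) (hF'.toLp F' a) ∂ν =
        ∫ τ in Ioo 0 T, ((‖F τ‖ ^ 2 : ℝ) : ℂ) := by
      rw [← key]
      refine integral_congr_ae ?_
      filter_upwards [hF'.coeFn_toLp] with x hx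
      rw [hx, inner_self_eq_norm_sq_to_K]
      by_cases hx' : x ∈ Ioo 0 T <;> simp [F', hx']
    rw [h2, integral_complex_ofReal] at h1
    refine Complex.ofReal_injective (h1.trans ?_).symm
    push_cast; rfl
  rw [hn] at hb
  have hsq : ‖((Real.sqrt L)⁻¹ : ℂ)‖ ^ 2 = L⁻¹ := by
    rw [norm_inv, Complex.norm_real, inv_pow, Real.norm_of_nonneg (Real.sqrt_nonneg _),
      Real.sq_sqrt hL0.le]
  have hterm : ∀ i, ‖inner ℂ (v i) (hF'.toLp F')‖ ^ 2 = L⁻¹ *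
      ‖∫ τ in Ioo 0 T, Complex.exp (Complex.I * (Real.pi ^ 2 * g i : ℝ) * τ) * F τ‖ ^ 2 := by
    intro i
    rw [hin, norm_mul, mul_pow, hsq, ← key]
    congr 3
    refine integral_congr_ae ?_
    filter_upwards [hF'.coeFn_toLp] with x hx
    rw [hx]
    by_cases hx' : x ∈ Ioo 0 T <;> simp [F', hx']
  simp only [hterm] at hb
  rw [← Finset.mul_sum, inv_mul_le_iff₀ hL0] at hb
  exact hb

/-! ### Weak derivatives on an interval -/

namespace IsTestFunction

variable {a b : ℝ} {θ : ℝ → ℝ}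

lemma exists_Icc (h : IsTestFunction a b θ) (hab : a < b) :
    ∃ a' b', a < a' ∧ a' ≤ b' ∧ b' < b ∧ ∀ x, x ∉ Icc a' b' → θ x = 0 := by
  rcases (tsupport θ).eq_empty_or_nonempty with h0 | h0
  · refine ⟨(a + b) / 2, (a + b) / 2, by linarith, le_rfl, by linarith, fun x _ => ?_⟩
    exact image_eq_zero_of_notMem_tsupport (by simp [h0])
  · obtain ⟨u, hu⟩ := h.2.1.isCompact.exists_isLeast h0
    obtain ⟨v, hv⟩ := h.2.1.isCompact.exists_isGreatest h0
    exact ⟨u, v, (h.2.2 hu.1).1, hu.2 hv.1, (h.2.2 hv.1).2, fun x hx =>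
      image_eq_zero_of_notMem_tsupport fun hx' => hx ⟨hu.2 hx', hv.2 hx'⟩⟩

lemma of_Icc (h : ContDiff ℝ ∞ θ) {a' b' : ℝ} (ha : a < a') (hb : b' < b)
    (h0 : ∀ x, x ∉ Icc a' b' → θ x = 0) : IsTestFunction a b θ := by
  refine ⟨h, HasCompactSupport.intro isCompact_Icc h0, ?_⟩
  refine (closure_minimal (fun x hx => ?_) isClosed_Icc).trans (Icc_subset_Ioo ha hb)
  by_contra h1
  exact hx (h0 x h1)

lemma continuous (h : IsTestFunction a b θ) : Continuous θ := h.1.continuous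

lemma eq_zero_of_notMem (h : IsTestFunction a b θ) {x : ℝ} (hx : x ∉ Ioo a b) : θ x = 0 :=
  image_eq_zero_of_notMem_tsupport fun h' => hx (h.2.2 h')

lemma apply_left (h : IsTestFunction a b θ) : θ a = 0 := h.eq_zero_of_notMem (by simp)

lemma apply_right (h : IsTestFunction a b θ) : θ b = 0 := h.eq_zero_of_notMem (by simp)

lemma deriv (h : IsTestFunction a b θ) : IsTestFunction a b (deriv θ) :=
  ⟨(contDiff_infty_iff_deriv.1 h.1).2, h.2.1.deriv, (tsupport_deriv_subset).trans h.2.2⟩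

lemma iteratedDeriv (h : IsTestFunction a b θ) (n : ℕ) :
    IsTestFunction a b (iteratedDeriv n θ) := by
  induction n with
  | zero => simpa using h
  | succ n ih => rw [iteratedDeriv_succ]; exact ih.deriv

lemma add {χ : ℝ → ℝ} (h : IsTestFunction a b θ) (h' : IsTestFunction a b χ) :
    IsTestFunction a b (fun x => θ x + χ x) :=
  ⟨h.1.add h'.1, h.2.1.add h'.2.1, (tsupport_add θ χ).trans (union_subset h.2.2 h'.2.2)⟩

lemma const_mul (h : IsTestFunction a b θ) (c : ℝ) : IsTestFunction a b (fun x => c * θ x) :=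
  ⟨contDiff_const.mul h.1, h.2.1.mul_left,
    (closure_mono (fun _ hx => right_ne_zero_of_mul hx)).trans h.2.2⟩

lemma integral_Ioo (h : IsTestFunction a b θ) : ∫ x in Ioo a b, θ x = ∫ x, θ x :=
  setIntegral_eq_integral_of_forall_compl_eq_zero fun _ hx => h.eq_zero_of_notMem hx

lemma integrable (h : IsTestFunction a b θ) : Integrable θ :=
  h.continuous.integrable_of_hasCompactSupport h.2.1

lemma exists_bound (h : IsTestFunction a b θ) : ∃ C : ℝ, 0 ≤ C ∧ ∀ x, |θ x| ≤ C := by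
  obtain ⟨C, hC⟩ := h.2.1.exists_bound_of_continuous h.continuous
  exact ⟨C, (norm_nonneg _).trans (hC 0), hC⟩

lemma memLp (h : IsTestFunction a b θ) : MemLp θ 2 (volume.restrict (Ioo a b)) := by
  obtain ⟨C, -, hC⟩ := h.exists_bound
  exact MemLp.of_bound h.continuous.aestronglyMeasurable C (Eventually.of_forall hC)

/-- The primitive of a test function of mean zero is a test function. -/
lemma primitive (h : IsTestFunction a b θ) (hab : a < b) (h0 : ∫ x, θ x = 0) :
    IsTestFunction a b (fun x => ∫ y in a..x, θ y) ∧
      ∀ x, HasDerivAt (fun x => ∫ y in a..x, θ y) (θ x) x := by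
  have hd : ∀ x, HasDerivAt (fun x => ∫ y in a..x, θ y) (θ x) x := fun x =>
    intervalIntegral.integral_hasDerivAt_right (h.continuous.intervalIntegrable _ _)
      (h.continuous.stronglyMeasurableAtFilter _ _) h.continuous.continuousAt
  refine ⟨?_, hd⟩
  obtain ⟨a', b', ha, hab', hb, hz⟩ := h.exists_Icc hab
  refine of_Icc (a' := a') (b' := b') ?_ ha hb fun x hx => ?_
  · rw [contDiff_infty_iff_deriv]
    refine ⟨fun x => (hd x).differentiableAt, ?_⟩
    rw [show _root_.deriv (fun x => ∫ y in a..x, θ y) = θ from funext fun x => (hd x).deriv]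
    exact h.1
  · rcases le_or_gt a' x with h1 | h1
    · have h2 : b' < x := by
        by_contra h3
        exact hx ⟨h1, not_lt.1 h3⟩
      rw [← h0, intervalIntegral.integral_of_le (by linarith)]
      refine setIntegral_eq_integral_of_forall_compl_eq_zero fun y hy => hz y fun hy' => hy ?_
      exact ⟨by linarith [hy'.1], by linarith [hy'.2]⟩
    · rw [intervalIntegral.integral_congr (g := fun _ => 0), intervalIntegral.integral_zero]
      intro y hy
      refine hz y fun hy' => ?_
      have : y ≤ max a x := hy.2
      exact absurd (this.trans_lt (max_lt ha h1)) (not_lt.2 hy'.1)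

end IsTestFunction

lemma exists_test_bump {a b : ℝ} (hab : a < b) :
    ∃ θ : ℝ → ℝ, IsTestFunction a b θ ∧ ∫ x, θ x = 1 ∧ ∀ x, 0 ≤ θ x := by
  set f : ContDiffBump ((a + b) / 2) := ⟨(b - a) / 8, (b - a) / 4, by linarith, by linarith⟩
  refine ⟨f.normed volume, ⟨f.contDiff_normed, f.hasCompactSupport_normed, ?_⟩,
    f.integral_normed, f.nonneg_normed⟩
  rw [f.tsupport_normed_eq, Real.closedBall_eq_Icc]
  change Icc ((a + b) / 2 - (b - a) / 4) ((a + b) / 2 + (b - a) / 4) ⊆ _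
  exact Icc_subset_Ioo (by linarith) (by linarith)

/-- The lemma of du Bois-Reymond. -/
lemma ae_eq_const_of_integral_mul_deriv_eq_zero {a b : ℝ} (hab : a < b) {f : ℝ → ℝ}
    (hf : IntegrableOn f (Ioo a b))
    (h : ∀ θ, IsTestFunction a b θ → ∫ x in Ioo a b, f x * deriv θ x = 0) :
    ∃ c : ℝ, ∀ᵐ x ∂volume.restrict (Ioo a b), f x = c := by
  obtain ⟨θ₀, hθ₀, h1, -⟩ := exists_test_bump hab
  have hint : ∀ g, IsTestFunction a b g → IntegrableOn (fun x => f x * g x) (Ioo a b) := by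
    intro g hg
    obtain ⟨C, -, hC⟩ := hg.exists_bound
    exact Integrable.mul_bdd (c := C) hf hg.continuous.aestronglyMeasurable (Eventually.of_forall hC)
  set c := ∫ x in Ioo a b, f x * θ₀ x with hc
  refine ⟨c, ?_⟩
  have key : ∀ᵐ x, x ∈ Ioo a b → f x - c = 0 := by
    refine isOpen_Ioo.ae_eq_zero_of_integral_contDiff_smul_eq_zero
      (IntegrableOn.locallyIntegrableOn (hf.sub (integrableOn_const (by simp)))) ?_
    intro φ h2 h3 h4
    have hφ : IsTestFunction a b φ := ⟨h2, h3, h4⟩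
    set I := ∫ x, φ x
    -- Subtracting I·θ₀ makes the mean zero, so the result is the derivative of a test function and
    -- the hypothesis applies to it.
    have hη : IsTestFunction a b (fun x => φ x + (-I) * θ₀ x) := hφ.add (hθ₀.const_mul _)
    have hη0 : ∫ x, (φ x + (-I) * θ₀ x) = 0 := by
      rw [integral_add hφ.integrable (hθ₀.const_mul _).integrable, integral_const_mul, h1]
      simp [I]
    obtain ⟨hp, hd⟩ := hη.primitive hab hη0
    have h5 := h _ hp
    simp only [fun x => (hd x).deriv] at h5
    have e : ∀ x, f x * (φ x + (-I) * θ₀ x) = f x * φ x - I * (f x * θ₀ x) := fun x => by ring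
    simp only [e] at h5
    rw [integral_sub (hint _ hφ) ((hint _ hθ₀).const_mul _), integral_const_mul, ← hc] at h5
    have h6 : ∫ x, φ x • (f x - c) = ∫ x in Ioo a b, φ x • (f x - c) :=
      (setIntegral_eq_integral_of_forall_compl_eq_zero fun x hx => by
        rw [hφ.eq_zero_of_notMem hx, zero_smul]).symm
    have e2 : ∀ x, φ x • (f x - c) = f x * φ x - c * φ x := fun x => by
      rw [smul_eq_mul]; ring
    rw [h6]
    simp only [e2]
    rw [integral_sub (hint _ hφ) (hφ.integrable.integrableOn.const_mul _), integral_const_mul,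
      hφ.integral_Ioo]
    linarith
  rw [ae_restrict_iff' measurableSet_Ioo]
  filter_upwards [key] with x hx hx'
  linarith [hx hx']

/-- Integration by parts of a primitive against a smooth function. -/
lemma integral_primitive_mul_deriv {a b : ℝ} (hab : a ≤ b) {g W e : ℝ → ℝ}
    (hg : IntervalIntegrable g volume a b) (he : ContDiff ℝ 1 e)
    (hW : ∀ x ∈ Icc a b, W x = W a + ∫ y in a..x, g y) :
    ∫ x in a..b, W x * deriv e x = W b * e b - W a * e a - ∫ x in a..b, g x * e x := by
  set P : ℝ → ℝ := fun x => ∫ y in a..x, g y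
  have hP : AbsolutelyContinuousOnInterval P a b :=
    hg.absolutelyContinuousOnInterval_intervalIntegral left_mem_uIcc
  have hE : AbsolutelyContinuousOnInterval e a b := by
    exact (he.contDiffOn).absolutelyContinuousOnInterval
  have h := hP.integral_mul_deriv_eq_deriv_mul hE
  have hde : Continuous (deriv e) := he.continuous_deriv le_rfl
  have h1 : ∫ x in a..b, deriv P x * e x = ∫ x in a..b, g x * e x := by
    refine intervalIntegral.integral_congr_ae ?_
    filter_upwards [hg.ae_hasDerivAt_integral] with x hx hx'
    rw [(hx (uIoc_subset_uIcc hx') a left_mem_uIcc).deriv]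
  have h2 : ∫ x in a..b, W x * deriv e x =
      W a * (e b - e a) + ∫ x in a..b, P x * deriv e x := by
    rw [← intervalIntegral.integral_deriv_eq_sub (fun x _ => he.differentiable one_ne_zero x)
      (hde.intervalIntegrable _ _), ← intervalIntegral.integral_const_mul,
      ← intervalIntegral.integral_add ((hde.intervalIntegrable _ _).const_mul _)
        ((hde.intervalIntegrable _ _).continuousOn_mul hP.continuousOn)]
    refine intervalIntegral.integral_congr fun x hx => ?_
    rw [uIcc_of_le hab] at hx
    simp only [hW x hx]
    ring
  have h3 : P a = 0 := intervalIntegral.integral_same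
  rw [h2, h, h1, h3, hW b (right_mem_Icc.2 hab)]
  ring

lemma IsWeakDeriv.succ {a b : ℝ} {n : ℕ} {f g g' : ℝ → ℝ} (h : IsWeakDeriv a b n f g)
    (h' : IsWeakDeriv a b (n + 1) f g') {θ : ℝ → ℝ} (hθ : IsTestFunction a b θ) :
    ∫ x in Ioo a b, g x * deriv θ x = - ∫ x in Ioo a b, g' x * θ x := by
  have h1 := h _ hθ.deriv
  have h2 := h' _ hθ
  rw [iteratedDeriv_succ'] at h2
  rw [h1, pow_succ] at h2
  have h3 : ((-1 : ℝ) ^ n) ≠ 0 := pow_ne_zero _ (by norm_num)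
  apply mul_left_cancel₀ h3
  linarith

lemma MemLp.intervalIntegrable_Ioo {a b : ℝ} (hab : a ≤ b) {E : Type*} [NormedAddCommGroup E]
    {f : ℝ → E} (hf : MemLp f 2 (volume.restrict (Ioo a b))) :
    IntervalIntegrable f volume a b := by
  rw [intervalIntegrable_iff_integrableOn_Ioo_of_le hab]
  exact hf.integrable one_le_two

/-- Two consecutive weak derivatives: the first is the primitive of the second. -/
lemma IsWeakDeriv.exists_primitive {a b : ℝ} (hab : a < b) {n : ℕ} {f g g' : ℝ → ℝ}
    (hg : MemLp g 2 (volume.restrict (Ioo a b))) (hg' : MemLp g' 2 (volume.restrict (Ioo a b)))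
    (h : IsWeakDeriv a b n f g) (h' : IsWeakDeriv a b (n + 1) f g') :
    ∃ c : ℝ, ∀ᵐ x ∂volume.restrict (Ioo a b), g x = c + ∫ y in a..x, g' y := by
  have hi := MemLp.intervalIntegrable_Ioo hab.le hg'
  set P : ℝ → ℝ := fun x => ∫ y in a..x, g' y
  have hPc : ContinuousOn P (Icc a b) := by
    have := intervalIntegral.continuousOn_primitive_interval' hi left_mem_uIcc
    rwa [uIcc_of_le hab.le] at this
  have hPi : IntegrableOn P (Ioo a b) :=
    (hPc.integrableOn_compact isCompact_Icc).mono_set Ioo_subset_Icc_self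
  have hgi : IntegrableOn g (Ioo a b) := hg.integrable one_le_two
  -- The difference between g and the primitive of g' has zero weak derivative.
  obtain ⟨c, hc⟩ := ae_eq_const_of_integral_mul_deriv_eq_zero hab (f := fun x => g x - P x)
    (hgi.sub hPi) (by
      intro θ hθ
      have hb : ∀ u : ℝ → ℝ, IntegrableOn u (Ioo a b) →
          IntegrableOn (fun x => u x * deriv θ x) (Ioo a b) := by
        intro u hu
        obtain ⟨C, -, hC⟩ := hθ.deriv.exists_bound
        exact Integrable.mul_bdd (c := C) hu hθ.deriv.continuous.aestronglyMeasurable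
          (Eventually.of_forall hC)
      simp only [sub_mul]
      rw [integral_sub (hb _ hgi) (hb _ hPi), h.succ h' hθ]
      have := integral_primitive_mul_deriv hab.le (W := P) hi (hθ.1.of_le (by simp))
        (fun x _ => by simp [P])
      rw [hθ.apply_left, hθ.apply_right, intervalIntegral.integral_of_le hab.le,
        intervalIntegral.integral_of_le hab.le, integral_Ioc_eq_integral_Ioo,
        integral_Ioc_eq_integral_Ioo] at this
      rw [this]; ring)
  exact ⟨c, hc.mono fun x hx => by linarith [hx]⟩

lemma IsWeakDeriv.congr {a b : ℝ} {n : ℕ} {f g g' : ℝ → ℝ} (h : IsWeakDeriv a b n f g)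
    (hgg : ∀ᵐ x ∂volume.restrict (Ioo a b), g x = g' x) : IsWeakDeriv a b n f g' := by
  intro θ hθ
  rw [h θ hθ]
  congr 1
  exact integral_congr_ae (hgg.mono fun x hx => by simp only [hx])

lemma IsWeakDeriv.ae_eq {a b : ℝ} {n : ℕ} {f g g' : ℝ → ℝ} (h : IsWeakDeriv a b n f g)
    (h' : IsWeakDeriv a b n f g') (hg : IntegrableOn g (Ioo a b))
    (hg' : IntegrableOn g' (Ioo a b)) :
    ∀ᵐ x ∂volume.restrict (Ioo a b), g x = g' x := by
  rw [ae_restrict_iff' measurableSet_Ioo]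
  have key : ∀ᵐ x, x ∈ Ioo a b → g x - g' x = 0 := by
    refine isOpen_Ioo.ae_eq_zero_of_integral_contDiff_smul_eq_zero
      (IntegrableOn.locallyIntegrableOn (hg.sub hg')) ?_
    intro φ h2 h3 h4
    have hφ : IsTestFunction a b φ := ⟨h2, h3, h4⟩
    have hint : ∀ u, IntegrableOn u (Ioo a b) → IntegrableOn (fun x => u x * φ x) (Ioo a b) := by
      intro u hu
      obtain ⟨C, -, hC⟩ := hφ.exists_bound
      exact Integrable.mul_bdd (c := C) hu hφ.continuous.aestronglyMeasurable (Eventually.of_forall hC)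
    have h6 : ∫ x, φ x • (g x - g' x) = ∫ x in Ioo a b, φ x • (g x - g' x) :=
      (setIntegral_eq_integral_of_forall_compl_eq_zero fun x hx => by
        rw [hφ.eq_zero_of_notMem hx, zero_smul]).symm
    have e2 : ∀ x, φ x • (g x - g' x) = g x * φ x - g' x * φ x := fun x => by
      rw [smul_eq_mul]; ring
    rw [h6]
    simp only [e2]
    rw [integral_sub (hint _ hg) (hint _ hg'), sub_eq_zero]
    have h7 := (h φ hφ).symm.trans (h' φ hφ)
    exact mul_left_cancel₀ (pow_ne_zero _ (by norm_num)) h7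
  filter_upwards [key] with x hx hx'
  linarith [hx hx']

/-- A function of `H^N(0,1)` has representatives `W 0, …, W N` of its weak derivatives, each being
a primitive of the next one. -/
lemma MemSobolev.exists_representatives {a b : ℝ} (hab : a < b) {N : ℕ} {f : ℝ → ℝ}
    (hf : MemSobolev a b N f) :
    ∃ W : ℕ → ℝ → ℝ, (∀ n ≤ N, MemLp (W n) 2 (volume.restrict (Ioo a b))) ∧
      (∀ n ≤ N, IsWeakDeriv a b n f (W n)) ∧
      (∀ n < N, ∀ x ∈ Icc a b, W n x = W n a + ∫ y in a..x, W (n + 1) y) ∧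
      ∀ n < N, ContinuousOn (W n) (Icc a b) := by
  have hex : ∀ n, ∃ g : ℝ → ℝ, n ≤ N →
      MemLp g 2 (volume.restrict (Ioo a b)) ∧ IsWeakDeriv a b n f g := by
    intro n
    by_cases hn : n ≤ N
    · obtain ⟨g, hg⟩ := hf.2 n hn
      exact ⟨g, fun _ => hg⟩
    · exact ⟨0, fun h => absurd h hn⟩
  choose g hg using hex
  have hc : ∀ n, ∃ c : ℝ, n < N →
      ∀ᵐ x ∂volume.restrict (Ioo a b), g n x = c + ∫ y in a..x, g (n + 1) y := by
    intro n
    by_cases hn : n < N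
    · obtain ⟨c, hc⟩ := IsWeakDeriv.exists_primitive hab (hg n hn.le).1 (hg (n + 1) hn).1
        (hg n hn.le).2 (hg (n + 1) hn).2
      exact ⟨c, fun _ => hc⟩
    · exact ⟨0, fun h => absurd h hn⟩
  choose c hc using hc
  -- Below the top order the representative is the primitive itself, hence continuous; the
  -- derivative of order N is only in L² and is kept as it is.
  set W : ℕ → ℝ → ℝ := fun n => if n < N then fun x => c n + ∫ y in a..x, g (n + 1) y else g n
  have hWg : ∀ n ≤ N, ∀ᵐ x ∂volume.restrict (Ioo a b), g n x = W n x := by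
    intro n hn
    by_cases h : n < N
    · simpa [W, h] using hc n h
    · simp [W, h]
  have hprim : ∀ n < N, ∀ x ∈ Icc a b, ∫ y in a..x, g (n + 1) y = ∫ y in a..x, W (n + 1) y := by
    intro n hn x hx
    rw [intervalIntegral.integral_of_le hx.1, intervalIntegral.integral_of_le hx.1,
      integral_Ioc_eq_integral_Ioo, integral_Ioc_eq_integral_Ioo]
    exact integral_congr_ae (ae_restrict_of_ae_restrict_of_subset
      (Ioo_subset_Ioo_right hx.2) (hWg (n + 1) hn))
  refine ⟨W, fun n hn => (memLp_congr_ae (hWg n hn)).1 (hg n hn).1,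
    fun n hn => (hg n hn).2.congr (hWg n hn), fun n hn x hx => ?_, fun n hn => ?_⟩
  · rw [← hprim n hn x hx]
    simp [W, hn]
  · have hi := MemLp.intervalIntegrable_Ioo hab.le (hg (n + 1) hn).1
    have := intervalIntegral.continuousOn_primitive_interval' hi left_mem_uIcc
    rw [uIcc_of_le hab.le] at this
    have h2 : W n = fun x => c n + ∫ y in a..x, g (n + 1) y := by simp [W, hn]
    rw [h2]
    exact continuousOn_const.add this

/-- Two continuous representatives of one weak derivative agree almost everywhere on the open
interval, hence everywhere on the closed one, so they share their end-point values. -/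
lemma DerivVanishesAtEndpoints.representative_eq_zero {a b : ℝ} (hab : a < b) {n : ℕ}
    {f W : ℝ → ℝ} (h : DerivVanishesAtEndpoints a b n f) (hW : IsWeakDeriv a b n f W)
    (hWc : ContinuousOn W (Icc a b)) : W a = 0 ∧ W b = 0 := by
  obtain ⟨g, hgc, hg, ha, hb⟩ := h
  have hint : ∀ u : ℝ → ℝ, ContinuousOn u (Icc a b) → IntegrableOn u (Ioo a b) := fun u hu =>
    (hu.integrableOn_compact isCompact_Icc).mono_set Ioo_subset_Icc_self
  have hae := hW.ae_eq hg (hint _ hWc) (hint _ hgc)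
  have h1 : EqOn W g (Icc a b) := by
    refine Measure.eqOn_of_ae_eq (μ := volume) ?_ hWc hgc ?_
    · rw [← restrict_Ioo_eq_restrict_Icc]; exact hae
    · rw [interior_Icc, closure_Ioo hab.ne]
  exact ⟨(h1 (left_mem_Icc.2 hab.le)).trans ha, (h1 (right_mem_Icc.2 hab.le)).trans hb⟩

/-! ### Cosine coefficients of the potential -/

/-- The cosine coefficients `∫_0^1 μ(x) cos(nπx) dx`. -/
def cosCoeff (μ : ℝ → ℝ) (n : ℤ) : ℝ := ∫ x in (0 : ℝ)..1, μ x * Real.cos (n * Real.pi * x)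

/-- The sine coefficients `∫_0^1 μ(x) sin(nπx) dx`. -/
def sinCoeff (μ : ℝ → ℝ) (n : ℤ) : ℝ := ∫ x in (0 : ℝ)..1, μ x * Real.sin (n * Real.pi * x)

lemma sinCoeff_neg (μ : ℝ → ℝ) (n : ℤ) : sinCoeff μ (-n) = -sinCoeff μ n := by
  rw [sinCoeff, sinCoeff, ← intervalIntegral.integral_neg]
  refine intervalIntegral.integral_congr fun x _ => ?_
  simp

/-- For n ≥ 1 these are, up to the factor √2, the coordinates of w in the basis φ_n, so Parseval
applies; oddness in n covers the negative indices. -/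
lemma summable_sinCoeff_sq {w : ℝ → ℝ} (hw : MemLp w 2 (volume.restrict (Ioo (0 : ℝ) 1))) :
    Summable fun n : ℤ => sinCoeff w n ^ 2 := by
  have hw' : MemLp (fun x => (w x : ℂ)) 2 (volume.restrict (Ioo (0 : ℝ) 1)) := hw.ofReal
  have hc : ∀ j : ℕ+, ‖coeff j (hw'.toLp _)‖ ^ 2 = 2 * sinCoeff w (j : ℤ) ^ 2 := by
    intro j
    have : coeff j (hw'.toLp _) = ((Real.sqrt 2 * sinCoeff w (j : ℤ) : ℝ) : ℂ) := by
      rw [coeff_eq, sinCoeff, intervalIntegral.integral_of_le zero_le_one,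
        integral_Ioc_eq_integral_Ioo, ← integral_const_mul, ← integral_complex_ofReal]
      refine integral_congr_ae ?_
      filter_upwards [hw'.coeFn_toLp] with x hx
      rw [hx, phi]
      push_cast; ring
    rw [this, Complex.norm_real, Real.norm_eq_abs, sq_abs, mul_pow, Real.sq_sqrt (by norm_num)]
  have h1 : Summable fun j : ℕ+ => sinCoeff w (j : ℤ) ^ 2 := by
    have := Seq.summable_norm_sq (phiBasis.repr (hw'.toLp _))
    simp only [phiBasis_repr, hc] at this
    exact (summable_mul_left_iff (by norm_num)).1 this
  have h2 : Summable fun n : ℕ => sinCoeff w (n : ℤ) ^ 2 := by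
    exact (summable_pnat_iff_summable_nat (f := fun n : ℕ => sinCoeff w (n : ℤ) ^ 2)).1 h1
  refine Summable.of_nat_of_neg h2 ?_
  simpa [sinCoeff_neg] using h2

/-- Integration by parts against sin(nπx), which vanishes at both ends: no trace of W appears. -/
lemma mul_cosCoeff {g W : ℝ → ℝ} (hg : MemLp g 2 (volume.restrict (Ioo (0 : ℝ) 1)))
    (hW : ∀ x ∈ Icc (0 : ℝ) 1, W x = W 0 + ∫ y in (0 : ℝ)..x, g y) (n : ℤ) :
    n * Real.pi * cosCoeff W n = - sinCoeff g n := by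
  have := integral_primitive_mul_deriv zero_le_one (MemLp.intervalIntegrable_Ioo zero_le_one hg)
    (e := fun x => Real.sin (n * Real.pi * x)) (by fun_prop) hW
  have hd : ∀ x, deriv (fun x => Real.sin (n * Real.pi * x)) x =
      n * Real.pi * Real.cos (n * Real.pi * x) := by
    intro x
    simp [mul_comm]
  simp only [hd, mul_one, mul_zero, Real.sin_zero, Real.sin_int_mul_pi] at this
  rw [cosCoeff, sinCoeff, ← intervalIntegral.integral_const_mul]
  rw [sub_zero, zero_sub] at this
  rw [← this]
  refine intervalIntegral.integral_congr fun x _ => ?_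
  ring

/-- Here the boundary values of cos(nπx) are 1 and (-1)^n, and the traces of W survive. Applied to
odd derivatives, this is the only source of boundary terms. -/
lemma mul_sinCoeff {g W : ℝ → ℝ} (hg : MemLp g 2 (volume.restrict (Ioo (0 : ℝ) 1)))
    (hW : ∀ x ∈ Icc (0 : ℝ) 1, W x = W 0 + ∫ y in (0 : ℝ)..x, g y) (n : ℤ) :
    n * Real.pi * sinCoeff W n = W 0 - (-1) ^ n * W 1 + cosCoeff g n := by
  have := integral_primitive_mul_deriv zero_le_one (MemLp.intervalIntegrable_Ioo zero_le_one hg)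
    (e := fun x => -Real.cos (n * Real.pi * x)) (by fun_prop) hW
  have hd : ∀ x, deriv (fun x => -Real.cos (n * Real.pi * x)) x =
      n * Real.pi * Real.sin (n * Real.pi * x) := by
    intro x
    simp [mul_comm]
  simp only [hd, mul_one, mul_zero, Real.cos_zero, Real.cos_int_mul_pi, mul_neg,
    intervalIntegral.integral_neg] at this
  rw [cosCoeff, sinCoeff, ← intervalIntegral.integral_const_mul]
  have h2 : ∫ x in (0 : ℝ)..1, n * Real.pi * (W x * Real.sin (n * Real.pi * x)) =
      ∫ x in (0 : ℝ)..1, W x * (n * Real.pi * Real.sin (n * Real.pi * x)) :=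
    intervalIntegral.integral_congr fun x _ => by ring
  rw [h2, this]; ring

/-- Asymptotic expansion of the cosine coefficients of a potential whose first `p` odd derivatives
vanish at the end-points. -/
lemma exists_cosCoeff_expansion {p N : ℕ} (hN : 2 * p + 3 ≤ N) {μ : ℝ → ℝ}
    (hμ : MemSobolev 0 1 N μ)
    (hμbc : ∀ n < p, DerivVanishesAtEndpoints 0 1 (2 * n + 1) μ) :
    ∃ (A B : ℝ) (ρ : ℤ → ℝ), (Summable fun n => ρ n ^ 2) ∧
      ∀ n : ℤ, (n : ℝ) ^ (2 * p + 3) * cosCoeff μ n = n * (A + (-1) ^ n * B) + ρ n := by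
  obtain ⟨W, hWm, hWd, hWp, hWc⟩ := hμ.exists_representatives zero_lt_one
  have hbc : ∀ q < p, W (2 * q + 1) 0 = 0 ∧ W (2 * q + 1) 1 = 0 := fun q hq =>
    (hμbc q hq).representative_eq_zero zero_lt_one (hWd _ (by omega)) (hWc _ (by omega))
  have h0 : ∀ n, cosCoeff μ n = cosCoeff (W 0) n := by
    intro n
    have hμi : IntegrableOn μ (Ioo 0 1) := hμ.1.integrable one_le_two
    have hae := IsWeakDeriv.ae_eq (n := 0) (f := μ) (g := μ) (g' := W 0)
      (fun θ _ => by simp) (hWd 0 (Nat.zero_le _)) hμi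
      ((hWm 0 (Nat.zero_le _)).integrable one_le_two)
    rw [cosCoeff, cosCoeff, intervalIntegral.integral_of_le zero_le_one,
      intervalIntegral.integral_of_le zero_le_one, integral_Ioc_eq_integral_Ioo,
      integral_Ioc_eq_integral_Ioo]
    exact integral_congr_ae (hae.mono fun x hx => by simp only [hx])
  have hstep : ∀ q, 2 * q + 1 < N → ∀ n : ℤ, (n * Real.pi) ^ 2 * cosCoeff (W (2 * q)) n =
      (-1) ^ n * W (2 * q + 1) 1 - W (2 * q + 1) 0 - cosCoeff (W (2 * q + 2)) n := by
    intro q hq n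
    have e1 := mul_cosCoeff (hWm (2 * q + 1) (by omega)) (hWp (2 * q) (by omega)) n
    have e2 := mul_sinCoeff (hWm (2 * q + 1 + 1) (by omega)) (hWp (2 * q + 1) (by omega)) n
    linear_combination (n * Real.pi) * e1 - e2
  -- The odd traces of orders 1, 3, …, 2p-1 vanish by hypothesis, so the first p double integrations
  -- by parts cost nothing.
  have hpow : ∀ q ≤ p, ∀ n : ℤ, (n * Real.pi) ^ (2 * q) * cosCoeff μ n =
      (-1) ^ q * cosCoeff (W (2 * q)) n := by
    intro q
    induction q with
    | zero => intro _ n; simp [h0]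
    | succ q ih =>
      intro hq n
      have e1 := ih (by omega) n
      have e2 := hstep q (by omega) n
      rw [(hbc q (by omega)).1, (hbc q (by omega)).2] at e2
      have e3 : 2 * (q + 1) = 2 * q + 2 := by ring
      rw [e3, pow_succ (-1 : ℝ) q, pow_add]
      linear_combination (n * Real.pi) ^ 2 * e1 + (-1) ^ q * e2
  have hπ : Real.pi ≠ 0 := Real.pi_ne_zero
  -- A and B come from the traces of the derivative of order 2p+1 at 0 and 1; ρ is a multiple of the
  -- sine coefficients of the derivative of order 2p+3, which is merely square integrable.
  refine ⟨-((-1) ^ p * Real.pi * W (2 * p + 1) 0) / Real.pi ^ (2 * p + 3),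
    ((-1) ^ p * Real.pi * W (2 * p + 1) 1) / Real.pi ^ (2 * p + 3),
    fun n => ((-1) ^ p / Real.pi ^ (2 * p + 3)) * sinCoeff (W (2 * p + 3)) n, ?_, fun n => ?_⟩
  · simp only [mul_pow]
    exact (summable_sinCoeff_sq (hWm _ hN)).mul_left _
  · have e1 := hpow p le_rfl n
    have e2 := hstep p (by omega) n
    have e3 := mul_cosCoeff (hWm (2 * p + 3) (by omega)) (hWp (2 * p + 2) (by omega)) n
    have e4 : (n * Real.pi) ^ (2 * p + 3) * cosCoeff μ n = (-1) ^ p * (n * Real.pi *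
        ((-1) ^ n * W (2 * p + 1) 1 - W (2 * p + 1) 0) + sinCoeff (W (2 * p + 3)) n) := by
      have e5 : 2 * p + 3 = 2 * p + 1 + 1 + 1 := by ring
      rw [e5, pow_succ, pow_succ, pow_succ]
      linear_combination (n * Real.pi) ^ 3 * e1 + (-1) ^ p * (n * Real.pi) * e2 - (-1) ^ p * e3
    rw [mul_pow] at e4
    field_simp
    linear_combination e4

/-- By 2 sin a sin b = cos(a-b) - cos(a+b), the matrix of multiplication by μ is a Toeplitz matrix
minus a Hankel matrix built from the same coefficients. -/
lemma integral_mul_phi_mul_phi {μ : ℝ → ℝ} (hμ : MemLp μ 2 (volume.restrict (Ioo (0 : ℝ) 1)))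
    (j l : ℕ+) : ∫ x in Ioo (0 : ℝ) 1, μ x * phi j x * phi l x =
      cosCoeff μ ((j : ℤ) - l) - cosCoeff μ ((j : ℤ) + l) := by
  have hi := MemLp.intervalIntegrable_Ioo zero_le_one hμ
  rw [cosCoeff, cosCoeff, ← intervalIntegral.integral_sub
    (hi.mul_continuousOn (Continuous.continuousOn (by fun_prop)))
    (hi.mul_continuousOn (Continuous.continuousOn (by fun_prop))),
    intervalIntegral.integral_of_le zero_le_one, integral_Ioc_eq_integral_Ioo]
  refine integral_congr_ae (Eventually.of_forall fun x => ?_)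
  have h2 : Real.sqrt 2 * Real.sqrt 2 = 2 := Real.mul_self_sqrt (by norm_num)
  have a1 : (((j : ℤ) - l : ℤ) : ℝ) * Real.pi * x =
      (j : ℝ) * Real.pi * x - (l : ℝ) * Real.pi * x := by push_cast; ring
  have a2 : (((j : ℤ) + l : ℤ) : ℝ) * Real.pi * x =
      (j : ℝ) * Real.pi * x + (l : ℝ) * Real.pi * x := by push_cast; ring
  simp only [a1, a2, Real.cos_sub, Real.cos_add, phi]
  linear_combination (μ x * Real.sin ((j : ℝ) * Real.pi * x) *
    Real.sin ((l : ℝ) * Real.pi * x)) * h2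

/-! ### Convolution with the cosine coefficients -/

lemma hasSum_of_eq {ι : Type*} {f g : ι → ℂ} {a : ℂ} (h : HasSum f a) (hfg : ∀ i, f i = g i) :
    HasSum g a := funext hfg ▸ h

namespace Seq

variable {ι : Type*}

lemma summable_norm_mul_norm (c x : Seq ι) :
    (Summable fun i => ‖c i‖ * ‖x i‖) ∧ ∑' i, ‖c i‖ * ‖x i‖ ≤ ‖c‖ * ‖x‖ := by
  have key : ∀ s : Finset ι, ∑ i ∈ s, ‖c i‖ * ‖x i‖ ≤ ‖c‖ * ‖x‖ := by
    intro s
    refine le_of_sq_le_sq ?_ (by positivity)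
    rw [mul_pow]
    exact (Finset.sum_mul_sq_le_sq_mul_sq s _ _).trans
      (mul_le_mul (sum_norm_sq_le c s) (sum_norm_sq_le x s) (by positivity) (by positivity))
  have hs := summable_of_sum_le (fun i => by positivity) key
  exact ⟨hs, hs.tsum_le_of_sum_le key⟩

lemma summable_mul (c x : Seq ι) : Summable fun i => c i * x i := by
  refine Summable.of_norm ?_
  simpa only [norm_mul] using (summable_norm_mul_norm c x).1

/-- The bilinear pairing with a fixed element of `ℓ²`. -/
def pair (c : Seq ι) : Seq ι →L[ℂ] ℂ :=
  LinearMap.mkContinuous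
    { toFun := fun x => ∑' i, c i * x i
      map_add' := fun x y => by
        rw [← (summable_mul c x).tsum_add (summable_mul c y)]
        exact tsum_congr fun i => by simp [mul_add]
      map_smul' := fun a x => by
        rw [RingHom.id_apply, smul_eq_mul, ← tsum_mul_left]
        exact tsum_congr fun i => by simp; ring } ‖c‖ fun x => by
    have h := summable_norm_mul_norm c x
    refine le_trans ?_ h.2
    simp only [← norm_mul] at h ⊢
    exact norm_tsum_le_tsum_norm h.1

lemma hasSum_pair (c x : Seq ι) : HasSum (fun i => c i * x i) (pair c x) :=
  (summable_mul c x).hasSum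

lemma memℓp_of_eventually_le {f : ι → ℂ} {g : ι → ℝ} (hg : Summable g)
    (h : ∀ᶠ i in cofinite, ‖f i‖ ^ 2 ≤ g i) : Memℓp f 2 := by
  refine memℓp_gen ?_
  refine Summable.of_norm_bounded_eventually hg ?_
  filter_upwards [h] with i hi
  simpa using hi

lemma memℓp_of_le_div {f : ℤ → ℂ} (K : ℝ) (h : ∀ n : ℤ, n ≠ 0 → ‖f n‖ ≤ K / |(n : ℝ)|) :
    Memℓp f 2 := by
  refine memℓp_of_eventually_le (g := fun n : ℤ => K ^ 2 * (1 / (n : ℝ) ^ 2))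
    ((Real.summable_one_div_int_pow.2 (by norm_num)).mul_left _) ?_
  filter_upwards [(Set.finite_singleton (0 : ℤ)).compl_mem_cofinite] with n hn
  refine (pow_le_pow_left₀ (norm_nonneg _) (h n hn) 2).trans_eq ?_
  rw [div_pow, sq_abs]; ring

/-- Young's inequality `ℓ¹ * ℓ² ⊆ ℓ²`. -/
lemma exists_conv {a : ℤ → ℂ} (ha : Summable fun n => ‖a n‖) (b : Seq ℤ) :
    ∃ y : Seq ℤ, ‖y‖ ≤ (∑' n, ‖a n‖) * ‖b‖ ∧ ∀ j, HasSum (fun l => a l * b (j - l)) (y j) := by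
  have hm : ∀ l : ℤ, ∀ s : Finset ℤ, ∑ j ∈ s, ‖b (j - l)‖ ^ 2 ≤ ‖b‖ ^ 2 := by
    intro l s
    refine le_trans (le_of_eq ?_) (sum_norm_sq_le b (s.map (Equiv.subRight l).toEmbedding))
    rw [Finset.sum_map]; rfl
  -- The convolution is an absolutely convergent series in ℓ² of translates of b, all of norm at
  -- most that of b.
  set sh : ℤ → Seq ℤ := fun l => mk (fun j => b (j - l)) (memℓp_of_sum_le (hm l))
  have hsh : ∀ l, ‖sh l‖ ≤ ‖b‖ := fun l => norm_le_of_sum_le (norm_nonneg _) (hm l)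
  have hle : ∀ l, ‖a l • sh l‖ ≤ ‖a l‖ * ‖b‖ := fun l => by
    rw [norm_smul]; exact mul_le_mul_of_nonneg_left (hsh l) (norm_nonneg _)
  have hs : Summable fun l => a l • sh l := Summable.of_norm_bounded (ha.mul_right _) hle
  refine ⟨∑' l, a l • sh l, ?_, fun j => ?_⟩
  · rw [← tsum_mul_right]
    exact tsum_of_norm_bounded (ha.mul_right _).hasSum hle
  · exact hs.hasSum.map (eval j) (eval j).continuous

lemma exists_conv' {a : ℤ → ℂ} (ha : Summable fun n => ‖a n‖) (b : Seq ℤ) :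
    ∃ y : Seq ℤ, ‖y‖ ≤ (∑' n, ‖a n‖) * ‖b‖ ∧ ∀ j, HasSum (fun l => a (j - l) * b l) (y j) := by
  obtain ⟨y, hy, h⟩ := exists_conv ha b
  refine ⟨y, hy, fun j => ?_⟩
  have := (Equiv.subLeft j).hasSum_iff.2 (h j)
  convert this using 2 with l
  simp

/-- The coordinates of the even extension to `ℤ` of a sequence on `ℕ+`. -/
def evenExtFun (x : ℕ+ → ℂ) (l : ℤ) : ℂ :=
  if h : l = 0 then 0 else x ⟨l.natAbs, Int.natAbs_pos.2 h⟩

lemma evenExtFun_pnat (x : ℕ+ → ℂ) (n : ℕ+) : evenExtFun x (n : ℤ) = x n := by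
  rw [evenExtFun, dif_neg (by simp)]; rfl

lemma evenExtFun_neg (x : ℕ+ → ℂ) (l : ℤ) : evenExtFun x (-l) = evenExtFun x l := by
  simp [evenExtFun]

lemma sum_norm_evenExtFun_le (x : Seq ℕ+) (s : Finset ℤ) :
    ∑ l ∈ s, ‖evenExtFun x l‖ ^ 2 ≤ (2 * ‖x‖) ^ 2 := by
  set f : ℤ → ℝ := fun l => ‖evenExtFun x l‖ ^ 2
  have hf0 : f 0 = 0 := by simp [f, evenExtFun]
  have hfp : ∀ n : ℕ+, f (n : ℤ) = ‖x n‖ ^ 2 := fun n => by simp only [f, evenExtFun_pnat]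
  have hfn : ∀ l, f (-l) = f l := fun l => by simp only [f, evenExtFun_neg]
  have hs0 := summable_norm_sq x
  have h1 : Summable fun n : ℕ => f (n : ℤ) :=
    (summable_pnat_iff_summable_nat (f := fun n : ℕ => f (n : ℤ))).1 (by simpa only [hfp] using hs0)
  have hs : Summable f := Summable.of_nat_of_neg h1 (by simpa only [hfn] using h1)
  refine (hs.sum_le_tsum s fun _ _ => by positivity).trans ?_
  rw [tsum_int_eq_zero_add_tsum_pnat hs, hf0]
  simp only [hfn, hfp, (hasSum_norm_sq x).tsum_eq]
  nlinarith [sq_nonneg ‖x‖]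

/-- The even extension to `ℤ` of a sequence on `ℕ+`. -/
def evenExt : Seq ℕ+ →L[ℂ] Seq ℤ :=
  LinearMap.mkContinuous
    { toFun := fun x => mk (evenExtFun x) (memℓp_of_sum_le (sum_norm_evenExtFun_le x))
      map_add' := fun x y => by
        ext l
        by_cases h : l = 0
        · simp [evenExtFun, h]
        · simp only [mk_apply, evenExtFun, dif_neg h, lp.coeFn_add, Pi.add_apply]
          rfl
      map_smul' := fun a x => by
        ext l
        by_cases h : l = 0
        · simp [evenExtFun, h]
        · simp only [mk_apply, evenExtFun, dif_neg h, lp.coeFn_smul, Pi.smul_apply,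
            RingHom.id_apply]
          rfl } 2 fun x =>
    norm_le_of_sum_le (by positivity) (sum_norm_evenExtFun_le x)

lemma norm_evenExt_le (x : Seq ℕ+) : ‖evenExt x‖ ≤ 2 * ‖x‖ :=
  (evenExt.le_opNorm x).trans (mul_le_mul_of_nonneg_right
    (LinearMap.mkContinuous_norm_le _ (by norm_num) _) (norm_nonneg _))

@[simp] lemma evenExt_zero (x : Seq ℕ+) : evenExt x 0 = 0 := rfl

lemma evenExt_pnat (x : Seq ℕ+) (n : ℕ+) : evenExt x (n : ℤ) = x n := evenExtFun_pnat x n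

lemma evenExt_neg (x : Seq ℕ+) (l : ℤ) : evenExt x (-l) = evenExt x l := evenExtFun_neg x l

end Seq

lemma neg_one_zpow_sub (j l : ℤ) : ((-1 : ℂ)) ^ (j - l) = (-1) ^ j * (-1) ^ l := by
  rw [zpow_sub₀ (by norm_num), div_eq_mul_inv]
  congr 1
  rcases Int.even_or_odd l with h | h
  · rw [h.neg_one_zpow, inv_one]
  · rw [h.neg_one_zpow]; norm_num

lemma norm_neg_one_zpow (l : ℤ) : ‖((-1 : ℂ)) ^ l‖ = 1 := by
  rw [norm_zpow, norm_neg, norm_one, one_zpow]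

lemma one_le_abs_intCast {n : ℤ} (hn : n ≠ 0) : 1 ≤ |(n : ℝ)| := by
  exact_mod_cast Int.one_le_abs hn

lemma memℓp_intCast_pow_inv {i : ℕ} (hi : 1 ≤ i) : Memℓp (fun l : ℤ => ((l : ℂ) ^ i)⁻¹) 2 := by
  refine Seq.memℓp_of_le_div 1 fun n hn => ?_
  have h1 := one_le_abs_intCast hn
  rw [norm_inv, norm_pow, Complex.norm_intCast, one_div]
  exact inv_anti₀ (by linarith) (le_self_pow₀ h1 (by omega))

/-- The sequence `l^{-i}` on `ℤ`. -/
def invPow (i : ℕ) (hi : 1 ≤ i) : Seq ℤ := Seq.mk _ (memℓp_intCast_pow_inv hi)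

/-- The sequence `(-1)^l l^{-i}` on `ℤ`. -/
def altInvPow (i : ℕ) (hi : 1 ≤ i) : Seq ℤ :=
  Seq.mk _ (Seq.memℓp_mul (c := fun l : ℤ => (-1) ^ l) (C := 1)
    (fun l => (norm_neg_one_zpow l).le) (invPow i hi))

/-- The functional `∑_l l^{-i} x_{|l|}`. -/
def sumInvPow (i : ℕ) (hi : 1 ≤ i) : Seq ℕ+ →L[ℂ] ℂ := (Seq.pair (invPow i hi)).comp Seq.evenExt

/-- The functional `∑_l (-1)^l l^{-i} x_{|l|}`. -/
def sumAltInvPow (i : ℕ) (hi : 1 ≤ i) : Seq ℕ+ →L[ℂ] ℂ :=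
  (Seq.pair (altInvPow i hi)).comp Seq.evenExt

lemma hasSum_sumInvPow {i : ℕ} (hi : 1 ≤ i) (x : Seq ℕ+) :
    HasSum (fun l : ℤ => ((l : ℂ) ^ i)⁻¹ * Seq.evenExt x l) (sumInvPow i hi x) :=
  Seq.hasSum_pair (invPow i hi) (Seq.evenExt x)

lemma hasSum_sumAltInvPow {i : ℕ} (hi : 1 ≤ i) (x : Seq ℕ+) :
    HasSum (fun l : ℤ => (-1) ^ l * (((l : ℂ) ^ i)⁻¹ * Seq.evenExt x l)) (sumAltInvPow i hi x) := by
  have := Seq.hasSum_pair (altInvPow i hi) (Seq.evenExt x)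
  refine hasSum_of_eq this fun l => ?_
  exact mul_assoc _ _ _

lemma summable_norm_invPow_mul {i : ℕ} (hi : 1 ≤ i) (x : Seq ℕ+) :
    (Summable fun l : ℤ => ‖((l : ℂ) ^ i)⁻¹ * Seq.evenExt x l‖) ∧
      ∑' l : ℤ, ‖((l : ℂ) ^ i)⁻¹ * Seq.evenExt x l‖ ≤ ‖invPow i hi‖ * (2 * ‖x‖) := by
  have h := Seq.summable_norm_mul_norm (invPow i hi) (Seq.evenExt x)
  have e : (fun l : ℤ => ‖((l : ℂ) ^ i)⁻¹ * Seq.evenExt x l‖) =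
      fun l => ‖invPow i hi l‖ * ‖Seq.evenExt x l‖ := funext fun l => norm_mul _ _
  rw [e]
  exact ⟨h.1, h.2.trans (mul_le_mul_of_nonneg_left (Seq.norm_evenExt_le x) (norm_nonneg _))⟩

lemma hasSum_zero_of_odd {f : ℤ → ℂ} (hf : Summable f) (hfo : ∀ l, f (-l) = - f l) :
    HasSum f 0 := by
  have h4 := (Equiv.neg ℤ).tsum_eq f
  simp only [Equiv.neg_apply, hfo, tsum_neg] at h4
  have h5 : ∑' l, f l = 0 := by
    have : (2 : ℂ) * ∑' l, f l = 0 := by linear_combination -h4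
    simpa using this
  rw [← h5]; exact hf.hasSum

/-- A kernel without decay is harmless when it is constant or alternating: (-1)^{j-l} factors, and
the convolution depends on j only through 1 and (-1)^j. -/
lemma hasSum_const_kernel {i : ℕ} (hi : 1 ≤ i) (A B : ℂ) (x : Seq ℕ+) (j : ℤ) :
    HasSum (fun l : ℤ => (A + (-1) ^ (j - l) * B) * (((l : ℂ) ^ i)⁻¹ * Seq.evenExt x l))
      (A * sumInvPow i hi x + (-1) ^ j * (B * sumAltInvPow i hi x)) := by
  have := ((hasSum_sumInvPow hi x).mul_left A).add
    (((hasSum_sumAltInvPow hi x).mul_left B).mul_left ((-1) ^ j))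
  refine hasSum_of_eq this fun l => ?_
  rw [neg_one_zpow_sub]; ring

/-- The growing factor j multiplies sums of l^{-(i+1)} x_{|l|}, with or without (-1)^l, which are
odd in l and vanish. Only the factor -l remains, and it lowers the power to l^{-i}. -/
lemma hasSum_linear_kernel {i : ℕ} (hi : 1 ≤ i) (hodd : Odd (i + 1)) (A B : ℂ) (x : Seq ℕ+)
    (j : ℤ) :
    HasSum (fun l : ℤ => (((j - l : ℤ) : ℂ) * (A + (-1) ^ (j - l) * B)) *
      (((l : ℂ) ^ (i + 1))⁻¹ * Seq.evenExt x l))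
      (-(A * sumInvPow i hi x + (-1) ^ j * (B * sumAltInvPow i hi x))) := by
  set G : ℤ → ℂ := fun l => ((l : ℂ) ^ (i + 1))⁻¹ * Seq.evenExt x l with hG
  have hGs1 : Summable fun l => ‖G l‖ := (summable_norm_invPow_mul (Nat.le_add_left 1 i) x).1
  have hGo : ∀ l, G (-l) = -G l := by
    intro l
    simp only [hG, Seq.evenExt_neg, Int.cast_neg, hodd.neg_pow, inv_neg, neg_mul]
  have hG2 : Summable fun l : ℤ => (-1 : ℂ) ^ l * G l := by
    refine Summable.of_norm ?_
    simpa only [norm_mul, norm_neg_one_zpow, one_mul] using hGs1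
  have t₀ := hasSum_zero_of_odd hGs1.of_norm hGo
  have t₁ := hasSum_zero_of_odd hG2 (fun l => by
    rw [hGo, mul_neg, ← zero_sub l, neg_one_zpow_sub]; simp)
  have hlG : ∀ l : ℤ, (l : ℂ) * G l = ((l : ℂ) ^ i)⁻¹ * Seq.evenExt x l := by
    intro l
    by_cases hl : l = 0
    · subst hl; simp [hG]
    · have hl' : (l : ℂ) ≠ 0 := by exact_mod_cast hl
      simp only [hG, pow_succ]
      field_simp
  have := ((t₀.mul_left ((j : ℂ) * A)).add (t₁.mul_left ((j : ℂ) * ((-1) ^ j * B)))).sub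
    (((hasSum_sumInvPow hi x).mul_left A).add
      (((hasSum_sumAltInvPow hi x).mul_left B).mul_left ((-1) ^ j)))
  rw [mul_zero, mul_zero, add_zero, zero_sub] at this
  refine hasSum_of_eq this fun l => ?_
  rw [← hlG, neg_one_zpow_sub]
  push_cast; ring

/-- `j^N (m * F)_j`, where `F` is the odd extension of `l^{-N} x_l` and `m` has a two-term
asymptotic expansion, is square summable up to `a + (-1)^j b`. -/
theorem exists_conv_structure {N : ℕ} (hN : Odd N) (h3 : 3 ≤ N) {m : ℤ → ℂ} {A B : ℂ}
    {ρ : Seq ℤ} (h : ∀ n : ℤ, (n : ℂ) ^ N * m n = n * (A + (-1) ^ n * B) + ρ n) :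
    (Summable fun n => ‖m n‖) ∧
    ∃ (a b : Seq ℕ+ →L[ℂ] ℂ) (C : ℝ), 0 ≤ C ∧ ∀ x, ∃ Y : Seq ℤ, ‖Y‖ ≤ C * ‖x‖ ∧
      ∀ j : ℤ, HasSum (fun l : ℤ => (j : ℂ) ^ N * (m (j - l) * (((l : ℂ) ^ N)⁻¹ * Seq.evenExt x l)))
        (a x + (-1) ^ j * b x + Y j) := by
  set K : ℝ := ‖A‖ + ‖B‖ + ‖ρ‖ with hK
  have hK0 : 0 ≤ K := by positivity
  have hnorm1 : ∀ n : ℤ, n ≠ 0 → 1 ≤ |(n : ℝ)| := fun n hn => one_le_abs_intCast hn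
  have hAB : ∀ n : ℤ, ‖A + (-1) ^ n * B‖ ≤ ‖A‖ + ‖B‖ := fun n => by
    refine (norm_add_le _ _).trans ?_
    rw [norm_mul, norm_neg_one_zpow, one_mul]
  have hcast : ∀ n : ℤ, ‖(n : ℂ)‖ = |(n : ℝ)| := fun n => by
    rw [Complex.norm_intCast]
  -- One power is sacrificed to the factor n in front of A + (-1)^n B. As N ≥ 3, the decay
  -- n^{-(N-1)} is summable.
  have hbase : ∀ n : ℤ, n ≠ 0 → |(n : ℝ)| ^ (N - 1) * ‖m n‖ ≤ K := by
    intro n hn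
    have h1 := hnorm1 n hn
    have h2 : |(n : ℝ)| * (|(n : ℝ)| ^ (N - 1) * ‖m n‖) ≤ |(n : ℝ)| * K := by
      rw [← mul_assoc, ← pow_succ', Nat.sub_add_cancel (by omega), ← hcast, ← norm_pow, ← norm_mul,
        h n, hK]
      refine (norm_add_le _ _).trans ?_
      rw [norm_mul, hcast, mul_add]
      refine add_le_add (mul_le_mul_of_nonneg_left (hAB n) (abs_nonneg _)) ?_
      exact (Seq.norm_apply_le ρ n).trans (le_mul_of_one_le_left (norm_nonneg _) h1)
    exact le_of_mul_le_mul_left h2 (by linarith)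
  have hpow : ∀ i, i ≤ N - 2 → ∀ n : ℤ, n ≠ 0 → ‖(n : ℂ) ^ i * m n‖ ≤ K / |(n : ℝ)| := by
    intro i hi n hn
    have h1 := hnorm1 n hn
    rw [norm_mul, norm_pow, hcast, le_div_iff₀ (by linarith)]
    calc |(n : ℝ)| ^ i * ‖m n‖ * |(n : ℝ)| = |(n : ℝ)| ^ (i + 1) * ‖m n‖ := by ring
      _ ≤ |(n : ℝ)| ^ (N - 1) * ‖m n‖ := mul_le_mul_of_nonneg_right
          (pow_le_pow_right₀ h1 (by omega)) (norm_nonneg _)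
      _ ≤ K := hbase n hn
  have hm1 : Summable fun n => ‖m n‖ := by
    refine Summable.of_norm_bounded_eventually (g := fun n : ℤ => K * (1 / (n : ℝ) ^ 2))
      ((Real.summable_one_div_int_pow.2 (by norm_num)).mul_left _) ?_
    filter_upwards [(Set.finite_singleton (0 : ℤ)).compl_mem_cofinite] with n hn
    have h1 := hnorm1 n hn
    rw [norm_norm, mul_one_div, le_div_iff₀ (by rw [← sq_abs]; positivity), ← sq_abs, mul_comm]
    exact (mul_le_mul_of_nonneg_right (pow_le_pow_right₀ h1 (by omega)) (norm_nonneg _)).trans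
      (hbase n hn)
  refine ⟨hm1, ?_⟩
  have hN1 : 1 ≤ N - 1 := by omega
  set s₀ : Seq ℕ+ →L[ℂ] ℂ := sumInvPow (N - 1) hN1 with hs₀
  set s₁ : Seq ℕ+ →L[ℂ] ℂ := sumAltInvPow (N - 1) hN1 with hs₁
  -- Dividing the expansion by n leaves the remainder ρ_n/n for n ≠ 0; the single index 0 does not
  -- affect summability.
  have hσm : Memℓp (fun n : ℤ => (n : ℂ) ^ (N - 1) * m n - (A + (-1) ^ n * B)) 2 := by
    refine Seq.memℓp_of_eventually_le (Seq.summable_norm_sq ρ) ?_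
    filter_upwards [(Set.finite_singleton (0 : ℤ)).compl_mem_cofinite] with n hn
    have hn' : (n : ℂ) ≠ 0 := by exact_mod_cast hn
    have h1 := hnorm1 n hn
    have e : (n : ℂ) ^ (N - 1) * m n - (A + (-1) ^ n * B) = ρ n / n := by
      have h2 := h n
      rw [← Nat.sub_add_cancel (show 1 ≤ N by omega), pow_succ] at h2
      field_simp
      linear_combination h2
    rw [e, norm_div, hcast]
    exact pow_le_pow_left₀ (by positivity) (div_le_self (norm_nonneg _) h1) 2
  set σ : Seq ℤ := Seq.mk _ hσm
  have hker : ∀ i, ∃ α : Seq ℤ, 1 ≤ i → i ≤ N → ∀ n : ℤ, (n : ℂ) ^ i * m n = α n +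
      (if i = N - 1 then A + (-1) ^ n * B else if i = N then n * (A + (-1) ^ n * B) else 0) := by
    intro i
    by_cases hi : 1 ≤ i ∧ i ≤ N
    · by_cases h1 : i = N - 1
      · refine ⟨σ, fun _ _ n => ?_⟩
        rw [if_pos h1, h1]; simp [σ]
      by_cases h2 : i = N
      · refine ⟨ρ, fun _ _ n => ?_⟩
        rw [if_neg h1, if_pos h2, h2, h n]; ring
      · refine ⟨Seq.mk _ (Seq.memℓp_of_le_div K (hpow i (by omega))), fun _ _ n => ?_⟩
        rw [if_neg h1, if_neg h2]; simp
    · exact ⟨0, fun h4 h5 => absurd ⟨h4, h5⟩ hi⟩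
  choose α hα using hker
  -- Piece i of the binomial expansion convolves n^i m with l^{-i}x. For i = 0 the first factor is
  -- in ℓ¹; for i ≥ 1 the second one is, and n^i m is in ℓ² up to the explicit kernels at i = N-1
  -- and i = N. Young's inequality treats every ℓ² part.
  have hpiece : ∀ i, ∃ C : ℝ, 0 ≤ C ∧ ∀ x : Seq ℕ+, ∃ Y : Seq ℤ, ‖Y‖ ≤ C * ‖x‖ ∧ (i ≤ N → ∀ j : ℤ,
      HasSum (fun l : ℤ => ((j - l : ℤ) : ℂ) ^ i * m (j - l) * (((l : ℂ) ^ i)⁻¹ * Seq.evenExt x l))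
        (Y j + (if i = N - 1 then A * s₀ x + (-1) ^ j * (B * s₁ x) else
          if i = N then - (A * s₀ x + (-1) ^ j * (B * s₁ x)) else 0))) := by
    intro i
    rcases Nat.eq_zero_or_pos i with rfl | hi
    · refine ⟨(∑' n, ‖m n‖) * 2, by positivity, fun x => ?_⟩
      obtain ⟨Y, hY, hs⟩ := Seq.exists_conv' hm1 (Seq.evenExt x)
      refine ⟨Y, hY.trans ?_, fun _ j => ?_⟩
      · rw [mul_assoc]
        exact mul_le_mul_of_nonneg_left (Seq.norm_evenExt_le x) (by positivity)
      · rw [if_neg (by omega), if_neg (by omega), add_zero]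
        simpa using hs j
    · by_cases hiN : i ≤ N
      swap
      · exact ⟨0, le_rfl, fun x => ⟨0, by simp, fun h' => absurd h' hiN⟩⟩
      refine ⟨‖invPow i hi‖ * 2 * ‖α i‖, by positivity, fun x => ?_⟩
      obtain ⟨hG1, hG2⟩ := summable_norm_invPow_mul hi x
      obtain ⟨Y, hY, hs⟩ := Seq.exists_conv hG1 (α i)
      refine ⟨Y, hY.trans ?_, fun _ j => ?_⟩
      · calc _ ≤ (‖invPow i hi‖ * (2 * ‖x‖)) * ‖α i‖ :=
              mul_le_mul_of_nonneg_right hG2 (norm_nonneg _)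
          _ = _ := by ring
      · have hext : HasSum (fun l : ℤ => (if i = N - 1 then A + (-1) ^ (j - l) * B else
            if i = N then ((j - l : ℤ) : ℂ) * (A + (-1) ^ (j - l) * B) else 0) *
              (((l : ℂ) ^ i)⁻¹ * Seq.evenExt x l))
            (if i = N - 1 then A * s₀ x + (-1) ^ j * (B * s₁ x) else
              if i = N then - (A * s₀ x + (-1) ^ j * (B * s₁ x)) else 0) := by
          by_cases h1 : i = N - 1
          · simp only [if_pos h1]
            subst h1
            exact hasSum_const_kernel hN1 A B x j
          by_cases h2 : i = N
          · simp only [if_neg h1, if_pos h2]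
            have h5 := hasSum_linear_kernel hN1 (by rwa [Nat.sub_add_cancel (by omega)]) A B x j
            rw [Nat.sub_add_cancel (by omega)] at h5
            rw [h2]
            exact h5
          · simp only [if_neg h1, if_neg h2, zero_mul]
            exact hasSum_zero
        refine hasSum_of_eq ((hs j).add hext) fun l => ?_
        rw [hα i hi hiN]
        ring
  choose C hC Y hYn hYs using hpiece
  -- The rank-two terms enter with the binomial coefficient N from i = N-1 and with -1 from i = N.
  set c : ℂ := (N : ℂ) - 1
  refine ⟨(c * A) • s₀, (c * B) • s₁, ∑ i ∈ Finset.range (N + 1), (N.choose i : ℝ) * C i,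
    Finset.sum_nonneg fun i _ => mul_nonneg (by positivity) (hC i), fun x =>
      ⟨∑ i ∈ Finset.range (N + 1), (N.choose i : ℂ) • Y i x, ?_, fun j => ?_⟩⟩
  · rw [Finset.sum_mul]
    refine (norm_sum_le _ _).trans (Finset.sum_le_sum fun i _ => ?_)
    rw [norm_smul, Complex.norm_natCast, mul_assoc]
    exact mul_le_mul_of_nonneg_left (hYn i x) (by positivity)
  · have hsum := hasSum_sum (s := Finset.range (N + 1)) fun i hi =>
      ((hYs i x (by simpa [Nat.lt_succ_iff] using hi) j).mul_left (N.choose i : ℂ))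
    have e : (∑ i ∈ Finset.range (N + 1), (N.choose i : ℂ) * (Y i x j +
        (if i = N - 1 then A * s₀ x + (-1) ^ j * (B * s₁ x) else
          if i = N then - (A * s₀ x + (-1) ^ j * (B * s₁ x)) else 0))) =
        ((c * A) • s₀) x + (-1) ^ j * ((c * B) • s₁) x +
          (∑ i ∈ Finset.range (N + 1), (N.choose i : ℂ) • Y i x) j := by
      have e1 : (∑ i ∈ Finset.range (N + 1), (N.choose i : ℂ) • Y i x) j =
          ∑ i ∈ Finset.range (N + 1), (N.choose i : ℂ) * Y i x j := by
        rw [lp.coeFn_sum, Finset.sum_apply]; rfl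
      rw [e1]
      simp only [mul_add, Finset.sum_add_distrib]
      obtain ⟨N', rfl⟩ : ∃ N', N = N' + 1 := ⟨N - 1, by omega⟩
      have e2 : ∑ i ∈ Finset.range (N' + 1 + 1), ((N' + 1).choose i : ℂ) *
          (if i = N' + 1 - 1 then A * s₀ x + (-1) ^ j * (B * s₁ x) else
          if i = N' + 1 then - (A * s₀ x + (-1) ^ j * (B * s₁ x)) else 0) =
          c * (A * s₀ x + (-1) ^ j * (B * s₁ x)) := by
        rw [Finset.sum_range_succ, Finset.sum_range_succ, Finset.sum_eq_zero]
        · simp [c]; ring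
        · intro i hi
          rw [Finset.mem_range] at hi
          rw [if_neg (by omega), if_neg (by omega), mul_zero]
      rw [e2]
      simp only [smul_apply, smul_eq_mul]
      ring
    rw [← e]
    refine hasSum_of_eq hsum fun l => ?_
    symm
    -- Write j = (j-l) + l: the weight j^N is distributed between the kernel and the sequence.
    have hb : (j : ℂ) ^ N = ∑ i ∈ Finset.range (N + 1),
        ((j - l : ℤ) : ℂ) ^ i * (l : ℂ) ^ (N - i) * (N.choose i : ℂ) := by
      rw [← add_pow]; push_cast; ring
    rw [hb, Finset.sum_mul]
    refine Finset.sum_congr rfl fun i hi => ?_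
    have hi' : i ≤ N := by simpa [Nat.lt_succ_iff] using hi
    by_cases hl : l = 0
    · subst hl; simp
    · have hl' : (l : ℂ) ≠ 0 := by exact_mod_cast hl
      have : (l : ℂ) ^ N = l ^ (N - i) * l ^ i := by rw [← pow_add, Nat.sub_add_cancel hi']
      rw [this]
      field_simp

/-! ### Multiplication by the potential -/

/-- The function `μ φ_j` in `L²`. -/
def mulPhi {μ : ℝ → ℝ} (hμ : MemLp μ 2 (volume.restrict (Ioo (0 : ℝ) 1))) (j : ℕ+) : L2Space :=
  MemLp.toLp (fun x => ((μ x * phi j x : ℝ) : ℂ)) (by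
    refine MemLp.ofReal (hf := ?_)
    refine MemLp.of_le_mul (g := μ) (c := Real.sqrt 2) hμ
      (hμ.aestronglyMeasurable.mul (continuous_phi j).aestronglyMeasurable)
      (Eventually.of_forall fun x => ?_)
    change ‖μ x * phi j x‖ ≤ _
    rw [norm_mul, mul_comm]
    refine mul_le_mul_of_nonneg_right ?_ (norm_nonneg _)
    rw [phi, norm_mul, Real.norm_of_nonneg (Real.sqrt_nonneg 2)]
    exact mul_le_of_le_one_right (Real.sqrt_nonneg 2) (Real.abs_sin_le_one _))

section Mul

variable {μ : ℝ → ℝ} (hμ : MemLp μ 2 (volume.restrict (Ioo (0 : ℝ) 1)))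

lemma mulPhi_coeFn (j : ℕ+) :
    mulPhi hμ j =ᵐ[volume.restrict (Ioo (0 : ℝ) 1)] fun x => ((μ x * phi j x : ℝ) : ℂ) :=
  MemLp.coeFn_toLp _

lemma inner_mulPhi (j : ℕ+) (ψ : L2Space) : inner ℂ (mulPhi hμ j) ψ =
    ∫ x in Ioo (0 : ℝ) 1, (μ x : ℂ) * ψ x * (phi j x : ℂ) := by
  rw [L2.inner_def]
  refine integral_congr_ae ?_
  filter_upwards [mulPhi_coeFn hμ j] with x hx
  rw [hx, RCLike.inner_apply, Complex.conj_ofReal]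
  push_cast; ring

lemma inner_mulPhi_phiL2 (j l : ℕ+) : inner ℂ (mulPhi hμ j) (phiL2 l) =
    ((cosCoeff μ ((j : ℤ) - l) - cosCoeff μ ((j : ℤ) + l) : ℝ) : ℂ) := by
  rw [inner_mulPhi, ← integral_mul_phi_mul_phi hμ, ← integral_complex_ofReal]
  refine integral_congr_ae ?_
  filter_upwards [(memLp_phi l).coeFn_toLp] with x hx
  rw [phiL2, hx]; push_cast; ring

lemma hasSum_inner_mulPhi (j : ℕ+) (ψ : L2Space) :
    HasSum (fun l : ℕ+ => ((cosCoeff μ ((j : ℤ) - l) - cosCoeff μ ((j : ℤ) + l) : ℝ) : ℂ) *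
      coeff l ψ) (inner ℂ (mulPhi hμ j) ψ) := by
  refine hasSum_of_eq (phiBasis.hasSum_inner_mul_inner (mulPhi hμ j) ψ) fun l => ?_
  rw [phiBasis_apply, inner_mulPhi_phiL2]; rfl

/-- With odd weights κ on an even extension, the Toeplitz minus Hankel sum over positive indices
becomes one convolution over ℤ. -/
lemma inner_mulPhi_eq_of_hasSum {κ : ℤ → ℂ} (hκ : ∀ l, κ (-l) = - κ l) {x : Seq ℕ+}
    {ψ : L2Space} (hψ : ∀ l : ℕ+, coeff l ψ = κ l * x l) {j : ℕ+} {S : ℂ}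
    (h : HasSum (fun l : ℤ => (cosCoeff μ (j - l) : ℂ) * (κ l * Seq.evenExt x l)) S) :
    inner ℂ (mulPhi hμ j) ψ = S := by
  rw [← h.tsum_eq, tsum_int_eq_zero_add_tsum_pnat h.summable, Seq.evenExt_zero, mul_zero, mul_zero,
    zero_add]
  have hinj : Function.Injective (fun n : ℕ+ => ((n : ℕ) : ℤ)) := fun a b hab => by
    exact PNat.coe_injective (Int.ofNat.inj hab)
  have h1 := h.summable.comp_injective hinj
  have h2 := h.summable.comp_injective (neg_injective.comp hinj)
  refine Eq.trans ?_ (Summable.tsum_add h1 h2)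
  rw [← (hasSum_inner_mulPhi hμ j ψ).tsum_eq]
  refine tsum_congr fun l => ?_
  simp only
  rw [hψ, hκ, Seq.evenExt_neg, Seq.evenExt_pnat, sub_neg_eq_add]
  push_cast; ring

/-- The functional `x ↦ j^N ⟨μψ, φ_j⟩`, where `ψ` has coefficients `j^{-N} x_j`. -/
def wmul (N : ℕ) (j : ℕ+) : Seq ℕ+ →L[ℂ] ℂ :=
  ((j : ℂ) ^ N) • (innerSL ℂ (mulPhi hμ j)).comp (ofWeighted N)

lemma wmul_apply (N : ℕ) (j : ℕ+) (x : Seq ℕ+) :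
    wmul hμ N j x = (j : ℂ) ^ N * inner ℂ (mulPhi hμ j) (ofWeighted N x) := rfl

end Mul

/-- A family of functionals on `ℓ²` which is square summable up to `a + (-1)^j b`. -/
def IsTame (m : ℕ+ → Seq ℕ+ →L[ℂ] ℂ) : Prop :=
  ∃ (a b : Seq ℕ+ →L[ℂ] ℂ) (C : ℝ), 0 ≤ C ∧ ∀ (x : Seq ℕ+) (s : Finset ℕ+),
    ∑ j ∈ s, ‖m j x - a x - (-1) ^ (j : ℕ) * b x‖ ^ 2 ≤ (C * ‖x‖) ^ 2

lemma sum_norm_sq_pnat_le (Y : Seq ℤ) (s : Finset ℕ+) : ∑ j ∈ s, ‖Y (j : ℤ)‖ ^ 2 ≤ ‖Y‖ ^ 2 := by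
  have hinj : Function.Injective (fun n : ℕ+ => ((n : ℕ) : ℤ)) := fun a b hab => by
    exact PNat.coe_injective (Int.ofNat.inj hab)
  refine le_trans (le_of_eq ?_) (Seq.sum_norm_sq_le Y (s.map ⟨_, hinj⟩))
  rw [Finset.sum_map]; rfl

/-- The weight 0 is needed for uniqueness in L², the weight 2p+3 for regularity. In weight 2p+3 the
trace terms a and b are the obstruction for μψ to lie in H^{2p+3}_{(0)}. -/
lemma isTame_wmul {p N : ℕ} (hN : 2 * p + 3 ≤ N) {μ : ℝ → ℝ} (hμ : MemSobolev 0 1 N μ)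
    (hμbc : ∀ n < p, DerivVanishesAtEndpoints 0 1 (2 * n + 1) μ) :
    IsTame (wmul hμ.1 0) ∧ IsTame (wmul hμ.1 (2 * p + 3)) := by
  obtain ⟨A, B, ρ, hρ, h⟩ := exists_cosCoeff_expansion hN hμ hμbc
  have hρ' : Memℓp (fun n : ℤ => (ρ n : ℂ)) 2 := by
    refine Seq.memℓp_of_eventually_le hρ (Eventually.of_forall fun n => ?_)
    rw [Complex.norm_real, Real.norm_eq_abs, sq_abs]
  have hodd : Odd (2 * p + 3) := ⟨p + 1, by ring⟩
  obtain ⟨hm, a, b, C, hC, hs⟩ := exists_conv_structure (N := 2 * p + 3) hodd (by omega)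
    (m := fun n => (cosCoeff μ n : ℂ)) (A := A) (B := B) (ρ := Seq.mk _ hρ')
    (fun n => by
      have := h n
      simp only [Seq.mk_apply]
      have h2 := congrArg (fun r : ℝ => (r : ℂ)) this
      push_cast at h2
      exact h2)
  constructor
  · refine ⟨0, 0, (∑' n : ℤ, ‖(cosCoeff μ n : ℂ)‖) * 2, by positivity, fun x s => ?_⟩
    have hsgn : ∀ l : ℤ, ‖((Int.sign l : ℤ) : ℂ)‖ ≤ 1 := fun l => by
      rcases lt_trichotomy l 0 with h | h | h
      · simp [Int.sign_eq_neg_one_of_neg h]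
      · simp [h]
      · simp [Int.sign_eq_one_of_pos h]
    -- Without a weight, the odd extension is sign(l)·x_{|l|}, and Young's inequality with the
    -- summable coefficients of μ suffices: a = b = 0.
    obtain ⟨Y, hY, hYs⟩ := Seq.exists_conv' hm (Seq.diag _ 1 hsgn (Seq.evenExt x))
    have hYn : ‖Y‖ ≤ (∑' n : ℤ, ‖(cosCoeff μ n : ℂ)‖) * 2 * ‖x‖ := by
      refine hY.trans ?_
      rw [mul_assoc]
      refine mul_le_mul_of_nonneg_left ?_ (by positivity)
      refine le_trans ?_ (Seq.norm_evenExt_le x)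
      refine Seq.norm_le_of_sum_le (norm_nonneg _) fun t => ?_
      refine le_trans (Finset.sum_le_sum fun l _ => ?_) (Seq.sum_norm_sq_le (Seq.evenExt x) t)
      rw [Seq.diag_apply, norm_mul]
      exact pow_le_pow_left₀ (by positivity)
        (mul_le_of_le_one_left (norm_nonneg _) (hsgn l)) 2
    have e : ∀ j : ℕ+, wmul hμ.1 0 j x = Y (j : ℤ) := by
      intro j
      rw [wmul_apply, pow_zero, one_mul]
      refine inner_mulPhi_eq_of_hasSum hμ.1 (κ := fun l => ((Int.sign l : ℤ) : ℂ))
        (fun l => by simp) (x := x) (fun l => ?_) (hYs j)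
      rw [coeff_ofWeighted, Int.sign_eq_one_of_pos (by exact_mod_cast l.pos)]
      simp
    simp only [zero_apply, mul_zero, sub_zero, e]
    exact (sum_norm_sq_pnat_le Y s).trans (pow_le_pow_left₀ (norm_nonneg _) hYn 2)
  · refine ⟨a, b, C, hC, fun x s => ?_⟩
    obtain ⟨Y, hY, hYs⟩ := hs x
    have e : ∀ j : ℕ+, wmul hμ.1 (2 * p + 3) j x - a x - (-1) ^ (j : ℕ) * b x = Y (j : ℤ) := by
      intro j
      have hj0 : ((j : ℂ) ^ (2 * p + 3)) ≠ 0 := pnat_pow_ne_zero _ j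
      have h1 := hYs j
      have h2 := h1.mul_left ((j : ℂ) ^ (2 * p + 3))⁻¹
      have h3 := inner_mulPhi_eq_of_hasSum hμ.1 (κ := fun l => ((l : ℂ) ^ (2 * p + 3))⁻¹)
        (fun l => by simp [hodd.neg_pow, inv_neg]) (x := x) (ψ := ofWeighted (2 * p + 3) x)
        (fun l => by rw [coeff_ofWeighted]; simp) (j := j)
        (hasSum_of_eq h2 fun l => by
          have : (((j : ℕ) : ℤ) : ℂ) = (j : ℂ) := by simp
          rw [this, inv_mul_cancel_left₀ hj0])
      rw [wmul_apply, h3, mul_inv_cancel_left₀ hj0, zpow_natCast]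
      ring
    simp only [e]
    exact (sum_norm_sq_pnat_le Y s).trans (pow_le_pow_left₀ (norm_nonneg _) hY 2)

/-! ### The Duhamel operator -/

lemma norm_integral_mul_sq_le {ν : Measure ℝ} {f h : ℝ → ℂ} (hf : MemLp f 2 ν)
    (hh : MemLp h 2 ν) :
    ‖∫ τ, f τ * h τ ∂ν‖ ^ 2 ≤ (∫ τ, ‖f τ‖ ^ 2 ∂ν) * ∫ τ, ‖h τ‖ ^ 2 ∂ν := by
  have h1 := integral_mul_norm_le_Lp_mul_Lq (μ := ν) (f := f) (g := h) (p := 2) (q := 2)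
    (Real.HolderConjugate.two_two) (by simpa using hf) (by simpa using hh)
  have h2 : ‖∫ τ, f τ * h τ ∂ν‖ ≤ ∫ τ, ‖f τ‖ * ‖h τ‖ ∂ν := by
    refine (norm_integral_le_integral_norm _).trans (le_of_eq ?_)
    simp only [norm_mul]
  have e : ∀ g : ℝ → ℂ, (∫ τ, ‖g τ‖ ^ (2 : ℝ) ∂ν) ^ (1 / (2 : ℝ)) =
      Real.sqrt (∫ τ, ‖g τ‖ ^ 2 ∂ν) := fun g => by
    rw [← Real.sqrt_eq_rpow]; simp
  rw [e, e] at h1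
  refine (pow_le_pow_left₀ (norm_nonneg _) (h2.trans h1) 2).trans (le_of_eq ?_)
  rw [mul_pow, Real.sq_sqrt (integral_nonneg fun _ => by positivity),
    Real.sq_sqrt (integral_nonneg fun _ => by positivity)]

/-- Bounded continuous curves in `ℓ²`. -/
abbrev Curve : Type := BoundedContinuousFunction ℝ (Seq ℕ+)

/-- Lebesgue measure on `(0, T)`. -/
abbrev timeMeasure (T : ℝ) : Measure ℝ := volume.restrict (Ioo (0 : ℝ) T)

/-- The phase `e^{iλ_j t}`. -/
def phase (j : ℕ+) (t : ℝ) : ℂ := Complex.exp (Complex.I * eigenvalue j * t)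

lemma norm_phase (j : ℕ+) (t : ℝ) : ‖phase j t‖ = 1 := norm_exp_I_mul _ _

lemma continuous_phase (j : ℕ+) : Continuous (phase j) := by
  unfold phase; fun_prop

lemma phase_neg (j : ℕ+) (t : ℝ) :
    phase j (-t) = Complex.exp (-(Complex.I * eigenvalue j * t)) := by
  rw [phase]; push_cast; ring_nf

lemma phase_add (j : ℕ+) (s t : ℝ) : phase j (s + t) = phase j s * phase j t := by
  rw [phase, phase, phase, ← Complex.exp_add]; push_cast; ring_nf

lemma phase_neg_mul_phase (j : ℕ+) (t : ℝ) : phase j (-t) * phase j t = 1 := by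
  rw [← phase_add]; simp [phase]

lemma hasDerivAt_phase (j : ℕ+) (t : ℝ) :
    HasDerivAt (phase j) (Complex.I * eigenvalue j * phase j t) t := by
  have h : HasDerivAt (fun t : ℝ => Complex.I * eigenvalue j * (t : ℂ))
      (Complex.I * eigenvalue j) t := by
    simpa using (Complex.ofRealCLM.hasDerivAt (x := t)).const_mul (Complex.I * eigenvalue j)
  have := h.cexp
  rw [mul_comm]; exact this

section Duhamel

variable {T : ℝ} {m : ℕ+ → Seq ℕ+ →L[ℂ] ℂ}

lemma memLp_mul_curve {f : ℝ → ℝ} (hf : MemLp f 2 (timeMeasure T)) {c : ℝ → ℂ}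
    (hc : Continuous c) {K : ℝ} (hK : ∀ t, ‖c t‖ ≤ K) :
    MemLp (fun τ => (f τ : ℂ) * c τ) 2 (timeMeasure T) := by
  refine MemLp.of_le_mul (g := f) (c := K) hf
    ((Complex.continuous_ofReal.comp_aestronglyMeasurable hf.aestronglyMeasurable).mul
      hc.aestronglyMeasurable) (Eventually.of_forall fun x => ?_)
  rw [norm_mul, Complex.norm_real, mul_comm]
  exact mul_le_mul_of_nonneg_right (hK x) (norm_nonneg _)

lemma integral_norm_mul_curve_le {f : ℝ → ℝ} (hf : MemLp f 2 (timeMeasure T)) {c : ℝ → ℂ}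
    {K : ℝ} (hK : ∀ t, ‖c t‖ ≤ K) :
    ∫ τ in Ioo 0 T, ‖(f τ : ℂ) * c τ‖ ^ 2 ≤ K ^ 2 * ∫ τ in Ioo 0 T, f τ ^ 2 := by
  rw [← integral_const_mul]
  refine integral_mono_of_nonneg (Eventually.of_forall fun _ => by positivity)
    (hf.integrable_sq.const_mul _) (Eventually.of_forall fun τ => ?_)
  simp only [norm_mul, Complex.norm_real, mul_pow, Real.norm_eq_abs, sq_abs]
  rw [mul_comm]
  exact mul_le_mul_of_nonneg_right (pow_le_pow_left₀ (norm_nonneg _) (hK τ) 2) (sq_nonneg _)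

/-- The square summable part is handled by Cauchy–Schwarz in time and summation in j. The parts a
and (-1)^j b do not decay in j, but they multiply one scalar function of time integrated against
e^{iλ_jτ}, and the Bessel inequality in time supplies the summability. -/
lemma IsTame.exists_bound_aux (hT : 0 ≤ T) (hm : IsTame m) :
    ∃ C : ℝ, 0 ≤ C ∧ ∀ (f : ℝ → ℝ), MemLp f 2 (timeMeasure T) → ∀ (x : Curve) (s : Finset ℕ+),
      ∑ j ∈ s, ‖∫ τ in Ioo 0 T, phase j τ * (f τ * m j (x τ))‖ ^ 2 ≤
        C * ‖x‖ ^ 2 * ∫ τ in Ioo 0 T, f τ ^ 2 := by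
  obtain ⟨a, b, C, hC, h⟩ := hm
  -- The frequencies are λ_j = π²j², with distinct integers j².
  obtain ⟨D, hD, hB⟩ := exists_time_bessel (fun j : ℕ+ => ((j : ℕ) : ℤ) ^ 2) (fun i j hij => by
    have h1 : ((i : ℕ) : ℤ) ^ 2 = ((j : ℕ) : ℤ) ^ 2 := hij
    have h2 : (i : ℕ) ^ 2 = (j : ℕ) ^ 2 := by exact_mod_cast h1
    exact PNat.coe_injective (Nat.pow_left_injective (n := 2) (by norm_num) h2)) T
  have hB' : ∀ F : ℝ → ℂ, MemLp F 2 (timeMeasure T) → ∀ s : Finset ℕ+,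
      ∑ j ∈ s, ‖∫ τ in Ioo 0 T, phase j τ * F τ‖ ^ 2 ≤ D * ∫ τ in Ioo 0 T, ‖F τ‖ ^ 2 := by
    intro F hF s
    convert hB F hF s using 7 with j _ τ
    rw [phase, eigenvalue]; push_cast; ring_nf
  refine ⟨3 * (T * C ^ 2 + D * ‖a‖ ^ 2 + D * ‖b‖ ^ 2), by positivity, fun f hf x s => ?_⟩
  set I₂ := ∫ τ in Ioo 0 T, f τ ^ 2
  have hx : ∀ τ, ‖x τ‖ ≤ ‖x‖ := x.norm_coe_le_norm
  have hc : ∀ c : Seq ℕ+ →L[ℂ] ℂ, Continuous (fun τ => c (x τ)) := fun c =>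
    c.continuous.comp x.continuous
  have hcb : ∀ (c : Seq ℕ+ →L[ℂ] ℂ) τ, ‖c (x τ)‖ ≤ ‖c‖ * ‖x‖ := fun c τ =>
    (c.le_opNorm _).trans (mul_le_mul_of_nonneg_left (hx τ) (norm_nonneg _))
  set r : ℕ+ → Seq ℕ+ →L[ℂ] ℂ := fun j => m j - a - ((-1) ^ (j : ℕ) : ℂ) • b with hr
  have hrx : ∀ j y, r j y = m j y - a y - (-1) ^ (j : ℕ) * b y := fun j y => rfl
  have hmem : ∀ c : Seq ℕ+ →L[ℂ] ℂ, MemLp (fun τ => (f τ : ℂ) * c (x τ)) 2 (timeMeasure T) :=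
    fun c => memLp_mul_curve hf (hc c) (hcb c)
  have hint : ∀ (c : Seq ℕ+ →L[ℂ] ℂ) j,
      IntegrableOn (fun τ => phase j τ * (f τ * c (x τ))) (Ioo 0 T) := fun c j =>
    Integrable.bdd_mul (c := 1) ((hmem c).integrable one_le_two)
      (continuous_phase j).aestronglyMeasurable
      (Eventually.of_forall fun τ => (norm_phase j τ).le)
  have hsplit : ∀ j, ∫ τ in Ioo 0 T, phase j τ * (f τ * m j (x τ)) =
      (∫ τ in Ioo 0 T, phase j τ * (f τ * r j (x τ))) +
      (∫ τ in Ioo 0 T, phase j τ * (f τ * a (x τ))) +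
      (-1) ^ (j : ℕ) * ∫ τ in Ioo 0 T, phase j τ * (f τ * b (x τ)) := by
    intro j
    have e1 := integral_add (hint (r j) j) (hint a j)
    have e2 := integral_add ((hint (r j) j).add (hint a j)) ((hint b j).const_mul ((-1) ^ (j : ℕ)))
    rw [← integral_const_mul, ← e1]
    refine Eq.trans ?_ e2
    refine integral_congr_ae (Eventually.of_forall fun τ => ?_)
    simp only [hrx, Pi.add_apply]; ring
  -- The remainder is summed over j under the time integral, where tameness bounds it uniformly in
  -- τ.
  have h1 : ∑ j ∈ s, ‖∫ τ in Ioo 0 T, phase j τ * (f τ * r j (x τ))‖ ^ 2 ≤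
      (T * C ^ 2) * ‖x‖ ^ 2 * I₂ := by
    have e1 : ∀ j, ‖∫ τ in Ioo 0 T, phase j τ * (f τ * r j (x τ))‖ ^ 2 ≤
        I₂ * ∫ τ in Ioo 0 T, ‖r j (x τ)‖ ^ 2 := by
      intro j
      have hr2 : MemLp (fun τ => phase j τ * r j (x τ)) 2 (timeMeasure T) :=
        MemLp.of_bound ((continuous_phase j).mul (hc (r j))).aestronglyMeasurable (‖r j‖ * ‖x‖)
          (Eventually.of_forall fun τ => by
            rw [norm_mul, norm_phase, one_mul]; exact hcb _ _)
      have := norm_integral_mul_sq_le (f := fun τ => (f τ : ℂ)) (MemLp.ofReal hf) hr2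
      simp only [norm_mul, norm_phase, one_mul, Complex.norm_real, Real.norm_eq_abs, sq_abs] at this
      convert this using 3
      refine integral_congr_ae (Eventually.of_forall fun τ => ?_)
      simp only; ring
    refine (Finset.sum_le_sum fun j _ => e1 j).trans ?_
    rw [← Finset.mul_sum, ← integral_finsetSum]
    · have e2 : ∫ τ in Ioo 0 T, ∑ j ∈ s, ‖r j (x τ)‖ ^ 2 ≤ T * (C * ‖x‖) ^ 2 := by
        have : ∫ τ in Ioo 0 T, ∑ j ∈ s, ‖r j (x τ)‖ ^ 2 ≤ ∫ _ in Ioo 0 T, (C * ‖x‖) ^ 2 := by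
          refine integral_mono_of_nonneg (Eventually.of_forall fun _ => by positivity)
            (integrable_const _) (Eventually.of_forall fun τ => ?_)
          simp only [hrx]
          exact (h (x τ) s).trans (pow_le_pow_left₀ (by positivity)
            (mul_le_mul_of_nonneg_left (hx τ) hC) 2)
        refine this.trans (le_of_eq ?_)
        simp [hT]
      refine (mul_le_mul_of_nonneg_left e2 (integral_nonneg fun _ => sq_nonneg _)).trans
        (le_of_eq ?_)
      ring
    · intro j _
      exact (MemLp.of_bound (hc (r j)).aestronglyMeasurable (‖r j‖ * ‖x‖)
          (Eventually.of_forall fun τ => hcb _ _) : MemLp _ 2 (timeMeasure T)).integrable_norm_pow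
            (by norm_num)
  have h2 : ∀ c : Seq ℕ+ →L[ℂ] ℂ, ∑ j ∈ s, ‖∫ τ in Ioo 0 T, phase j τ * (f τ * c (x τ))‖ ^ 2 ≤
      (D * ‖c‖ ^ 2) * ‖x‖ ^ 2 * I₂ := by
    intro c
    refine (hB' _ (hmem c) s).trans ?_
    refine (mul_le_mul_of_nonneg_left (integral_norm_mul_curve_le hf (hcb c)) hD.le).trans
      (le_of_eq ?_)
    ring
  have h3 : ∀ j, ‖∫ τ in Ioo 0 T, phase j τ * (f τ * m j (x τ))‖ ^ 2 ≤
      3 * (‖∫ τ in Ioo 0 T, phase j τ * (f τ * r j (x τ))‖ ^ 2 +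
      ‖∫ τ in Ioo 0 T, phase j τ * (f τ * a (x τ))‖ ^ 2 +
      ‖∫ τ in Ioo 0 T, phase j τ * (f τ * b (x τ))‖ ^ 2) := by
    intro j
    rw [hsplit]
    set u := ∫ τ in Ioo 0 T, phase j τ * (f τ * r j (x τ))
    set v := ∫ τ in Ioo 0 T, phase j τ * (f τ * a (x τ))
    set w := ∫ τ in Ioo 0 T, phase j τ * (f τ * b (x τ))
    have e : ‖u + v + (-1) ^ (j : ℕ) * w‖ ≤ ‖u‖ + ‖v‖ + ‖w‖ := by
      refine (norm_add₃_le).trans ?_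
      rw [norm_mul, norm_pow, norm_neg, norm_one, one_pow, one_mul]
    refine (pow_le_pow_left₀ (norm_nonneg _) e 2).trans ?_
    nlinarith [sq_nonneg (‖u‖ - ‖v‖), sq_nonneg (‖u‖ - ‖w‖), sq_nonneg (‖v‖ - ‖w‖)]
  refine (Finset.sum_le_sum fun j _ => h3 j).trans ?_
  rw [← Finset.mul_sum, Finset.sum_add_distrib, Finset.sum_add_distrib]
  have := add_le_add (add_le_add h1 (h2 a)) (h2 b)
  nlinarith

/-- The basic smoothing estimate on a measurable subset `B` of the time interval. -/
lemma IsTame.exists_bound (hT : 0 ≤ T) (hm : IsTame m) :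
    ∃ C : ℝ, 0 ≤ C ∧ ∀ (f : ℝ → ℝ), MemLp f 2 (timeMeasure T) → ∀ (x : Curve) (B : Set ℝ),
      MeasurableSet B → ∀ s : Finset ℕ+,
      ∑ j ∈ s, ‖∫ τ in B, phase j τ * (f τ * m j (x τ)) ∂(timeMeasure T)‖ ^ 2 ≤
        C ^ 2 * ‖x‖ ^ 2 * ∫ τ in B, f τ ^ 2 ∂(timeMeasure T) := by
  obtain ⟨C, hC, h⟩ := hm.exists_bound_aux hT
  refine ⟨Real.sqrt C, Real.sqrt_nonneg _, fun f hf x B hB s => ?_⟩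
  rw [Real.sq_sqrt hC]
  -- Truncating the control localizes the estimate in time; this yields continuity of the Duhamel
  -- integral.
  have := h (B.indicator f) (hf.indicator hB) x s
  convert this using 1
  · refine Finset.sum_congr rfl fun j _ => ?_
    rw [← integral_indicator hB]
    congr 2
    refine integral_congr_ae (Eventually.of_forall fun τ => ?_)
    by_cases hτ : τ ∈ B <;> simp [hτ]
  · rw [← integral_indicator hB]
    congr 1
    refine integral_congr_ae (Eventually.of_forall fun τ => ?_)
    by_cases hτ : τ ∈ B <;> simp [hτ]

end Duhamel

/-! ### The free evolution on ℓ² -/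

namespace Seq

/-- The free evolution `e^{-iAt}` on sequences. -/
def rot (t : ℝ) : Seq ℕ+ →L[ℂ] Seq ℕ+ :=
  diag (fun j => phase j (-t)) 1 fun j => (norm_phase j (-t)).le

@[simp] lemma rot_apply (t : ℝ) (x : Seq ℕ+) (j : ℕ+) : rot t x j = phase j (-t) * x j := rfl

lemma norm_rot_le (t : ℝ) (x : Seq ℕ+) : ‖rot t x‖ ≤ ‖x‖ := by
  refine norm_le_of_sum_le (norm_nonneg _) fun s => ?_
  refine le_trans (Finset.sum_le_sum fun j _ => ?_) (sum_norm_sq_le x s)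
  rw [rot_apply, norm_mul, norm_phase, one_mul]

/-- The operators do not increase norms, so finite sums of modes, which evolve continuously,
converge uniformly in time. -/
lemma continuous_rot_apply (x : Seq ℕ+) : Continuous fun t => rot t x := by
  classical
  have hx := lp.hasSum_single (p := 2) (by norm_num) x
  have hu : TendstoUniformly (fun (s : Finset ℕ+) (t : ℝ) => rot t (∑ i ∈ s, lp.single 2 i (x i)))
      (fun t => rot t x) atTop := by
    rw [Metric.tendstoUniformly_iff]
    intro ε hε
    have h1 : Tendsto (fun s : Finset ℕ+ => ∑ i ∈ s, lp.single 2 i (x i)) atTop (𝓝 x) := hx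
    filter_upwards [Metric.tendsto_nhds.1 h1 ε hε] with s hs t
    rw [dist_eq_norm, ← map_sub]
    refine (norm_rot_le t _).trans_lt ?_
    rwa [← dist_eq_norm, dist_comm]
  refine hu.continuous (Frequently.of_forall fun s => ?_)
  simp only [map_sum]
  refine continuous_finsetSum _ fun i _ => ?_
  have e : (fun t : ℝ => rot t (lp.single 2 i (x i))) =
      fun t : ℝ => phase i (-t) • (lp.single 2 i (x i) : Seq ℕ+) := by
    funext t
    ext j
    by_cases h : j = i
    · subst h; simp
    · simp [h]
  rw [e]
  exact ((continuous_phase i).comp continuous_neg).smul continuous_const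

lemma continuous_rot {y : ℝ → Seq ℕ+} (hy : Continuous y) : Continuous fun t => rot t (y t) := by
  rw [continuous_iff_continuousAt]
  intro t₀
  have h1 : Tendsto (fun t => rot t (y t - y t₀)) (𝓝 t₀) (𝓝 0) := by
    refine squeeze_zero_norm (fun t => norm_rot_le t _) ?_
    have : Tendsto (fun t => ‖y t - y t₀‖) (𝓝 t₀) (𝓝 ‖y t₀ - y t₀‖) :=
      ((hy.sub continuous_const).norm).continuousAt
    simpa using this
  have h2 := h1.add (continuous_rot_apply (y t₀)).continuousAt.tendsto
  simpa [ContinuousAt] using h2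

end Seq

/-- The free evolution as a bounded curve. -/
def freeCurve : Seq ℕ+ →L[ℂ] Curve :=
  LinearMap.mkContinuous
    { toFun := fun x => BoundedContinuousFunction.ofNormedAddCommGroup (fun t => Seq.rot t x)
        (Seq.continuous_rot_apply x) ‖x‖ fun t => Seq.norm_rot_le t x
      map_add' := fun x y => by ext t : 1; simp
      map_smul' := fun c x => by ext t : 1; simp } 1 fun x => by
    rw [one_mul]
    exact (BoundedContinuousFunction.norm_le (norm_nonneg _)).2 fun t => Seq.norm_rot_le t x

@[simp] lemma freeCurve_apply (x : Seq ℕ+) (t : ℝ) : freeCurve x t = Seq.rot t x := rfl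

lemma L2Time.integral_sq {T : ℝ} (f : L2Time T) : ∫ τ in Ioo 0 T, f τ ^ 2 = ‖f‖ ^ 2 := by
  rw [← real_inner_self_eq_norm_sq, L2.inner_def]
  refine integral_congr_ae (Eventually.of_forall fun τ => ?_)
  simp [sq]

/-! ### The Duhamel operator as a bounded bilinear map -/

section Duhamel

variable {T : ℝ} {m : ℕ+ → Seq ℕ+ →L[ℂ] ℂ}

/-- The constant of the smoothing estimate. -/
def IsTame.const (hT : 0 ≤ T) (hm : IsTame m) : ℝ := (hm.exists_bound hT).choose

lemma IsTame.const_nonneg (hT : 0 ≤ T) (hm : IsTame m) : 0 ≤ hm.const hT :=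
  (hm.exists_bound hT).choose_spec.1

lemma IsTame.sum_le (hT : 0 ≤ T) (hm : IsTame m) (f : L2Time T) (x : Curve) {B : Set ℝ}
    (hB : MeasurableSet B) (s : Finset ℕ+) :
    ∑ j ∈ s, ‖∫ τ in B, phase j τ * (f τ * m j (x τ)) ∂(timeMeasure T)‖ ^ 2 ≤
      hm.const hT ^ 2 * ‖x‖ ^ 2 * ∫ τ in B, f τ ^ 2 ∂(timeMeasure T) :=
  (hm.exists_bound hT).choose_spec.2 f (Lp.memLp f) x B hB s

lemma IsTame.sum_le' (hT : 0 ≤ T) (hm : IsTame m) (f : L2Time T) (x : Curve) {B : Set ℝ}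
    (hB : MeasurableSet B) (s : Finset ℕ+) :
    ∑ j ∈ s, ‖∫ τ in B, phase j τ * (f τ * m j (x τ)) ∂(timeMeasure T)‖ ^ 2 ≤
      (hm.const hT * ‖f‖ * ‖x‖) ^ 2 := by
  refine (hm.sum_le hT f x hB s).trans ?_
  have h1 : ∫ τ in B, f τ ^ 2 ∂(timeMeasure T) ≤ ‖f‖ ^ 2 := by
    rw [← L2Time.integral_sq]
    exact setIntegral_le_integral (Lp.memLp f).integrable_sq
      (Eventually.of_forall fun _ => sq_nonneg _)
  refine (mul_le_mul_of_nonneg_left h1 (by positivity)).trans (le_of_eq ?_)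
  ring

/-- The Duhamel integral in the interaction picture. -/
def interaction (hT : 0 ≤ T) (hm : IsTame m) (f : L2Time T) (x : Curve) (t : ℝ) : Seq ℕ+ :=
  Seq.mk (fun j => ∫ τ in Iic t, phase j τ * (f τ * m j (x τ)) ∂(timeMeasure T))
    (Seq.memℓp_of_sum_le (hm.sum_le' hT f x measurableSet_Iic))

lemma norm_interaction_le (hT : 0 ≤ T) (hm : IsTame m) (f : L2Time T) (x : Curve) (t : ℝ) :
    ‖interaction hT hm f x t‖ ≤ hm.const hT * ‖f‖ * ‖x‖ :=
  Seq.norm_le_of_sum_le (by have := hm.const_nonneg hT; positivity)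
    (hm.sum_le' hT f x measurableSet_Iic)

lemma continuous_apply_curve (l : Seq ℕ+ →L[ℂ] ℂ) (x : Curve) : Continuous fun τ => l (x τ) :=
  l.continuous.comp x.continuous

lemma norm_apply_curve_le (l : Seq ℕ+ →L[ℂ] ℂ) (x : Curve) (τ : ℝ) : ‖l (x τ)‖ ≤ ‖l‖ * ‖x‖ :=
  (l.le_opNorm _).trans (mul_le_mul_of_nonneg_left (x.norm_coe_le_norm τ) (norm_nonneg _))

lemma integrable_phase_mul (f : L2Time T) (x : Curve) (l : Seq ℕ+ →L[ℂ] ℂ) (j : ℕ+) :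
    Integrable (fun τ => phase j τ * (f τ * l (x τ))) (timeMeasure T) :=
  Integrable.bdd_mul (c := 1) ((memLp_mul_curve (Lp.memLp f) (continuous_apply_curve l x)
    (norm_apply_curve_le l x)).integrable one_le_two)
    (continuous_phase j).aestronglyMeasurable (Eventually.of_forall fun τ => (norm_phase j τ).le)

/-- An increment is the same integral over (s,t], so the localized smoothing estimate bounds it by
the square root of ∫_s^t f², which tends to zero. -/
lemma continuous_interaction (hT : 0 ≤ T) (hm : IsTame m) (f : L2Time T) (x : Curve) :
    Continuous (interaction hT hm f x) := by
  set K := hm.const hT * ‖x‖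
  have hint : Integrable (fun τ => f τ ^ 2) (timeMeasure T) := (Lp.memLp f).integrable_sq
  have key : ∀ s t, s ≤ t → ‖interaction hT hm f x t - interaction hT hm f x s‖ ≤
      Real.sqrt (K ^ 2 * |∫ τ in s..t, f τ ^ 2 ∂(timeMeasure T)|) := by
    intro s t hst
    rw [intervalIntegral.integral_of_le hst, abs_of_nonneg (integral_nonneg fun _ => sq_nonneg _)]
    refine Seq.norm_le_of_sum_le (Real.sqrt_nonneg _) fun S => ?_
    rw [Real.sq_sqrt (mul_nonneg (sq_nonneg _) (integral_nonneg fun _ => sq_nonneg _)), mul_pow]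
    refine le_trans (le_of_eq ?_) (hm.sum_le hT f x measurableSet_Ioc S)
    refine Finset.sum_congr rfl fun j _ => ?_
    rw [← intervalIntegral.integral_of_le hst, ← intervalIntegral.integral_Iic_sub_Iic
      (integrable_phase_mul f x (m j) j).integrableOn (integrable_phase_mul f x (m j) j).integrableOn]
    rfl
  have key' : ∀ s t, ‖interaction hT hm f x t - interaction hT hm f x s‖ ≤
      Real.sqrt (K ^ 2 * |∫ τ in s..t, f τ ^ 2 ∂(timeMeasure T)|) := by
    intro s t
    rcases le_total s t with h | h
    · exact key s t h
    · rw [norm_sub_rev, intervalIntegral.integral_symm, abs_neg]; exact key t s h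
  rw [continuous_iff_continuousAt]
  intro t₀
  rw [ContinuousAt, tendsto_iff_norm_sub_tendsto_zero]
  refine squeeze_zero (fun _ => norm_nonneg _) (fun t => key' t₀ t) ?_
  have hc : Continuous fun t => ∫ τ in t₀..t, f τ ^ 2 ∂(timeMeasure T) :=
    intervalIntegral.continuous_primitive (fun a b => hint.intervalIntegrable) t₀
  have hc2 : Continuous fun t => Real.sqrt (K ^ 2 * |∫ τ in t₀..t, f τ ^ 2 ∂(timeMeasure T)|) :=
    (continuous_const.mul hc.abs).sqrt
  have := hc2.tendsto t₀
  simpa using this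

/-- The Duhamel operator `(f, x) ↦ i ∫_0^t e^{-iA(t-τ)} f(τ) (m x)(τ) dτ`. -/
def duhamelFun (hT : 0 ≤ T) (hm : IsTame m) (f : L2Time T) (x : Curve) : Curve :=
  BoundedContinuousFunction.ofNormedAddCommGroup
    (fun t => Complex.I • Seq.rot t (interaction hT hm f x t))
    ((continuous_const_smul Complex.I).comp
      (Seq.continuous_rot (continuous_interaction hT hm f x)))
    (hm.const hT * ‖f‖ * ‖x‖) fun t => by
      rw [norm_smul, Complex.norm_I, one_mul]
      exact (Seq.norm_rot_le _ _).trans (norm_interaction_le hT hm f x t)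

lemma norm_duhamelFun_le (hT : 0 ≤ T) (hm : IsTame m) (f : L2Time T) (x : Curve) :
    ‖duhamelFun hT hm f x‖ ≤ hm.const hT * ‖f‖ * ‖x‖ := by
  refine (BoundedContinuousFunction.norm_le
    (by have := hm.const_nonneg hT; positivity)).2 fun t => ?_
  change ‖Complex.I • Seq.rot t (interaction hT hm f x t)‖ ≤ _
  rw [norm_smul, Complex.norm_I, one_mul]
  exact (Seq.norm_rot_le _ _).trans (norm_interaction_le hT hm f x t)

lemma duhamelFun_apply (hT : 0 ≤ T) (hm : IsTame m) (f : L2Time T) (x : Curve) (t : ℝ) (j : ℕ+) :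
    duhamelFun hT hm f x t j = Complex.I * (phase j (-t) *
      ∫ τ in Iic t, phase j τ * (f τ * m j (x τ)) ∂(timeMeasure T)) := rfl

/-- The Duhamel operator as a bounded bilinear map. -/
def duhamel (hT : 0 ≤ T) (hm : IsTame m) : L2Time T →L[ℝ] Curve →L[ℝ] Curve :=
  LinearMap.mkContinuous₂ (LinearMap.mk₂ ℝ (duhamelFun hT hm)
    (fun f g x => by
      ext t j
      change _ = duhamelFun hT hm f x t j + duhamelFun hT hm g x t j
      simp only [duhamelFun_apply]
      rw [← mul_add, ← mul_add, ← integral_add (integrable_phase_mul f x _ j).integrableOn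
        (integrable_phase_mul g x _ j).integrableOn]
      congr 2
      refine integral_congr_ae (ae_restrict_of_ae ?_)
      filter_upwards [Lp.coeFn_add f g] with τ hτ
      rw [hτ, Pi.add_apply]; push_cast; ring)
    (fun c f x => by
      ext t j
      change _ = c • duhamelFun hT hm f x t j
      simp only [duhamelFun_apply]
      have h : ∫ τ in Iic t, phase j τ * ((c • f) τ * m j (x τ)) ∂(timeMeasure T) =
          (c : ℂ) * ∫ τ in Iic t, phase j τ * (f τ * m j (x τ)) ∂(timeMeasure T) := by
        rw [← integral_const_mul]
        refine integral_congr_ae (ae_restrict_of_ae ?_)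
        filter_upwards [Lp.coeFn_smul c f] with τ hτ
        rw [hτ, Pi.smul_apply, smul_eq_mul]; push_cast; ring
      rw [h, Complex.real_smul]; ring)
    (fun f x y => by
      ext t j
      change _ = duhamelFun hT hm f x t j + duhamelFun hT hm f y t j
      simp only [duhamelFun_apply]
      rw [← mul_add, ← mul_add, ← integral_add (integrable_phase_mul f x _ j).integrableOn
        (integrable_phase_mul f y _ j).integrableOn]
      congr 2
      refine integral_congr_ae (Eventually.of_forall fun τ => ?_)
      simp only [BoundedContinuousFunction.add_apply, map_add]; ring)
    (fun c f x => by
      ext t j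
      change _ = c • duhamelFun hT hm f x t j
      simp only [duhamelFun_apply]
      have h : ∫ τ in Iic t, phase j τ * (f τ * m j ((c • x) τ)) ∂(timeMeasure T) =
          (c : ℂ) * ∫ τ in Iic t, phase j τ * (f τ * m j (x τ)) ∂(timeMeasure T) := by
        rw [← integral_const_mul]
        refine integral_congr_ae (Eventually.of_forall fun τ => ?_)
        have : (c • x) τ = (c : ℂ) • x τ := rfl
        simp only [this, map_smul, smul_eq_mul]; ring
      rw [h, Complex.real_smul]; ring))
    (hm.const hT) (norm_duhamelFun_le hT hm)

lemma duhamel_apply (hT : 0 ≤ T) (hm : IsTame m) (f : L2Time T) (x : Curve) (t : ℝ) (j : ℕ+) :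
    duhamel hT hm f x t j = Complex.I * (phase j (-t) *
      ∫ τ in Iic t, phase j τ * (f τ * m j (x τ)) ∂(timeMeasure T)) := rfl

lemma norm_duhamel_le (hT : 0 ≤ T) (hm : IsTame m) (f : L2Time T) (x : Curve) :
    ‖duhamel hT hm f x‖ ≤ hm.const hT * ‖f‖ * ‖x‖ :=
  norm_duhamelFun_le hT hm f x

/-- The restriction of the integral to `(0, T)` is a usual integral. -/
lemma setIntegral_Iic_timeMeasure {t : ℝ} (ht : t ∈ Icc 0 T) (F : ℝ → ℂ) :
    ∫ τ in Iic t, F τ ∂(timeMeasure T) = ∫ τ in (0 : ℝ)..t, F τ := by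
  rw [Measure.restrict_restrict measurableSet_Iic, intervalIntegral.integral_of_le ht.1]
  refine setIntegral_congr_set ?_
  have h : (Iic t ∩ Ioo 0 T : Set ℝ) =ᵐ[volume] (Ioo 0 t : Set ℝ) := by
    have h2 : Iio t ∩ Ioo 0 T = Ioo 0 t := by
      ext x
      simp only [mem_inter_iff, mem_Iio, mem_Ioo]
      exact ⟨fun h => ⟨h.2.1, h.1⟩, fun h => ⟨h.2, h.1, h.2.trans_le ht.2⟩⟩
    rw [← h2]
    exact ae_eq_set_inter Iio_ae_eq_Iic.symm (ae_eq_refl _)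
  exact h.trans Ioo_ae_eq_Ioc

end Duhamel

/-! ### Time derivatives of the Duhamel operator -/

/-- Tuples of `L²` functions, thought of as `(u, u', …, u^{(k)})`. -/
abbrev ControlTuple (k : ℕ) (T : ℝ) : Type := PiLp 2 fun _ : Fin (k + 1) => L2Time T

/-- Tuples of curves, thought of as `(Ψ, Ψ', …, Ψ^{(k)})`. -/
abbrev CurveTuple (k : ℕ) : Type := Fin (k + 1) → Curve

/-- The index `q ≤ k`. -/
def ix (k q : ℕ) : Fin (k + 1) := ⟨min q k, by omega⟩

lemma ix_val {k q : ℕ} (h : q ≤ k) : ((ix k q : Fin (k + 1)) : ℕ) = q := min_eq_left h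

section Tuple

variable {T : ℝ} {m : ℕ+ → Seq ℕ+ →L[ℂ] ℂ} {k : ℕ}

/-- The Leibniz extension of the Duhamel operator to tuples. -/
def leibnizFun (hT : 0 ≤ T) (hm : IsTame m) (u : ControlTuple k T) (Ψ : CurveTuple k) :
    CurveTuple k := fun i => ∑ q ∈ Finset.range (i + 1),
  ((i : ℕ).choose q : ℝ) • duhamel hT hm (u (ix k q)) (Ψ (ix k (i - q)))

lemma norm_leibnizFun_le (hT : 0 ≤ T) (hm : IsTame m) (u : ControlTuple k T) (Ψ : CurveTuple k) :
    ‖leibnizFun hT hm u Ψ‖ ≤ 2 ^ k * hm.const hT * ‖u‖ * ‖Ψ‖ := by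
  have hc := hm.const_nonneg hT
  refine (pi_norm_le_iff_of_nonneg (by positivity)).2 fun i => ?_
  have h1 : ‖leibnizFun hT hm u Ψ i‖ ≤ ∑ q ∈ Finset.range (i + 1),
      ((i : ℕ).choose q : ℝ) * (hm.const hT * ‖u‖ * ‖Ψ‖) := by
    refine (norm_sum_le _ _).trans (Finset.sum_le_sum fun q _ => ?_)
    rw [norm_smul, Real.norm_of_nonneg (by positivity)]
    refine mul_le_mul_of_nonneg_left ?_ (by positivity)
    refine (norm_duhamel_le hT hm _ _).trans ?_
    exact mul_le_mul (mul_le_mul_of_nonneg_left (PiLp.norm_apply_le u _) hc)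
      (norm_le_pi_norm Ψ _) (norm_nonneg _) (by positivity)
  refine h1.trans ?_
  rw [← Finset.sum_mul]
  have h2 : ∑ q ∈ Finset.range ((i : ℕ) + 1), ((i : ℕ).choose q : ℝ) = 2 ^ (i : ℕ) := by
    exact_mod_cast Nat.sum_range_choose i
  rw [h2]
  have h3 : (2 : ℝ) ^ (i : ℕ) ≤ 2 ^ k :=
    pow_le_pow_right₀ (by norm_num) (Nat.lt_succ_iff.1 i.2)
  calc (2 : ℝ) ^ (i : ℕ) * (hm.const hT * ‖u‖ * ‖Ψ‖)
      ≤ 2 ^ k * (hm.const hT * ‖u‖ * ‖Ψ‖) := mul_le_mul_of_nonneg_right h3 (by positivity)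
    _ = _ := by ring

/-- The Leibniz extension of the Duhamel operator as a bounded bilinear map. -/
def leibniz (hT : 0 ≤ T) (hm : IsTame m) :
    ControlTuple k T →L[ℝ] CurveTuple k →L[ℝ] CurveTuple k :=
  LinearMap.mkContinuous₂ (LinearMap.mk₂ ℝ (leibnizFun hT hm)
    (fun u v Ψ => by
      funext i
      simp only [leibnizFun, PiLp.add_apply, map_add, _root_.add_apply, smul_add,
        Finset.sum_add_distrib, Pi.add_apply])
    (fun c u Ψ => by
      funext i
      simp only [leibnizFun, PiLp.smul_apply, map_smul, _root_.smul_apply, Finset.smul_sum,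
        Pi.smul_apply]
      exact Finset.sum_congr rfl fun q _ => smul_comm _ _ _)
    (fun u Ψ Φ => by
      funext i
      simp only [leibnizFun, map_add, smul_add, Finset.sum_add_distrib, Pi.add_apply])
    (fun c u Ψ => by
      funext i
      simp only [leibnizFun, Pi.smul_apply, map_smul, Finset.smul_sum]
      exact Finset.sum_congr rfl fun q _ => smul_comm _ _ _))
    (2 ^ k * hm.const hT) (norm_leibnizFun_le hT hm)

lemma leibniz_apply (hT : 0 ≤ T) (hm : IsTame m) (u : ControlTuple k T) (Ψ : CurveTuple k)
    (i : Fin (k + 1)) : leibniz hT hm u Ψ i = ∑ q ∈ Finset.range (i + 1),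
      ((i : ℕ).choose q : ℝ) • duhamel hT hm (u (ix k q)) (Ψ (ix k (i - q))) := rfl

lemma norm_leibniz_le (hT : 0 ≤ T) (hm : IsTame m) (u : ControlTuple k T) (Ψ : CurveTuple k) :
    ‖leibniz hT hm u Ψ‖ ≤ 2 ^ k * hm.const hT * ‖u‖ * ‖Ψ‖ :=
  norm_leibnizFun_le hT hm u Ψ

/-- Integration of a curve. -/
def curveInt (t : ℝ) : Curve →L[ℝ] Seq ℕ+ :=
  LinearMap.mkContinuous
    { toFun := fun x => ∫ τ in (0 : ℝ)..t, x τ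
      map_add' := fun x y => intervalIntegral.integral_add
        (x.continuous.intervalIntegrable _ _) (y.continuous.intervalIntegrable _ _)
      map_smul' := fun c x => intervalIntegral.integral_smul c _ } |t| fun x => by
    have := intervalIntegral.norm_integral_le_of_norm_le_const (a := (0 : ℝ)) (b := t)
      (f := x) (C := ‖x‖) fun τ _ => x.norm_coe_le_norm τ
    rw [sub_zero, mul_comm] at this
    exact this

/-- Each curve of the tuple is the derivative of the preceding one. -/
def derivTuples (k : ℕ) : Submodule ℝ (CurveTuple k) where
  carrier := {Ψ | ∀ i < k, ∀ t,
    Ψ (ix k i) t = Ψ (ix k i) 0 + curveInt t (Ψ (ix k (i + 1)))}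
  add_mem' := by
    intro Ψ Φ hΨ hΦ i hi t
    simp only [Pi.add_apply, BoundedContinuousFunction.add_apply, map_add, hΨ i hi t, hΦ i hi t]
    abel
  zero_mem' := by intro i _ t; simp
  smul_mem' := by
    intro c Ψ hΨ i hi t
    simp only [Pi.smul_apply, BoundedContinuousFunction.smul_apply, map_smul, hΨ i hi t, smul_add]

lemma mem_derivTuples {Ψ : CurveTuple k} : Ψ ∈ derivTuples k ↔ ∀ i < k, ∀ t,
    Ψ (ix k i) t = Ψ (ix k i) 0 + curveInt t (Ψ (ix k (i + 1))) := Iff.rfl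

lemma isClosed_derivTuples (k : ℕ) : IsClosed (derivTuples k : Set (CurveTuple k)) := by
  have : (derivTuples k : Set (CurveTuple k)) = ⋂ i, ⋂ (_ : i < k), ⋂ t,
      {Ψ | Ψ (ix k i) t = Ψ (ix k i) 0 + curveInt t (Ψ (ix k (i + 1)))} := by
    ext Ψ; simp [mem_derivTuples]
  rw [this]
  refine isClosed_iInter fun i => isClosed_iInter fun _ => isClosed_iInter fun t => ?_
  have hev : ∀ s : ℝ, Continuous fun Ψ : CurveTuple k => Ψ (ix k i) s := fun s =>
    (BoundedContinuousFunction.evalCLM ℝ s).continuous.comp (continuous_apply _)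
  exact isClosed_eq (hev t)
    ((hev 0).add ((curveInt t).continuous.comp (continuous_apply _)))

lemma hasDerivAt_of_mem_derivTuples {Ψ : CurveTuple k} (h : Ψ ∈ derivTuples k) {i : ℕ}
    (hi : i < k) (t : ℝ) : HasDerivAt (fun t => Ψ (ix k i) t) (Ψ (ix k (i + 1)) t) t := by
  have e : (fun t => Ψ (ix k i) t) = fun t => Ψ (ix k i) 0 + ∫ τ in (0 : ℝ)..t,
      Ψ (ix k (i + 1)) τ := funext fun t => h i hi t
  rw [e]
  have hc := (Ψ (ix k (i + 1))).continuous
  exact (intervalIntegral.integral_hasDerivAt_right (hc.intervalIntegrable _ _)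
    (hc.stronglyMeasurableAtFilter _ _) hc.continuousAt).const_add _

lemma hasDerivAt_clm_of_mem_derivTuples {Ψ : CurveTuple k} (h : Ψ ∈ derivTuples k) {i : ℕ}
    (hi : i < k) (l : Seq ℕ+ →L[ℂ] ℂ) (t : ℝ) :
    HasDerivAt (fun t => l (Ψ (ix k i) t)) (l (Ψ (ix k (i + 1)) t)) t :=
  ((l.restrictScalars ℝ).hasFDerivAt).comp_hasDerivAt t (hasDerivAt_of_mem_derivTuples h hi t)

lemma mem_derivTuples_of_hasDerivAt {Ψ : CurveTuple k} (h : ∀ i < k, ∀ (j : ℕ+) (t : ℝ),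
    HasDerivAt (fun t => Ψ (ix k i) t j) (Ψ (ix k (i + 1)) t j) t) : Ψ ∈ derivTuples k := by
  rw [mem_derivTuples]
  intro i hi t
  ext j
  have hc : Continuous fun t => Ψ (ix k (i + 1)) t j := continuous_apply_curve (Seq.eval j) _
  have h3 := intervalIntegral.integral_eq_sub_of_hasDerivAt (a := 0) (b := t)
    (fun τ _ => h i hi j τ) (hc.intervalIntegrable _ _)
  have h4 : curveInt t (Ψ (ix k (i + 1))) j = ∫ τ in (0 : ℝ)..t, Ψ (ix k (i + 1)) τ j := by
    have := ((Seq.eval j).restrictScalars ℝ).intervalIntegral_comp_comm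
      ((Ψ (ix k (i + 1))).continuous.intervalIntegrable (μ := volume) 0 t)
    exact this.symm
  rw [lp.coeFn_add, Pi.add_apply, h4, h3]
  ring

lemma iteratedDeriv_clm_of_mem_derivTuples {Ψ : CurveTuple k} (h : Ψ ∈ derivTuples k)
    (l : Seq ℕ+ →L[ℂ] ℂ) {i : ℕ} (hi : i ≤ k) :
    iteratedDeriv i (fun t => l (Ψ (ix k 0) t)) = fun t => l (Ψ (ix k i) t) := by
  induction i with
  | zero => exact iteratedDeriv_zero
  | succ i ih =>
    rw [iteratedDeriv_succ, ih (by omega)]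
    funext t
    exact (hasDerivAt_clm_of_mem_derivTuples h (by omega) l t).deriv

lemma contDiff_clm_of_mem_derivTuples {Ψ : CurveTuple k} (h : Ψ ∈ derivTuples k)
    (l : Seq ℕ+ →L[ℂ] ℂ) : ContDiff ℝ k (fun t => l (Ψ (ix k 0) t)) := by
  rw [contDiff_nat_iff_iteratedDeriv]
  refine ⟨fun i hi => ?_, fun i hi => ?_⟩
  · rw [iteratedDeriv_clm_of_mem_derivTuples h l hi]
    exact continuous_apply_curve l _
  · rw [iteratedDeriv_clm_of_mem_derivTuples h l hi.le]
    exact fun t => (hasDerivAt_clm_of_mem_derivTuples h hi l t).differentiableAt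

/-- Support in (0,T) makes the identity valid for all real t, so derivatives can be taken on the
whole line. -/
lemma setIntegral_Iic_of_support {h : ℝ → ℂ} (hc : Continuous h)
    (h0 : ∀ τ, τ ∉ Ioo 0 T → h τ = 0) (t : ℝ) :
    ∫ τ in Iic t, h τ ∂(timeMeasure T) = ∫ τ in (0 : ℝ)..t, h τ := by
  have hs : Function.support h ⊆ Ioo 0 T := fun τ hτ => by
    by_contra h1
    exact hτ (h0 τ h1)
  have hi : Integrable h := by
    rw [← integrableOn_iff_integrable_of_support_subset hs]
    exact (hc.integrableOn_Icc (a := 0) (b := T)).mono_set Ioo_subset_Icc_self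
  have e1 : ∫ τ in Iic t, h τ ∂(timeMeasure T) = ∫ τ in Iic t, h τ := by
    rw [Measure.restrict_restrict measurableSet_Iic]
    refine (setIntegral_eq_of_subset_of_forall_sdiff_eq_zero measurableSet_Iic
      inter_subset_left ?_).symm
    exact fun x hx => h0 x fun hx' => hx.2 ⟨hx.1, hx'⟩
  rw [e1, ← intervalIntegral.integral_Iic_sub_Iic hi.integrableOn hi.integrableOn,
    setIntegral_eq_zero_of_forall_eq_zero (t := Iic (0 : ℝ)), sub_zero]
  exact fun x hx => h0 x fun hx' => absurd hx'.1 (not_lt.2 hx)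

/-- The scalar Duhamel integral. -/
def scalarDuhamel (j : ℕ+) (G : ℝ → ℂ) (t : ℝ) : ℂ :=
  Complex.I * (phase j (-t) * ∫ τ in (0 : ℝ)..t, phase j τ * G τ)

lemma hasDerivAt_scalarDuhamel (j : ℕ+) {G : ℝ → ℂ} (hG : Continuous G) (t : ℝ) :
    HasDerivAt (scalarDuhamel j G)
      (Complex.I * G t - Complex.I * eigenvalue j * scalarDuhamel j G t) t := by
  have hc : Continuous fun τ => phase j τ * G τ := (continuous_phase j).mul hG
  have h1 : HasDerivAt (fun t => ∫ τ in (0 : ℝ)..t, phase j τ * G τ) (phase j t * G t) t :=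
    intervalIntegral.integral_hasDerivAt_right (hc.intervalIntegrable _ _)
      (hc.stronglyMeasurableAtFilter _ _) hc.continuousAt
  have h2 : HasDerivAt (fun t => phase j (-t)) (-(Complex.I * eigenvalue j * phase j (-t))) t := by
    have := (hasDerivAt_phase j (-t)).scomp t (hasDerivAt_neg t)
    simpa [Function.comp_def] using this
  have h3 := (h2.mul h1).const_mul Complex.I
  convert! h3 using 1
  rw [scalarDuhamel]
  linear_combination (-Complex.I * G t) * phase_neg_mul_phase j t

/-- Integration by parts, with no boundary term at 0. The right-hand side is also the time
derivative of the Duhamel integral of G (`hasDerivAt_scalarDuhamel`), so Duhamel integration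
commutes with d/dt. -/
lemma scalarDuhamel_deriv (j : ℕ+) {G G' : ℝ → ℂ} (hG : ∀ t, HasDerivAt G (G' t) t)
    (hG' : Continuous G') (h0 : G 0 = 0) (t : ℝ) :
    scalarDuhamel j G' t = Complex.I * G t - Complex.I * eigenvalue j * scalarDuhamel j G t := by
  have hGc : Continuous G := continuous_iff_continuousAt.2 fun t => (hG t).continuousAt
  have hc1 : Continuous fun τ => phase j τ * G τ := (continuous_phase j).mul hGc
  have hc2 : Continuous fun τ => phase j τ * G' τ := (continuous_phase j).mul hG'
  have hc3 : Continuous fun τ => Complex.I * eigenvalue j * (phase j τ * G τ) :=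
    continuous_const.mul hc1
  have hc4 : Continuous fun τ => Complex.I * eigenvalue j * (phase j τ * G τ) + phase j τ * G' τ :=
    hc3.add hc2
  have h1 : ∫ τ in (0 : ℝ)..t, (Complex.I * eigenvalue j * (phase j τ * G τ) + phase j τ * G' τ) =
      phase j t * G t := by
    rw [intervalIntegral.integral_eq_sub_of_hasDerivAt (f := fun τ => phase j τ * G τ)
      (fun τ _ => ?_) (hc4.intervalIntegrable _ _), h0, mul_zero, sub_zero]
    convert! (hasDerivAt_phase j τ).mul (hG τ) using 1
    ring
  rw [intervalIntegral.integral_add (hc3.intervalIntegrable _ _)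
    (hc2.intervalIntegrable _ _), intervalIntegral.integral_const_mul] at h1
  rw [scalarDuhamel, scalarDuhamel]
  linear_combination Complex.I * phase j (-t) * h1 + Complex.I * G t * phase_neg_mul_phase j t

/-- The tuple of derivatives of a test function. -/
def IsTestTuple (u : ControlTuple k T) (θ : ℝ → ℝ) : Prop :=
  IsTestFunction 0 T θ ∧
    ∀ i : Fin (k + 1), u i =ᵐ[volume.restrict (Ioo 0 T)] iteratedDeriv i θ

/-- By the Leibniz rule, the i-th component is the Duhamel integral of the i-th derivative of the
source θ·m_j(Ψ). -/
lemma IsTestTuple.leibniz_apply (hT : 0 ≤ T) (hm : IsTame m) {u : ControlTuple k T} {θ : ℝ → ℝ}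
    (hu : IsTestTuple u θ) {Ψ : CurveTuple k} (hΨ : Ψ ∈ derivTuples k) {i : ℕ} (hi : i ≤ k)
    (t : ℝ) (j : ℕ+) : leibniz hT hm u Ψ (ix k i) t j =
      scalarDuhamel j (iteratedDeriv i fun τ => (θ τ : ℂ) * m j (Ψ (ix k 0) τ)) t := by
  set F : ℝ → ℂ := fun τ => (θ τ : ℂ) * m j (Ψ (ix k 0) τ) with hF
  have hθc : ContDiff ℝ ∞ (fun τ => (θ τ : ℂ)) := Complex.ofRealCLM.contDiff.comp hu.1.1
  have hgc := contDiff_clm_of_mem_derivTuples hΨ (m j)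
  have hFc : ContDiff ℝ k F := (hθc.of_le (by exact_mod_cast le_top)).mul hgc
  have hθd : ∀ q, iteratedDeriv q (fun τ => (θ τ : ℂ)) = fun τ => ((iteratedDeriv q θ τ : ℝ) : ℂ) := by
    intro q
    induction q with
    | zero => simp
    | succ q ih =>
      funext τ
      rw [iteratedDeriv_succ, ih, iteratedDeriv_succ]
      exact ((((hu.1.iteratedDeriv q).1.differentiable (by simp)) τ).hasDerivAt.ofReal_comp).deriv
  have hFd : iteratedDeriv i F = fun τ => ∑ q ∈ Finset.range (i + 1),
      ((i.choose q : ℝ) : ℂ) * (((iteratedDeriv q θ τ : ℝ) : ℂ) * m j (Ψ (ix k (i - q)) τ)) := by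
    funext τ
    rw [hF, iteratedDeriv_fun_mul ((hθc.of_le (by exact_mod_cast le_top)).contDiffAt)
      (hgc.of_le (by exact_mod_cast hi)).contDiffAt]
    refine Finset.sum_congr rfl fun q _ => ?_
    rw [hθd, iteratedDeriv_clm_of_mem_derivTuples hΨ (m j) (by omega)]
    push_cast; ring
  have hGc : Continuous (iteratedDeriv i F) := hFc.continuous_iteratedDeriv i (by exact_mod_cast hi)
  have hG0 : ∀ τ, τ ∉ Ioo 0 T → phase j τ * iteratedDeriv i F τ = 0 := by
    intro τ hτ
    rw [hFd]
    simp only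
    rw [Finset.sum_eq_zero, mul_zero]
    intro q _
    rw [(hu.1.iteratedDeriv q).eq_zero_of_notMem hτ]; simp
  have hpc : Continuous fun τ => phase j τ * iteratedDeriv i F τ := (continuous_phase j).mul hGc
  rw [scalarDuhamel, ← setIntegral_Iic_of_support hpc hG0,
    BilinearSchrodinger.leibniz_apply, ix_val hi]
  have e1 : (∑ q ∈ Finset.range (i + 1), (i.choose q : ℝ) •
      duhamel hT hm (u (ix k q)) (Ψ (ix k (i - q)))) t j =
      ∑ q ∈ Finset.range (i + 1), ((i.choose q : ℝ) : ℂ) *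
        duhamel hT hm (u (ix k q)) (Ψ (ix k (i - q))) t j := by
    have := map_sum ((Seq.eval j).restrictScalars ℝ ∘L BoundedContinuousFunction.evalCLM ℝ t)
      (fun q => (i.choose q : ℝ) • duhamel hT hm (u (ix k q)) (Ψ (ix k (i - q))))
      (Finset.range (i + 1))
    simp only [map_smul] at this
    exact this
  rw [e1]
  simp only [duhamel_apply]
  have e2 : ∀ q ∈ Finset.range (i + 1), ((i.choose q : ℝ) : ℂ) * (Complex.I * (phase j (-t) *
      ∫ τ in Iic t, phase j τ * (u (ix k q) τ * m j (Ψ (ix k (i - q)) τ)) ∂(timeMeasure T))) =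
      Complex.I * (phase j (-t) * ∫ τ in Iic t, ((i.choose q : ℝ) : ℂ) * (phase j τ *
        (u (ix k q) τ * m j (Ψ (ix k (i - q)) τ))) ∂(timeMeasure T)) := by
    intro q _
    rw [integral_const_mul]; ring
  rw [Finset.sum_congr rfl e2, ← Finset.mul_sum, ← Finset.mul_sum, ← integral_finsetSum]
  · congr 2
    refine integral_congr_ae (ae_restrict_of_ae ?_)
    have hae : ∀ᵐ τ ∂(timeMeasure T), ∀ q : Fin (k + 1), u q τ = iteratedDeriv q θ τ :=
      ae_all_iff.2 hu.2
    filter_upwards [hae] with τ hτ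
    rw [hFd, Finset.mul_sum]
    refine Finset.sum_congr rfl fun q hq => ?_
    rw [hτ, ix_val (by have := Finset.mem_range.1 hq; omega)]
    ring
  · intro q _
    exact ((integrable_phase_mul _ _ _ j).const_mul _).integrableOn

/-- The Duhamel operator preserves tuples of successive derivatives, and determines the highest
derivative at the final time. -/
lemma leibniz_mem_derivTuples_of_test (hT : 0 ≤ T) (hm : IsTame m) {u : ControlTuple k T}
    {θ : ℝ → ℝ} (hu : IsTestTuple u θ) {Ψ : CurveTuple k} (hΨ : Ψ ∈ derivTuples k) :
    leibniz hT hm u Ψ ∈ derivTuples k ∧ ∀ i < k, ∀ j : ℕ+,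
      leibniz hT hm u Ψ (ix k (i + 1)) T j =
        -(Complex.I * eigenvalue j) * leibniz hT hm u Ψ (ix k i) T j := by
  -- G is the i-th derivative of the source. It vanishes at 0, which gives the relation between
  -- consecutive components, and at T, which reduces that relation to multiplication by -iλ_j.
  have key : ∀ i < k, ∀ j : ℕ+, ∃ G : ℝ → ℂ, Continuous G ∧ G T = 0 ∧
      (∀ t, leibniz hT hm u Ψ (ix k i) t j = scalarDuhamel j G t) ∧
      ∀ t, leibniz hT hm u Ψ (ix k (i + 1)) t j =
        Complex.I * G t - Complex.I * eigenvalue j * scalarDuhamel j G t := by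
    intro i hi j
    set F : ℝ → ℂ := fun τ => (θ τ : ℂ) * m j (Ψ (ix k 0) τ) with hF
    have hθc : ContDiff ℝ ∞ (fun τ => (θ τ : ℂ)) := Complex.ofRealCLM.contDiff.comp hu.1.1
    have hFc : ContDiff ℝ k F :=
      (hθc.of_le (by exact_mod_cast le_top)).mul (contDiff_clm_of_mem_derivTuples hΨ (m j))
    have hsupp : ∀ τ, τ ∉ Ioo 0 T → iteratedDeriv i F τ = 0 := by
      intro τ hτ
      have h1 : τ ∉ tsupport F := by
        intro h2
        have h3 : tsupport F ⊆ tsupport θ := closure_mono fun x hx hx' => hx (by simp [F, hx'])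
        exact hτ (hu.1.2.2 (h3 h2))
      rw [(notMem_tsupport_iff_eventuallyEq.1 h1).iteratedDeriv_eq i]
      simp
    have hd : ∀ t, HasDerivAt (iteratedDeriv i F) (iteratedDeriv (i + 1) F t) t := by
      intro t
      rw [iteratedDeriv_succ]
      exact (hFc.differentiable_iteratedDeriv i (by exact_mod_cast hi) t).hasDerivAt
    refine ⟨iteratedDeriv i F, hFc.continuous_iteratedDeriv i (by exact_mod_cast hi.le),
      hsupp T (by simp), fun t => hu.leibniz_apply hT hm hΨ hi.le t j, fun t => ?_⟩
    rw [hu.leibniz_apply hT hm hΨ hi t j]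
    exact scalarDuhamel_deriv j hd
      (hFc.continuous_iteratedDeriv (i + 1) (by exact_mod_cast hi)) (hsupp 0 (by simp)) t
  constructor
  · refine mem_derivTuples_of_hasDerivAt fun i hi j t => ?_
    obtain ⟨G, hG, -, h1, h2⟩ := key i hi j
    rw [h2 t, show (fun t => leibniz hT hm u Ψ (ix k i) t j) = scalarDuhamel j G from funext h1]
    exact hasDerivAt_scalarDuhamel j hG t
  · intro i hi j
    obtain ⟨G, -, hGT, h1, h2⟩ := key i hi j
    rw [h2, hGT, h1]; ring

/-- For fixed Ψ both properties are closed linear conditions on the control, so they pass from test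
functions to their closure. -/
lemma leibniz_mem_derivTuples (hT : 0 ≤ T) (hm : IsTame m) (u : H0 k T) {Ψ : CurveTuple k}
    (hΨ : Ψ ∈ derivTuples k) :
    leibniz hT hm u Ψ ∈ derivTuples k ∧ ∀ i < k, ∀ j : ℕ+,
      leibniz hT hm u Ψ (ix k (i + 1)) T j =
        -(Complex.I * eigenvalue j) * leibniz hT hm u Ψ (ix k i) T j := by
  have hcont : Continuous fun v : ControlTuple k T => leibniz hT hm v Ψ :=
    ((leibniz hT hm).flip Ψ).continuous
  set ev : ℕ → ℕ+ → CurveTuple k →L[ℝ] ℂ := fun i j =>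
    ((Seq.eval j).restrictScalars ℝ) ∘L (BoundedContinuousFunction.evalCLM ℝ T) ∘L
      (ContinuousLinearMap.proj (ix k i))
  have hev : ∀ i j (Φ : CurveTuple k), ev i j Φ = Φ (ix k i) T j := fun _ _ _ => rfl
  let S : Submodule ℝ (ControlTuple k T) :=
    { carrier := {v | leibniz hT hm v Ψ ∈ derivTuples k ∧ ∀ i < k, ∀ j : ℕ+,
        ev (i + 1) j (leibniz hT hm v Ψ) =
          -(Complex.I * eigenvalue j) * ev i j (leibniz hT hm v Ψ)}
      add_mem' := by
        intro v w hv hw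
        have e : leibniz hT hm (v + w) Ψ = leibniz hT hm v Ψ + leibniz hT hm w Ψ := by
          rw [map_add]; rfl
        refine ⟨e ▸ (derivTuples k).add_mem hv.1 hw.1, fun i hi j => ?_⟩
        rw [e, map_add, map_add, hv.2 i hi j, hw.2 i hi j, mul_add]
      zero_mem' := by
        have e : leibniz hT hm (0 : ControlTuple k T) Ψ = 0 := by rw [map_zero]; rfl
        refine ⟨e ▸ (derivTuples k).zero_mem, fun i hi j => ?_⟩
        rw [e, map_zero, map_zero, mul_zero]
      smul_mem' := by
        intro c v hv
        have e : leibniz hT hm (c • v) Ψ = c • leibniz hT hm v Ψ := by rw [map_smul]; rfl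
        refine ⟨e ▸ (derivTuples k).smul_mem c hv.1, fun i hi j => ?_⟩
        rw [e, map_smul, map_smul, hv.2 i hi j, mul_smul_comm] }
  have hS : IsClosed (S : Set (ControlTuple k T)) := by
    have : (S : Set (ControlTuple k T)) = (fun v => leibniz hT hm v Ψ) ⁻¹' (derivTuples k) ∩
        ⋂ i, ⋂ (_ : i < k), ⋂ j, {v | ev (i + 1) j (leibniz hT hm v Ψ) =
          -(Complex.I * eigenvalue j) * ev i j (leibniz hT hm v Ψ)} := by
      ext v
      simp [S]
    rw [this]
    refine ((isClosed_derivTuples k).preimage hcont).inter ?_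
    refine isClosed_iInter fun i => isClosed_iInter fun _ => isClosed_iInter fun j => ?_
    exact isClosed_eq ((ev (i + 1) j).continuous.comp hcont)
      (continuous_const.mul ((ev i j).continuous.comp hcont))
  have hle : H0 k T ≤ S := by
    refine Submodule.topologicalClosure_minimal _ (Submodule.span_le.2 ?_) hS
    rintro v ⟨θ, hθ, hv⟩
    exact leibniz_mem_derivTuples_of_test hT hm ⟨hθ, hv⟩ hΨ
  exact hle u.2

/-- The final value, in the weighted space of order `k`. -/
lemma leibniz_last_apply (hT : 0 ≤ T) (hm : IsTame m) (u : H0 k T) {Ψ : CurveTuple k}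
    (hΨ : Ψ ∈ derivTuples k) {i : ℕ} (hi : i ≤ k) (j : ℕ+) :
    leibniz hT hm u Ψ (ix k i) T j =
      (-(Complex.I * eigenvalue j)) ^ i * leibniz hT hm u Ψ (ix k 0) T j := by
  induction i with
  | zero => simp
  | succ i ih =>
    rw [(leibniz_mem_derivTuples hT hm u hΨ).2 i (by omega) j, ih (by omega), pow_succ]
    ring

end Tuple

/-! ### Existence, uniqueness and regularity of the solution for small controls -/

/-- The contraction is run inside the closed subspace E. With E the tuples of successive
derivatives, the fixed point is automatically such a tuple. -/
lemma exists_eq_add_apply {Y : Type*} [NormedAddCommGroup Y] [NormedSpace ℝ Y] [CompleteSpace Y]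
    (A : Y →L[ℝ] Y) (hA : ∀ x, ‖A x‖ ≤ 1 / 2 * ‖x‖) {E : Submodule ℝ Y} (hE : IsClosed (E : Set Y))
    (hAE : ∀ x ∈ E, A x ∈ E) {y : Y} (hy : y ∈ E) :
    ∃ x ∈ E, x = y + A x ∧ ‖x‖ ≤ 2 * ‖y‖ := by
  have : CompleteSpace E := hE.completeSpace_coe
  let f : E → E := fun x => ⟨y + A x, E.add_mem hy (hAE x x.2)⟩
  have hf : ContractingWith (1 / 2) f := by
    refine ⟨by rw [← NNReal.coe_lt_coe]; norm_num, LipschitzWith.of_dist_le_mul fun a b => ?_⟩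
    rw [Subtype.dist_eq, dist_add_left, dist_eq_norm, ← map_sub, Subtype.dist_eq, dist_eq_norm]
    exact hA _
  have hx := hf.fixedPoint_isFixedPt
  have hx' : (hf.fixedPoint : Y) = y + A hf.fixedPoint := (congrArg Subtype.val hx).symm
  refine ⟨hf.fixedPoint, Subtype.mem _, hx', ?_⟩
  have h1 : ‖(hf.fixedPoint : Y)‖ ≤ ‖y‖ + 1 / 2 * ‖(hf.fixedPoint : Y)‖ := by
    conv_lhs => rw [hx']
    exact (norm_add_le _ _).trans (add_le_add le_rfl (hA _))
  linarith

lemma ofWeighted_zero_repr (ψ : L2Space) : ofWeighted 0 (phiBasis.repr ψ) = ψ := by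
  refine ext_coeff fun j => ?_
  rw [coeff_ofWeighted, phiBasis_repr]; simp

section Solution

variable {T : ℝ} {μ : ℝ → ℝ} {hμ : MemLp μ 2 (volume.restrict (Ioo (0 : ℝ) 1))} {N : ℕ}

lemma exp_eq_phase_mul (j : ℕ+) (t τ : ℝ) :
    Complex.exp (-(Complex.I * eigenvalue j * (t - τ))) = phase j (-t) * phase j τ := by
  rw [phase, phase, ← Complex.exp_add]; push_cast; ring_nf

/-- Dictionary between the mild formulation and the operator on weighted coordinates, for any weight
N in which multiplication is tame. -/
lemma duhamel_coeff (hT : 0 ≤ T) (hm : IsTame (wmul hμ N)) (f : L2Time T) (y : Curve)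
    {ψ : ℝ → L2Space} (h : ∀ t ∈ Icc 0 T, ψ t = ofWeighted N (y t)) {t : ℝ} (ht : t ∈ Icc 0 T)
    (j : ℕ+) :
    Complex.I * ∫ τ in (0 : ℝ)..t, Complex.exp (-(Complex.I * eigenvalue j * (t - τ))) * (f τ : ℂ) *
        ∫ x in Ioo (0 : ℝ) 1, (μ x : ℂ) * ψ τ x * (phi j x : ℂ) =
      ((j : ℂ) ^ N)⁻¹ * duhamel hT hm f y t j := by
  have e : ∫ τ in (0 : ℝ)..t, Complex.exp (-(Complex.I * eigenvalue j * (t - τ))) * (f τ : ℂ) *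
      ∫ x in Ioo (0 : ℝ) 1, (μ x : ℂ) * ψ τ x * (phi j x : ℂ) =
      ∫ τ in (0 : ℝ)..t, ((j : ℂ) ^ N)⁻¹ * phase j (-t) * (phase j τ * (f τ * wmul hμ N j (y τ))) := by
    refine intervalIntegral.integral_congr fun τ hτ => ?_
    rw [uIcc_of_le ht.1] at hτ
    rw [← inner_mulPhi hμ, h τ ⟨hτ.1, hτ.2.trans ht.2⟩, wmul_apply, exp_eq_phase_mul]
    field_simp [pnat_pow_ne_zero N j]
  rw [duhamel_apply, setIntegral_Iic_timeMeasure ht, e, intervalIntegral.integral_const_mul]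
  ring

lemma isSolution_of_eq (hT : 0 ≤ T) (hm : IsTame (wmul hμ N)) (f : L2Time T) {x : Seq ℕ+}
    {y : Curve} (h : y = freeCurve x + duhamel hT hm f y) :
    IsSolution T μ f (ofWeighted N x) fun t => ofWeighted N (y t) := by
  refine ⟨((ofWeighted N).continuous.comp y.continuous).continuousOn, fun t ht j => ?_⟩
  rw [duhamel_coeff hT hm f y (fun _ _ => rfl) ht, coeff_ofWeighted, coeff_ofWeighted]
  conv_lhs => rw [h]
  rw [BoundedContinuousFunction.add_apply, lp.coeFn_add, Pi.add_apply, freeCurve_apply,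
    Seq.rot_apply, phase_neg]
  ring

/-- A solution, as a curve in `ℓ²`. -/
lemma IsSolution.exists_curve (hT : 0 ≤ T) (hm : IsTame (wmul hμ 0)) {f : L2Time T}
    {ψ₀ : L2Space} {ψ : ℝ → L2Space} (h : IsSolution T μ f ψ₀ ψ) :
    ∃ y : Curve, (∀ t ∈ Icc 0 T, y t = phiBasis.repr (ψ t)) ∧
      (∀ t, y t = y (projIcc 0 T hT t)) ∧
      ∀ t ∈ Icc 0 T, y t = freeCurve (phiBasis.repr ψ₀) t + duhamel hT hm f y t := by
  let y : Curve := (BoundedContinuousFunction.mkOfCompact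
    (⟨fun t : Icc 0 T => phiBasis.repr (ψ t),
      phiBasis.repr.continuous.comp h.1.domRestrict⟩ : C(Icc 0 T, Seq ℕ+))).compContinuous
    ⟨projIcc 0 T hT, continuous_projIcc⟩
  have hy : ∀ t, y t = phiBasis.repr (ψ (projIcc 0 T hT t)) := fun t => rfl
  have hy1 : ∀ t ∈ Icc 0 T, y t = phiBasis.repr (ψ t) := fun t ht => by
    rw [hy, projIcc_of_mem hT ht]
  have hy2 : ∀ t ∈ Icc 0 T, ψ t = ofWeighted 0 (y t) := fun t ht => by
    rw [hy1 t ht, ofWeighted_zero_repr]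
  refine ⟨y, hy1, fun t => by rw [hy, hy, projIcc_val], fun t ht => ?_⟩
  ext j
  rw [lp.coeFn_add, Pi.add_apply, hy1 t ht, phiBasis_repr, h.2 t ht j,
    duhamel_coeff hT hm f y hy2 ht, freeCurve_apply, Seq.rot_apply, phiBasis_repr, phase_neg]
  simp

/-- The difference of two solutions is a fixed point of a linear operator of norm less than one. The
curves are frozen outside [0,T], so the sup norm over ℝ is the one over [0,T]. -/
lemma IsSolution.unique (hT : 0 ≤ T) (hm : IsTame (wmul hμ 0)) {f : L2Time T}
    (hf : hm.const hT * ‖f‖ < 1) {ψ₀ : L2Space} {ψ χ : ℝ → L2Space}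
    (h : IsSolution T μ f ψ₀ ψ) (h' : IsSolution T μ f ψ₀ χ) {t : ℝ} (ht : t ∈ Icc 0 T) :
    ψ t = χ t := by
  obtain ⟨y, h1, h2, h3⟩ := h.exists_curve hT hm
  obtain ⟨z, h1', h2', h3'⟩ := h'.exists_curve hT hm
  have hd : ∀ t ∈ Icc 0 T, (y - z) t = duhamel hT hm f (y - z) t := by
    intro t ht
    rw [map_sub, BoundedContinuousFunction.sub_apply, BoundedContinuousFunction.sub_apply]
    conv_lhs => rw [h3 t ht, h3' t ht]
    abel
  have hn : ‖y - z‖ ≤ hm.const hT * ‖f‖ * ‖y - z‖ := by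
    have := hm.const_nonneg hT
    refine (BoundedContinuousFunction.norm_le (by positivity)).2 fun t => ?_
    have e : (y - z) t = (y - z) (projIcc 0 T hT t) := by
      rw [BoundedContinuousFunction.sub_apply, BoundedContinuousFunction.sub_apply, h2 t, h2' t]
    rw [e, hd _ (projIcc 0 T hT t).2]
    exact (BoundedContinuousFunction.norm_coe_le_norm _ _).trans (norm_duhamel_le hT hm f _)
  have h0 : y - z = 0 := by
    rw [← norm_le_zero_iff]
    nlinarith [norm_nonneg (y - z)]
  apply phiBasis.repr.injective
  rw [← h1 t ht, ← h1' t ht, sub_eq_zero.1 h0]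

/-- The final state is defined through a choice of solution; uniqueness makes it that of any
solution at hand. -/
lemma IsSolution.finalState_eq (hT : 0 ≤ T) (hm : IsTame (wmul hμ 0)) {f : L2Time T}
    (hf : hm.const hT * ‖f‖ < 1) {ψ₀ : L2Space} {ψ : ℝ → L2Space}
    (h : IsSolution T μ f ψ₀ ψ) : finalState T μ f ψ₀ = ψ T := by
  have hex : ∃ ψ : ℝ → L2Space, IsSolution T μ f ψ₀ ψ := ⟨ψ, h⟩
  rw [finalState, dif_pos hex]
  exact hex.choose_spec.unique hT hm hf h ⟨hT, le_rfl⟩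

variable {k s : ℕ}

lemma norm_neg_I_mul_pi_sq_pow (i : ℕ) (a : ℂ) (ha : ‖a‖ ≤ 1) :
    ‖(-(Complex.I * Real.pi ^ 2)) ^ i * a‖ ≤ ‖(-(Complex.I * (Real.pi : ℂ) ^ 2)) ^ i‖ := by
  rw [norm_mul]
  exact mul_le_of_le_one_right (norm_nonneg _) ha

/-- The free evolution and its time derivatives. -/
def freeTuple (k : ℕ) : Seq ℕ+ →L[ℝ] CurveTuple k :=
  ContinuousLinearMap.pi fun i : Fin (k + 1) => (freeCurve.comp
    (Seq.diag (fun j : ℕ+ => (-(Complex.I * Real.pi ^ 2)) ^ (i : ℕ) * ((j : ℂ) ^ (2 * (k - i)))⁻¹)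
      _ fun j => norm_neg_I_mul_pi_sq_pow i _ (norm_natCast_pow_inv_le _ j))).restrictScalars ℝ

lemma freeTuple_apply (x : Seq ℕ+) (i : Fin (k + 1)) (t : ℝ) (j : ℕ+) :
    freeTuple k x i t j = phase j (-t) *
      ((-(Complex.I * Real.pi ^ 2)) ^ (i : ℕ) * ((j : ℂ) ^ (2 * (k - i)))⁻¹ * x j) := rfl

lemma eigenvalue_eq (j : ℕ+) : (eigenvalue j : ℂ) = Real.pi ^ 2 * (j : ℂ) ^ 2 := by
  rw [eigenvalue]; push_cast; ring

lemma hasDerivAt_phase_neg (j : ℕ+) (t : ℝ) :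
    HasDerivAt (fun t => phase j (-t)) (-(Complex.I * eigenvalue j * phase j (-t))) t := by
  have := (hasDerivAt_phase j (-t)).scomp t (hasDerivAt_neg t)
  simpa [Function.comp_def] using this

/-- A time derivative multiplies mode j by -iλ_j = -iπ²j², and j² is exactly the change of weight
from one component to the next. -/
lemma freeTuple_mem_derivTuples (x : Seq ℕ+) : freeTuple k x ∈ derivTuples k := by
  refine mem_derivTuples_of_hasDerivAt fun i hi j t => ?_
  simp only [freeTuple_apply]
  refine ((hasDerivAt_phase_neg j t).mul_const _).congr_deriv ?_
  rw [ix_val hi.le, ix_val hi, eigenvalue_eq, show k - i = (k - (i + 1)) + 1 by omega, mul_add,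
    pow_add, pow_succ (-(Complex.I * (Real.pi : ℂ) ^ 2)) i]
  have h1 : (j : ℂ) ≠ 0 := by exact_mod_cast j.ne_zero
  field_simp
  ring

/-- The contribution of the control to the final state. -/
def finalDuhamel (hT : 0 ≤ T) (hm : IsTame (wmul hμ N)) (k : ℕ) :
    ControlTuple k T →L[ℝ] CurveTuple k →L[ℝ] Seq ℕ+ :=
  (ContinuousLinearMap.compL ℝ (CurveTuple k) (CurveTuple k) (Seq ℕ+)
    (((((-(Complex.I * Real.pi ^ 2)) ^ k)⁻¹ • ContinuousLinearMap.id ℂ (Seq ℕ+)).restrictScalars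
      ℝ) ∘L (BoundedContinuousFunction.evalCLM ℝ T) ∘L (ContinuousLinearMap.proj (ix k k)))) ∘L
    leibniz hT hm

lemma finalDuhamel_apply (hT : 0 ≤ T) (hm : IsTame (wmul hμ N)) (u : ControlTuple k T)
    (Ψ : CurveTuple k) (j : ℕ+) : finalDuhamel hT hm k u Ψ j =
      ((-(Complex.I * Real.pi ^ 2)) ^ k)⁻¹ * leibniz hT hm u Ψ (ix k k) T j := rfl

lemma neg_I_mul_pi_sq_ne_zero : (-(Complex.I * (Real.pi : ℂ) ^ 2)) ≠ 0 :=
  neg_ne_zero.2 (mul_ne_zero Complex.I_ne_zero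
    (pow_ne_zero _ (Complex.ofReal_ne_zero.2 Real.pi_ne_zero)))

/-- At time T the top component carries (-iλ_j)^k = (-iπ²)^k j^{2k}. After removal of the constant,
j^{2k} converts coordinates of weight N into coordinates of weight N+2k: k derivatives of the
control in time pay for 2k in space. -/
lemma finalDuhamel_apply_of_mem (hT : 0 ≤ T) (hm : IsTame (wmul hμ N)) (u : H0 k T)
    {Ψ : CurveTuple k} (hΨ : Ψ ∈ derivTuples k) (j : ℕ+) :
    finalDuhamel hT hm k u Ψ j = (j : ℂ) ^ (2 * k) *
      duhamel hT hm (controlDeriv u 0) (Ψ (ix k 0)) T j := by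
  have h0 : leibniz hT hm u Ψ (ix k 0) = duhamel hT hm (controlDeriv u 0) (Ψ (ix k 0)) := by
    rw [leibniz_apply, ix_val (Nat.zero_le k)]
    have : ix k 0 = 0 := Fin.ext (ix_val (Nat.zero_le k))
    simp [this, controlDeriv]
  rw [finalDuhamel_apply, leibniz_last_apply hT hm u hΨ le_rfl, h0, eigenvalue_eq,
    show -(Complex.I * (Real.pi ^ 2 * (j : ℂ) ^ 2)) = -(Complex.I * Real.pi ^ 2) * (j : ℂ) ^ 2 by
      ring, mul_pow, ← pow_mul, mul_assoc ((-(Complex.I * (Real.pi : ℂ) ^ 2)) ^ k),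
    inv_mul_cancel_left₀ (pow_ne_zero _ neg_I_mul_pi_sq_ne_zero)]

lemma exists_tuple (hT : 0 ≤ T) (hm : IsTame (wmul hμ N)) (u : H0 k T)
    (hu : 2 ^ k * hm.const hT * ‖u‖ ≤ 1 / 2) (x : Seq ℕ+) :
    ∃ Ψ ∈ derivTuples k, Ψ = freeTuple k x + leibniz hT hm u Ψ ∧ ‖Ψ‖ ≤ 2 * ‖freeTuple k x‖ := by
  have h1 : ∀ Ψ : CurveTuple k, ‖leibniz hT hm (u : ControlTuple k T) Ψ‖ ≤ 1 / 2 * ‖Ψ‖ := fun Ψ => by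
    have h := norm_leibniz_le hT hm (u : ControlTuple k T) Ψ
    rw [Submodule.norm_coe] at h
    exact h.trans (mul_le_mul_of_nonneg_right hu (norm_nonneg _))
  have h2 : ∀ Ψ ∈ derivTuples k, leibniz hT hm (u : ControlTuple k T) Ψ ∈ derivTuples k :=
    fun Ψ hΨ => (leibniz_mem_derivTuples hT hm u hΨ).1
  have h3 := freeTuple_mem_derivTuples (k := k) x
  have h4 := isClosed_derivTuples k
  exact exists_eq_add_apply (leibniz hT hm (u : ControlTuple k T)) h1 h4 h2 h3

/-- For small controls the solution exists, with the expected regularity. -/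
lemma exists_solution (hT : 0 ≤ T) (hm0 : IsTame (wmul hμ 0)) (hm : IsTame (wmul hμ N))
    (hs : s = N + 2 * k) : ∃ δ : ℝ, 0 < δ ∧ ∀ u : H0 k T, ‖u‖ ≤ δ → ∀ x : Seq ℕ+,
      ∃ Ψ : CurveTuple k, Ψ = freeTuple k x + leibniz hT hm u Ψ ∧ ‖Ψ‖ ≤ 2 * ‖freeTuple k x‖ ∧
        finalState T μ (controlFun u) (ofWeighted s x) =
          ofWeighted s (Seq.rot T x + finalDuhamel hT hm k u Ψ) := by
  have hc0 : 0 ≤ hm0.const hT := hm0.const_nonneg hT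
  have hc : 0 ≤ 2 ^ k * hm.const hT := mul_nonneg (by positivity) (hm.const_nonneg hT)
  obtain ⟨c0, hc0e⟩ : ∃ c, hm0.const hT = c := ⟨_, rfl⟩
  obtain ⟨c, hce⟩ : ∃ c, 2 ^ k * hm.const hT = c := ⟨_, rfl⟩
  rw [hc0e] at hc0
  rw [hce] at hc
  -- One radius makes both operators at most 1/2 in norm: c governs the fixed point for tuples in
  -- weight N, c0 the uniqueness in L².
  refine ⟨1 / (2 * (c0 + c + 1)), by positivity, fun u hu x => ?_⟩
  have hu' : (c0 + c + 1) * ‖u‖ ≤ 1 / 2 := by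
    calc (c0 + c + 1) * ‖u‖ ≤ (c0 + c + 1) * (1 / (2 * (c0 + c + 1))) :=
          mul_le_mul_of_nonneg_left hu (by positivity)
      _ = 1 / 2 := by field_simp
  have hcu : c * ‖u‖ ≤ 1 / 2 := by nlinarith [norm_nonneg u]
  have hcu0 : c0 * ‖u‖ ≤ 1 / 2 := by nlinarith [norm_nonneg u]
  obtain ⟨Ψ, hΨ, h1, h2⟩ := exists_tuple hT hm u (hce ▸ hcu) x
  refine ⟨Ψ, h1, h2, ?_⟩
  have i0 : ix k 0 = 0 := Fin.ext (ix_val (Nat.zero_le k))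
  -- The initial datum, given in coordinates of weight s, is rewritten in coordinates of weight N.
  set x' : Seq ℕ+ := Seq.diag (fun j : ℕ+ => ((j : ℂ) ^ (2 * k))⁻¹) 1
    (norm_natCast_pow_inv_le _) x with hx'
  have hx'a : ∀ j, x' j = ((j : ℂ) ^ (2 * k))⁻¹ * x j := fun j => rfl
  have e0 : Ψ 0 = freeCurve x' + duhamel hT hm (controlDeriv u 0) (Ψ 0) := by
    conv_lhs => rw [h1]
    rw [Pi.add_apply, leibniz_apply]
    congr 1
    · ext t j
      rw [freeTuple_apply, freeCurve_apply, Seq.rot_apply, hx'a]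
      simp
    · simp [i0, controlDeriv]
  have hsol := isSolution_of_eq hT hm (controlDeriv u 0) e0
  have hinit : ofWeighted N x' = ofWeighted s x := by
    refine ext_coeff fun j => ?_
    rw [coeff_ofWeighted, coeff_ofWeighted, hx'a, hs, pow_add, mul_inv]; ring
  have hn0 : ‖controlDeriv u 0‖ ≤ ‖u‖ := PiLp.norm_apply_le (u : ControlTuple k T) 0
  have hfin := hsol.finalState_eq hT hm0 (lt_of_le_of_lt
    (hc0e ▸ (mul_le_mul_of_nonneg_left hn0 hc0).trans hcu0) (by norm_num))
  rw [hinit] at hfin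
  rw [controlFun, hfin]
  refine ext_coeff fun j => ?_
  rw [coeff_ofWeighted, coeff_ofWeighted, lp.coeFn_add, Pi.add_apply, Seq.rot_apply,
    finalDuhamel_apply_of_mem hT hm u hΨ, i0]
  conv_lhs => rw [e0]
  rw [BoundedContinuousFunction.add_apply, lp.coeFn_add, Pi.add_apply, freeCurve_apply,
    Seq.rot_apply, hx'a, hs, pow_add]
  field_simp [pnat_pow_ne_zero N j, pnat_pow_ne_zero (2 * k) j]

end Solution

/-! ### The end-point map in coordinates -/

section Projections

open Classical in
lemma coeff_projJ (J : Set ℕ+) (ψ : L2Space) (j : ℕ+) :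
    coeff j (projJ J ψ) = if j ∈ J then coeff j ψ else 0 := by
  have h1 : coeff j (projJ J ψ) = inner ℂ (projJ J (phiL2 j)) ψ :=
    ((spanJ J).inner_starProjection_left_eq_right _ _).symm
  split_ifs with hj
  · have h2 : projJ J (phiL2 j) = phiL2 j := Submodule.starProjection_eq_self_iff.2
      (Submodule.le_topologicalClosure _ (Submodule.subset_span ⟨j, hj, rfl⟩))
    rw [h1, h2, coeff]
  · have h2 : projJ J (phiL2 j) = 0 := by
      refine ((spanJ J).starProjection_apply_eq_zero_iff).2 ?_
      rw [spanJ, Submodule.orthogonal_closure]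
      refine (Submodule.mem_orthogonal _ _).2 fun v hv => ?_
      induction hv using Submodule.span_induction with
      | mem v hv =>
        obtain ⟨l, hl, rfl⟩ := hv
        exact coeff_phiL2_of_ne fun h => hj (h ▸ hl)
      | zero => exact inner_zero_left _
      | add x y _ _ hx hy => rw [inner_add_left, hx, hy, add_zero]
      | smul c x _ hx => rw [inner_smul_left, hx, mul_zero]
    rw [h1, h2, inner_zero_left]

lemma mem_spanJ_iff {J : Set ℕ+} {ψ : L2Space} : ψ ∈ spanJ J ↔ ∀ j ∉ J, coeff j ψ = 0 := by
  rw [← Submodule.starProjection_eq_self_iff]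
  change projJ J ψ = ψ ↔ _
  constructor
  · intro h j hj
    rw [← h, coeff_projJ, if_neg hj]
  · intro h
    refine ext_coeff fun j => ?_
    rw [coeff_projJ]
    split_ifs with hj
    · rfl
    · exact (h j hj).symm

lemma conj_phase (j : ℕ+) (t : ℝ) : (starRingEnd ℂ) (phase j t) = phase j (-t) := by
  rw [phase, phase, ← Complex.exp_conj]; simp

lemma inner_psi1 (T : ℝ) (ψ : L2Space) : inner ℂ (psi1 T) ψ = phase 1 T * coeff 1 ψ := by
  rw [psi1, inner_smul_left, ← phase_neg, conj_phase, neg_neg]; rfl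

lemma coeff_psi1 (T : ℝ) (j : ℕ+) :
    coeff j (psi1 T) = if j = 1 then phase 1 (-T) else 0 := by
  rw [psi1, coeff_smul, coeff_phiL2, ← phase_neg]; split_ifs <;> simp

/-- The first coordinate vector. -/
def groundSeq : Seq ℕ+ := phiBasis.repr (phiL2 1)

lemma groundSeq_apply (j : ℕ+) : groundSeq j = if j = 1 then 1 else 0 := by
  rw [groundSeq, phiBasis_repr, coeff_phiL2]

lemma weightedEquiv_phiH (s : ℕ) : weightedEquiv s (phiH s 1) = groundSeq := by
  ext j
  rw [weightedEquiv_apply, groundSeq_apply]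
  change (j : ℂ) ^ s * coeff j (phiL2 1) = _
  rw [coeff_phiL2]
  split_ifs with h
  · simp [h]
  · simp

open Classical in
/-- The operator `Π_{ψ_1(T)} P_J` in coordinates. -/
def tangentProj (T : ℝ) (J : Set ℕ+) : Seq ℕ+ →L[ℝ] Seq ℕ+ :=
  (ContinuousLinearMap.id ℝ (Seq ℕ+) - (Complex.reCLM ∘L
    ((phase 1 T • Seq.eval (1 : ℕ+)).restrictScalars ℝ)).smulRight (phase 1 (-T) • groundSeq)) ∘L
  ((Seq.diag (fun j : ℕ+ => if j ∈ J then (1 : ℂ) else 0) 1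
    fun j => by split_ifs <;> simp).restrictScalars ℝ)

open Classical in
lemma tangentProj_apply (T : ℝ) (J : Set ℕ+) (y : Seq ℕ+) (j : ℕ+) :
    tangentProj T J y j = (if j ∈ J then y j else 0) -
      ((phase 1 T * (if 1 ∈ J then y 1 else 0)).re : ℂ) * (if j = 1 then phase 1 (-T) else 0) := by
  have h : tangentProj T J y j = (if j ∈ J then (1 : ℂ) else 0) * y j -
      ((phase 1 T * ((if 1 ∈ J then (1 : ℂ) else 0) * y 1)).re : ℂ) *
        (phase 1 (-T) * groundSeq j) := rfl
  rw [h, groundSeq_apply]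
  simp only [ite_mul, one_mul, zero_mul, mul_ite, mul_one, mul_zero]

lemma projTangent_projJ_ofWeighted (T : ℝ) (J : Set ℕ+) (s : ℕ) (y : Seq ℕ+) :
    projTangent (psi1 T) (projJ J (ofWeighted s y)) = ofWeighted s (tangentProj T J y) := by
  classical
  refine ext_coeff fun j => ?_
  rw [projTangent, sub_eq_add_neg, ← neg_smul, coeff_add, coeff_smul, inner_psi1, coeff_psi1,
    coeff_projJ, coeff_projJ, coeff_ofWeighted, coeff_ofWeighted, coeff_ofWeighted,
    tangentProj_apply]
  by_cases h : j = 1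
  · subst h; simp; ring
  · simp [h]

end Projections

/-! ### The differential of the end-point map at the ground state -/

section Differential

variable {T : ℝ} {μ : ℝ → ℝ} {hμ : MemLp μ 2 (volume.restrict (Ioo (0 : ℝ) 1))} {N k s : ℕ}

/-- The weighted coordinates, as a real isomorphism. -/
def weightedReal (s : ℕ) : HSp s ≃L[ℝ] Seq ℕ+ :=
  { (weightedEquiv s).toLinearEquiv.restrictScalars ℝ with
    continuous_toFun := (weightedEquiv s).continuous
    continuous_invFun := (weightedEquiv s).symm.continuous }

lemma weightedReal_apply (s : ℕ) (ψ : HSp s) : weightedReal s ψ = weightedEquiv s ψ := rfl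

lemma norm_weightedReal (s : ℕ) (ψ : HSp s) : ‖weightedReal s ψ‖ = ‖ψ‖ :=
  (weightedEquiv s).norm_map ψ

lemma toL2_weightedReal_symm (s : ℕ) (x : Seq ℕ+) :
    ((weightedReal s).symm x).toL2 = ofWeighted s x := rfl

lemma ofWeighted_weightedReal (s : ℕ) (ψ : HSp s) :
    ofWeighted s (weightedReal s ψ) = ψ.toL2 := by
  rw [← toL2_weightedReal_symm, ContinuousLinearEquiv.symm_apply_apply]

/-- The linearized final state at `(φ_1, 0)`. -/
def linearizedState (s : ℕ) (T : ℝ) (J : Set ℕ+) (F : H0 k T →L[ℝ] Seq ℕ+) :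
    (HSp s × H0 k T) →L[ℝ] HSp s :=
  ((weightedReal s).symm : Seq ℕ+ →L[ℝ] HSp s) ∘L tangentProj T J ∘L
    (((Seq.rot T).restrictScalars ℝ ∘L (weightedReal s : HSp s →L[ℝ] Seq ℕ+)).coprod F)

lemma linearizedState_apply (J : Set ℕ+) (F : H0 k T →L[ℝ] Seq ℕ+)
    (x : HSp s × H0 k T) : linearizedState s T J F x =
      (weightedReal s).symm (tangentProj T J (Seq.rot T (weightedReal s x.1) + F x.2)) := rfl

lemma endPointMap_eq {J : Set ℕ+} {x : HSp s × H0 k T} {y : Seq ℕ+}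
    (h : finalState T μ (controlFun x.2) x.1.toL2 = ofWeighted s y) :
    endPointMap T μ J s k x = (x.1, (weightedReal s).symm (tangentProj T J y)) := by
  have h1 : projTangent (psi1 T) (projJ J (finalState T μ (controlFun x.2) x.1.toL2)) =
      ofWeighted s (tangentProj T J y) := by rw [h, projTangent_projJ_ofWeighted]
  have h2 : projTangent (psi1 T) (projJ J (finalState T μ (controlFun x.2) x.1.toL2)) ∈ HSub s :=
    h1 ▸ ofWeighted_mem s _
  rw [endPointMap, dif_pos h2]
  refine Prod.ext rfl ?_
  exact Subtype.ext h1

/-- The final state is affine in the data except for a bilinear term in u and Ψ. Replacing Ψ by the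
free evolution of φ_1 costs u times a quantity of first order, so the error is quadratic. -/
lemma hasFDerivAt_endPointMap_aux (hT : 0 ≤ T) (hm0 : IsTame (wmul hμ 0))
    (hm : IsTame (wmul hμ N)) (hs : s = N + 2 * k) (J : Set ℕ+) (F : H0 k T →L[ℝ] Seq ℕ+)
    (hF : ∀ u : H0 k T, F u = finalDuhamel hT hm k u (freeTuple k groundSeq)) :
    HasFDerivAt (endPointMap T μ J s k)
      ((ContinuousLinearMap.fst ℝ (HSp s) (H0 k T)).prod (linearizedState s T J F))
      (phiH s 1, 0) := by
  obtain ⟨δ, hδ, h⟩ := exists_solution (s := s) hT hm0 hm hs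
  have hval : ∀ x : HSp s × H0 k T, ‖x.2‖ ≤ δ → ∃ Ψ : CurveTuple k,
      Ψ = freeTuple k (weightedReal s x.1) + leibniz hT hm (x.2 : ControlTuple k T) Ψ ∧
      ‖Ψ‖ ≤ 2 * ‖freeTuple k (weightedReal s x.1)‖ ∧
      endPointMap T μ J s k x = (x.1, (weightedReal s).symm (tangentProj T J
        (Seq.rot T (weightedReal s x.1) + finalDuhamel hT hm k (x.2 : ControlTuple k T) Ψ))) := by
    intro x hx
    obtain ⟨Ψ, h1, h2, h3⟩ := h x.2 hx (weightedReal s x.1)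
    rw [ofWeighted_weightedReal] at h3
    exact ⟨Ψ, h1, h2, endPointMap_eq h3⟩
  have hbase : weightedReal s (phiH s 1) = groundSeq := weightedEquiv_phiH s
  obtain ⟨B, hB⟩ : ∃ B, B = finalDuhamel hT hm k := ⟨_, rfl⟩
  obtain ⟨A, hA⟩ : ∃ A : ControlTuple k T →L[ℝ] CurveTuple k →L[ℝ] CurveTuple k,
    A = leibniz hT hm := ⟨_, rfl⟩
  obtain ⟨S, hS⟩ : ∃ S, S = freeTuple k := ⟨_, rfl⟩
  obtain ⟨Q, hQ⟩ : ∃ Q : Seq ℕ+ →L[ℝ] HSp s,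
    Q = ((weightedReal s).symm : Seq ℕ+ →L[ℝ] HSp s) ∘L tangentProj T J := ⟨_, rfl⟩
  rw [← hB, ← hA, ← hS] at hval
  rw [← hB, ← hS] at hF
  have hQa : ∀ y, Q y = (weightedReal s).symm (tangentProj T J y) := fun y => by rw [hQ]; rfl
  set K : ℝ := ‖Q‖ * (‖B‖ * (‖S‖ + ‖A‖ * (2 * (‖S‖ * (‖phiH s 1‖ + 1))))) with hK
  have hrem : ∀ x : HSp s × H0 k T, ‖x‖ ≤ min δ 1 →
      ‖endPointMap T μ J s k ((phiH s 1, 0) + x) - endPointMap T μ J s k (phiH s 1, 0) -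
        ((ContinuousLinearMap.fst ℝ (HSp s) (H0 k T)).prod (linearizedState s T J F)) x‖ ≤
        K * ‖x‖ ^ 2 := by
    rintro ⟨g, u⟩ hx
    have hg : ‖g‖ ≤ ‖(g, u)‖ := le_max_left _ _
    have hu : ‖u‖ ≤ ‖(g, u)‖ := le_max_right _ _
    have hx1 := hx.trans (min_le_left _ _)
    have hx2 := hx.trans (min_le_right _ _)
    obtain ⟨Ψ, h1, h2, h3⟩ := hval ((phiH s 1, 0) + (g, u)) (by simpa using hu.trans hx1)
    -- At the base point the control is zero, so which Ψ₀ is obtained is irrelevant.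
    obtain ⟨Ψ₀, -, -, h3'⟩ := hval (phiH s 1, 0) (by simpa using hδ.le)
    have e : endPointMap T μ J s k ((phiH s 1, 0) + (g, u)) - endPointMap T μ J s k (phiH s 1, 0) -
        ((ContinuousLinearMap.fst ℝ (HSp s) (H0 k T)).prod (linearizedState s T J F)) (g, u) =
        ((0 : HSp s), Q (B u (Ψ - S groundSeq))) := by
      rw [h3, h3', ← hQa, ← hQa]
      refine Prod.ext ?_ ?_
      · change phiH s 1 + g - phiH s 1 - g = 0
        abel
      · change Q (Seq.rot T (weightedReal s (phiH s 1 + g)) + B ((0 + u : H0 k T)) Ψ) -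
          Q (Seq.rot T (weightedReal s (phiH s 1)) + B ((0 : H0 k T) : ControlTuple k T) Ψ₀) -
          linearizedState s T J F (g, u) = _
        rw [linearizedState_apply, ← hQa, hF, ← map_sub, ← map_sub, zero_add, map_sub (B u)]
        have h0 : B ((0 : H0 k T) : ControlTuple k T) Ψ₀ = 0 := by
          rw [Submodule.coe_zero, map_zero]; rfl
        rw [h0, map_add, map_add]
        congr 1
        abel
    -- The deviation from the free ground state is the free evolution of the increment g plus the
    -- Duhamel term; both are of first order.
    have hv : Ψ - S groundSeq = S (weightedReal s g) + A u Ψ := by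
      have h1' : Ψ = S (weightedReal s (phiH s 1 + g)) + A ((0 + u : H0 k T)) Ψ := h1
      rw [zero_add, map_add, map_add, hbase] at h1'
      conv_lhs => rw [h1']
      abel
    have hun : ‖(u : ControlTuple k T)‖ = ‖u‖ := Submodule.norm_coe u
    have hΨ : ‖Ψ‖ ≤ 2 * (‖S‖ * (‖phiH s 1‖ + 1)) := by
      refine h2.trans (mul_le_mul_of_nonneg_left ((S.le_opNorm _).trans ?_) (by norm_num))
      refine mul_le_mul_of_nonneg_left ?_ (norm_nonneg _)
      rw [norm_weightedReal]
      exact (norm_add_le _ _).trans (add_le_add le_rfl (hg.trans hx2))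
    have hvn : ‖Ψ - S groundSeq‖ ≤
        (‖S‖ + ‖A‖ * (2 * (‖S‖ * (‖phiH s 1‖ + 1)))) * ‖(g, u)‖ := by
      rw [hv, add_mul]
      refine (norm_add_le _ _).trans (add_le_add ?_ ?_)
      · refine (S.le_opNorm _).trans (mul_le_mul_of_nonneg_left ?_ (norm_nonneg _))
        rwa [norm_weightedReal]
      · refine (A.le_opNorm₂ _ _).trans ?_
        rw [hun, mul_assoc, mul_assoc, mul_comm ‖u‖]
        exact mul_le_mul_of_nonneg_left (mul_le_mul hΨ hu (norm_nonneg _) (by positivity))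
          A.opNorm_nonneg
    rw [e]
    have e2 : ‖((0 : HSp s), Q (B u (Ψ - S groundSeq)))‖ = ‖Q (B u (Ψ - S groundSeq))‖ := by
      rw [Prod.norm_mk, norm_zero, max_eq_right (norm_nonneg _)]
    rw [e2, hK, mul_assoc]
    refine (Q.le_opNorm _).trans (mul_le_mul_of_nonneg_left ?_ (norm_nonneg _))
    refine (B.le_opNorm₂ _ _).trans ?_
    rw [hun, mul_assoc, mul_assoc]
    refine mul_le_mul_of_nonneg_left ?_ B.opNorm_nonneg
    calc ‖u‖ * ‖Ψ - S groundSeq‖ ≤ ‖(g, u)‖ *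
          ((‖S‖ + ‖A‖ * (2 * (‖S‖ * (‖phiH s 1‖ + 1)))) * ‖(g, u)‖) :=
          mul_le_mul hu hvn (norm_nonneg _) (norm_nonneg _)
      _ = _ := by ring
  rw [hasFDerivAt_iff_isLittleO_nhds_zero]
  refine Asymptotics.IsBigO.trans_isLittleO (g := fun x : HSp s × H0 k T => ‖x‖ ^ 2) ?_ ?_
  · refine Asymptotics.IsBigO.of_bound K ?_
    have hδ1 : 0 < min δ 1 := lt_min hδ one_pos
    filter_upwards [Metric.closedBall_mem_nhds (0 : HSp s × H0 k T) hδ1] with x hx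
    rw [mem_closedBall_zero_iff] at hx
    rw [norm_pow, norm_norm]
    exact hrem x hx
  · exact Asymptotics.isLittleO_norm_pow_id one_lt_two

/-- The end-point map is differentiable at `(φ_1, 0)`; its differential is explicit. -/
lemma hasFDerivAt_endPointMap (hT : 0 ≤ T) (hm0 : IsTame (wmul hμ 0))
    (hm : IsTame (wmul hμ N)) (hs : s = N + 2 * k) (J : Set ℕ+) :
    ∃ F : H0 k T →L[ℝ] Seq ℕ+,
      (∀ u j, F u j = (j : ℂ) ^ s * (phase j (-T) * (Complex.I *
        ((∫ x in Ioo (0 : ℝ) 1, μ x * phi 1 x * phi j x : ℝ) *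
          ∫ τ in Ioo 0 T, phase j τ * phase 1 (-τ) * controlFun u τ)))) ∧
      HasFDerivAt (endPointMap T μ J s k)
        ((ContinuousLinearMap.fst ℝ (HSp s) (H0 k T)).prod (linearizedState s T J F))
        (phiH s 1, 0) := by
  refine ⟨((finalDuhamel hT hm k).flip (freeTuple k groundSeq)) ∘L (H0 k T).subtypeL, ?_,
    hasFDerivAt_endPointMap_aux hT hm0 hm hs J _ fun u => rfl⟩
  intro u j
  have h1 : ((finalDuhamel hT hm k).flip (freeTuple k groundSeq) ∘L (H0 k T).subtypeL) u j =
    finalDuhamel hT hm k u (freeTuple k groundSeq) j := rfl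
  -- Along the ground state the source on mode j is ⟨μφ_1, φ_j⟩e^{-iλ_1τ}, which produces the moment
  -- at frequency λ_j - λ_1.
  have h2 : ∀ τ, wmul hμ N j (freeTuple k groundSeq (ix k 0) τ) =
      (j : ℂ) ^ N * ((∫ x in Ioo (0 : ℝ) 1, μ x * phi 1 x * phi j x : ℝ) * phase 1 (-τ)) := by
    intro τ
    have h3 : ofWeighted N (freeTuple k groundSeq (ix k 0) τ) = phase 1 (-τ) • phiL2 1 := by
      refine ext_coeff fun l => ?_
      rw [coeff_ofWeighted, freeTuple_apply, coeff_smul, coeff_phiL2, groundSeq_apply,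
        ix_val (Nat.zero_le k)]
      split_ifs with hl
      · simp [hl]
      · simp
    rw [wmul_apply, h3, inner_smul_right, inner_mulPhi_phiL2, ← integral_mul_phi_mul_phi hμ,
      mul_comm (phase 1 (-τ))]
    simp only [mul_right_comm _ (phi j _)]
  rw [h1, finalDuhamel_apply_of_mem hT hm u (freeTuple_mem_derivTuples _), duhamel_apply,
    setIntegral_Iic_timeMeasure ⟨hT, le_rfl⟩, intervalIntegral.integral_of_le hT,
    integral_Ioc_eq_integral_Ioo, hs, pow_add]
  have h4 : ∀ τ, phase j τ * (controlDeriv u 0 τ * wmul hμ N j (freeTuple k groundSeq (ix k 0) τ)) =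
      (j : ℂ) ^ N * (∫ x in Ioo (0 : ℝ) 1, μ x * phi 1 x * phi j x : ℝ) *
        (phase j τ * phase 1 (-τ) * controlFun u τ) := by
    intro τ
    rw [h2, controlFun]; ring
  simp only [h4]
  rw [integral_const_mul]
  ring

end Differential

/-! ### Fourier transforms of test functions -/

/-- The Fourier transform of `θ` over `(0, T)`. -/
def fourierTest (T : ℝ) (θ : ℝ → ℝ) (ν : ℝ) : ℂ :=
  ∫ t in Ioo 0 T, (θ t : ℂ) * Complex.exp (Complex.I * ν * t)

section FourierTest

variable {T : ℝ} {θ : ℝ → ℝ}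

lemma continuous_mul_exp (hθ : Continuous θ) (ν : ℝ) :
    Continuous fun t : ℝ => (θ t : ℂ) * Complex.exp (Complex.I * ν * t) :=
  (Complex.continuous_ofReal.comp hθ).mul (by fun_prop)

lemma integrableOn_Ioo_of_continuous {F : ℝ → ℂ} (hF : Continuous F) :
    IntegrableOn F (Ioo 0 T) :=
  (hF.integrableOn_Icc (a := 0) (b := T)).mono_set Ioo_subset_Icc_self

lemma hasDerivAt_exp_I_mul (ν t : ℝ) :
    HasDerivAt (fun t : ℝ => Complex.exp (Complex.I * ν * t))
      (Complex.I * ν * Complex.exp (Complex.I * ν * t)) t := by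
  have h : HasDerivAt (fun t : ℝ => Complex.I * ν * (t : ℂ)) (Complex.I * ν) t := by
    simpa using (Complex.ofRealCLM.hasDerivAt (x := t)).const_mul (Complex.I * ν)
  exact h.cexp.congr_deriv (mul_comm _ _)

lemma fourierTest_deriv (hT : 0 ≤ T) (hθ : IsTestFunction 0 T θ) (ν : ℝ) :
    fourierTest T (deriv θ) ν = -(Complex.I * ν) * fourierTest T θ ν := by
  have hd : ∀ t, HasDerivAt (fun t : ℝ => (θ t : ℂ) * Complex.exp (Complex.I * ν * t))
      (((deriv θ t : ℝ) : ℂ) * Complex.exp (Complex.I * ν * t) +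
        (Complex.I * ν) * ((θ t : ℂ) * Complex.exp (Complex.I * ν * t))) t := by
    intro t
    refine (((hθ.1.differentiable (by simp)) t).hasDerivAt.ofReal_comp.mul
      (hasDerivAt_exp_I_mul ν t)).congr_deriv ?_
    ring
  have hc1 := continuous_mul_exp hθ.deriv.continuous ν
  have hc2 := continuous_mul_exp hθ.continuous ν
  have hc3 : Continuous fun t : ℝ =>
    (Complex.I * ν) * ((θ t : ℂ) * Complex.exp (Complex.I * ν * t)) := continuous_const.mul hc2
  have h := intervalIntegral.integral_eq_sub_of_hasDerivAt (a := 0) (b := T)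
    (fun t _ => hd t) ((hc1.add hc3).intervalIntegrable _ _)
  rw [intervalIntegral.integral_add (hc1.intervalIntegrable _ _) (hc3.intervalIntegrable _ _),
    intervalIntegral.integral_const_mul, hθ.apply_left, hθ.apply_right,
    intervalIntegral.integral_of_le hT, intervalIntegral.integral_of_le hT,
    integral_Ioc_eq_integral_Ioo, integral_Ioc_eq_integral_Ioo] at h
  rw [fourierTest, fourierTest]
  simp only [Complex.ofReal_zero, zero_mul, sub_self] at h
  linear_combination h

lemma fourierTest_iteratedDeriv (hT : 0 ≤ T) (hθ : IsTestFunction 0 T θ) (ν : ℝ) (r : ℕ) :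
    fourierTest T (iteratedDeriv r θ) ν = (-(Complex.I * ν)) ^ r * fourierTest T θ ν := by
  induction r with
  | zero => simp
  | succ r ih => rw [iteratedDeriv_succ, fourierTest_deriv hT (hθ.iteratedDeriv r), ih]; ring

lemma exists_fourierTest_bound (hT : 0 ≤ T) (hθ : IsTestFunction 0 T θ) (r : ℕ) :
    ∃ C : ℝ, 0 ≤ C ∧ ∀ ν : ℝ, |ν| ^ r * ‖fourierTest T θ ν‖ ≤ C := by
  refine ⟨∫ t in Ioo 0 T, ‖((iteratedDeriv r θ t : ℝ) : ℂ)‖, integral_nonneg fun _ => norm_nonneg _,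
    fun ν => ?_⟩
  have h : |ν| ^ r * ‖fourierTest T θ ν‖ = ‖fourierTest T (iteratedDeriv r θ) ν‖ := by
    rw [fourierTest_iteratedDeriv hT hθ, norm_mul, norm_pow, norm_neg, norm_mul, Complex.norm_I,
      one_mul, Complex.norm_real, Real.norm_eq_abs]
  rw [h]
  refine (norm_integral_le_integral_norm _).trans (le_of_eq ?_)
  refine integral_congr_ae (Eventually.of_forall fun t => ?_)
  simp only
  rw [norm_mul, norm_exp_I_mul, mul_one]

lemma conj_fourierTest (ν : ℝ) :
    (starRingEnd ℂ) (fourierTest T θ ν) = fourierTest T θ (-ν) := by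
  rw [fourierTest, ← integral_conj, fourierTest]
  refine integral_congr_ae (Eventually.of_forall fun t => ?_)
  simp only
  rw [map_mul, Complex.conj_ofReal, ← Complex.exp_conj]
  congr 2
  simp

lemma fourierTest_zero (hθ : IsTestFunction 0 T θ) (h1 : ∫ t, θ t = 1) :
    fourierTest T θ 0 = 1 := by
  have h := hθ.integral_Ioo
  rw [h1] at h
  rw [fourierTest]
  simp only [Complex.ofReal_zero, mul_zero, zero_mul, Complex.exp_zero, mul_one]
  rw [integral_complex_ofReal, h, Complex.ofReal_one]

end FourierTest

/-- Absolute summability of the coefficients permits integration term by term against any integrable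
F. -/
lemma hasSum_mul_integral_exp {ι : Type*} [Countable ι] {m : Measure ℝ} {c : ι → ℂ}
    (hc : Summable fun n => ‖c n‖)
    (a : ι → ℝ) {F : ℝ → ℂ} (hF : Integrable F m) :
    HasSum (fun n => c n * ∫ t, Complex.exp (Complex.I * a n * t) * F t ∂m)
      (∫ t, (∑' n, c n * Complex.exp (Complex.I * a n * t)) * F t ∂m) := by
  have hn : ∀ n (t : ℝ), ‖c n * (Complex.exp (Complex.I * a n * t) * F t)‖ = ‖c n‖ * ‖F t‖ := fun n t => by
    rw [norm_mul, norm_mul, norm_exp_I_mul, one_mul]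
  have hi : ∀ n, Integrable (fun t : ℝ => c n * (Complex.exp (Complex.I * a n * t) * F t)) m := by
    intro n
    refine (Integrable.bdd_mul (c := 1) hF (Continuous.aestronglyMeasurable (by fun_prop))
      (Eventually.of_forall fun t => (norm_exp_I_mul _ _).le)).const_mul _
  have h := hasSum_integral_of_summable_integral_norm hi (by
    simp only [hn, integral_const_mul]
    exact hc.mul_right _)
  have e : ∀ t : ℝ, ∑' n, c n * (Complex.exp (Complex.I * a n * t) * F t) =
      (∑' n, c n * Complex.exp (Complex.I * a n * t)) * F t := fun t => by
    rw [← tsum_mul_right]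
    exact tsum_congr fun n => (mul_assoc _ _ _).symm
  simp only [e] at h
  exact hasSum_of_eq h fun n => integral_const_mul _ _

/-! ### The frequencies -/

/-- The index of the frequencies `± (λ_{j+1} - λ_1)`. -/
abbrev Mode : Type := ℕ+ × Bool

/-- The integers `± (j² + 2j)`. -/
def Mode.freq (n : Mode) : ℤ := (if n.2 then 1 else -1) * (((n.1 : ℕ) : ℤ) ^ 2 + 2 * (n.1 : ℕ))

/-- The frequencies `± (λ_{j+1} - λ_1)`. -/
def Mode.nu (n : Mode) : ℝ := Real.pi ^ 2 * n.freq

/-- The size of a mode. -/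
def Mode.size (n : Mode) : ℝ := (n.1 : ℕ)

namespace Mode

lemma one_le_size (n : Mode) : 1 ≤ n.size := by
  rw [size]; exact_mod_cast n.1.pos

/-- For equal signs the difference factors as (x-y)(x+y+2) with x ≠ y; for opposite signs it is a
sum of positive terms. The gap thus grows with both indices, which makes every T > 0 admissible. -/
lemma gap {l n : Mode} (h : l ≠ n) :
    (((l.1 : ℕ) : ℤ) + (n.1 : ℕ)) ≤ |l.freq - n.freq| := by
  obtain ⟨j, b⟩ := l
  obtain ⟨i, c⟩ := n
  have hj : 1 ≤ ((j : ℕ) : ℤ) := by exact_mod_cast j.pos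
  have hi : 1 ≤ ((i : ℕ) : ℤ) := by exact_mod_cast i.pos
  have hne : b = c → ((j : ℕ) : ℤ) ≠ (i : ℕ) := by
    rintro rfl h2
    exact h (by rw [Prod.mk.injEq]; exact ⟨PNat.coe_injective (by exact_mod_cast h2), rfl⟩)
  simp only [freq]
  generalize ((j : ℕ) : ℤ) = x at *
  generalize ((i : ℕ) : ℤ) = y at *
  rw [le_abs]
  cases b <;> cases c <;> simp only [if_true, Bool.false_eq_true, if_false] at *
  · rcases lt_or_gt_of_ne (hne trivial) with h3 | h3
    · left; nlinarith
    · right; nlinarith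
  · right; nlinarith
  · left; nlinarith
  · rcases lt_or_gt_of_ne (hne trivial) with h3 | h3
    · right; nlinarith
    · left; nlinarith

lemma freq_injective : Function.Injective freq := by
  intro l n h
  by_contra h1
  have h2 := gap h1
  rw [h, sub_self, abs_zero] at h2
  have := l.1.pos
  have := n.1.pos
  omega

lemma nu_injective : Function.Injective nu := by
  intro l n h
  have hπ : (Real.pi ^ 2 : ℝ) ≠ 0 := by positivity
  exact freq_injective (by exact_mod_cast mul_left_cancel₀ hπ h)

lemma one_le_pi_sq : (1 : ℝ) ≤ Real.pi ^ 2 := by nlinarith [Real.pi_gt_three]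

lemma gap_nu {l n : Mode} (h : l ≠ n) : l.size + n.size ≤ |l.nu - n.nu| := by
  have h1 : ((((l.1 : ℕ) : ℤ) + (n.1 : ℕ) : ℤ) : ℝ) ≤ ((|l.freq - n.freq| : ℤ) : ℝ) :=
    by exact_mod_cast gap h
  push_cast at h1
  rw [nu, nu, ← mul_sub, abs_mul, abs_of_nonneg (by positivity)]
  refine (h1 : l.size + n.size ≤ _).trans (le_mul_of_one_le_left (abs_nonneg _) one_le_pi_sq)

lemma abs_nu (n : Mode) : |n.nu| = Real.pi ^ 2 * (n.size ^ 2 + 2 * n.size) := by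
  have h : |(n.freq : ℝ)| = n.size ^ 2 + 2 * n.size := by
    rw [freq, size]
    push_cast
    rw [abs_mul, abs_of_nonneg (a := ((n.1 : ℕ) : ℝ) ^ 2 + _) (by positivity)]
    split_ifs <;> simp
  rw [nu, abs_mul, h, abs_of_nonneg (by positivity)]

/-- Mode j of the frequencies belongs to the eigenvalue of index j+1, so (j+1)² is the weight with
which ν must be compared. -/
lemma size_le_abs_nu (n : Mode) : (n.size + 1) ^ 2 ≤ |n.nu| := by
  rw [abs_nu]
  have := n.one_le_size
  have h1 : 0 ≤ (Real.pi ^ 2 - 9) * (n.size ^ 2 + 2 * n.size) :=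
    mul_nonneg (by nlinarith [Real.pi_gt_three]) (by positivity)
  nlinarith

lemma abs_nu_le (n : Mode) : |n.nu| ≤ 3 * Real.pi ^ 2 * n.size ^ 2 := by
  rw [abs_nu]
  have := n.one_le_size
  have h1 : 0 ≤ Real.pi ^ 2 * (2 * (n.size * (n.size - 1))) :=
    mul_nonneg (by positivity) (mul_nonneg (by norm_num) (mul_nonneg (by linarith) (by linarith)))
  linarith

lemma one_le_abs_nu (n : Mode) : 1 ≤ |n.nu| := by
  have := n.one_le_size
  have := n.size_le_abs_nu
  nlinarith

lemma nu_ne_zero (n : Mode) : (n.nu : ℂ) ≠ 0 := by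
  have := n.one_le_abs_nu
  rw [Complex.ofReal_ne_zero]
  intro h
  rw [h, abs_zero] at this
  linarith

/-- The opposite mode. -/
def opp (n : Mode) : Mode := (n.1, !n.2)

lemma nu_opp (n : Mode) : n.opp.nu = -n.nu := by
  rw [nu, nu, opp, freq, freq]
  cases n.2 <;> simp <;> ring

lemma summable_inv_size_sq : Summable fun n : Mode => (n.size ^ 2)⁻¹ := by
  have h1 : Summable fun j : ℕ+ => (((j : ℕ) : ℝ) ^ 2)⁻¹ :=
    (Real.summable_nat_pow_inv.2 one_lt_two).comp_injective PNat.coe_injective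
  have h2 := h1.mul_of_nonneg (g := fun _ : Bool => (1 : ℝ)) (Summable.of_finite)
    (fun _ => by positivity) (fun _ => by simp)
  simpa [size] using h2

/-- The sequence of inverse sizes. -/
def invSize : Seq Mode := Seq.mk (fun n => ((n.size⁻¹ : ℝ) : ℂ)) (by
  refine memℓp_gen ?_
  simpa using summable_inv_size_sq)

lemma norm_invSize_apply (n : Mode) : ‖invSize n‖ = n.size⁻¹ := by
  rw [invSize, Seq.mk_apply, Complex.norm_real, Real.norm_of_nonneg]
  have := n.one_le_size
  positivity

end Mode

/-! ### Operators with summable rows -/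

namespace Seq

variable {ι : Type*}

lemma norm_pair_le (c : Seq ι) : ‖pair c‖ ≤ ‖c‖ :=
  LinearMap.mkContinuous_norm_le _ (norm_nonneg _) _

variable [DecidableEq ι]

/-- The operator with given rows. -/
def rowOp (row : ι → Seq ι) : Seq ι →L[ℂ] Seq ι :=
  ∑' l, (pair (row l)).smulRight (lp.single 2 l 1)

variable {row : ι → Seq ι}

lemma summable_rowOp (h : Summable fun l => ‖row l‖) :
    Summable fun l => (pair (row l)).smulRight (lp.single 2 l (1 : ℂ) : Seq ι) := by
  refine Summable.of_norm_bounded h fun l => ?_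
  rw [ContinuousLinearMap.norm_smulRight_apply, lp.norm_single (by norm_num), norm_one, mul_one]
  exact norm_pair_le _

lemma rowOp_apply (h : Summable fun l => ‖row l‖) (b : Seq ι) (l : ι) :
    rowOp row b l = pair (row l) b := by
  have h1 := ((summable_rowOp h).hasSum.mapL (ContinuousLinearMap.apply ℂ (Seq ι) b)).mapL (eval l)
  refine h1.unique ?_
  have h2 : ∀ n, eval l (ContinuousLinearMap.apply ℂ (Seq ι) b
      ((pair (row n)).smulRight (lp.single 2 n (1 : ℂ) : Seq ι))) =
      if n = l then pair (row l) b else 0 := by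
    intro n
    change pair (row n) b * (lp.single 2 n (1 : ℂ) : Seq ι) l = _
    split_ifs with hn
    · rw [hn, lp.single_apply_self, mul_one]
    · rw [lp.single_apply_ne _ _ _ (Ne.symm hn), mul_zero]
  simp only [h2]
  exact hasSum_ite_eq _ _

/-- With summable row norms the operator is a norm limit of operators of finite rank. -/
lemma isCompactOperator_rowOp (h : Summable fun l => ‖row l‖) :
    IsCompactOperator (rowOp row) := by
  refine isCompactOperator_of_tendsto (summable_rowOp h).hasSum (Eventually.of_forall fun s => ?_)
  induction s using Finset.induction_on with
  | empty => simpa using! isCompactOperator_zero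
  | insert l s hl ih =>
    rw [Finset.sum_insert hl]
    refine IsCompactOperator.add ?_ ih
    have h1 : IsCompactOperator (pair (row l)) :=
      isCompactOperator_of_locallyCompactSpace_dom (pair (row l))
    exact h1.clm_comp ((ContinuousLinearMap.id ℂ ℂ).smulRight (lp.single 2 l (1 : ℂ) : Seq ι))

end Seq

/-! ### The Gram operator -/

section Gram

variable {T : ℝ} {χ : ℝ → ℝ}

open Mode

/-- The decay of χ̂ at order 2r+3, evaluated across the gap, pays size^{2r} for the weight ν_l^r and
leaves size_l^{-2}size_n^{-1}. This is square summable along each row, with summable row norms. -/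
lemma exists_row_bound (hT : 0 ≤ T) (hχ : IsTestFunction 0 T χ) (r : ℕ) :
    ∃ C : ℝ, 0 ≤ C ∧ ∀ l n : Mode, l ≠ n →
      ‖(l.nu : ℂ) ^ r * fourierTest T χ (l.nu - n.nu)‖ ≤ C * (l.size ^ 2)⁻¹ * n.size⁻¹ := by
  obtain ⟨C, hC, h⟩ := exists_fourierTest_bound hT hχ (2 * r + 3)
  refine ⟨(3 * Real.pi ^ 2) ^ r * C, by positivity, fun l n hln => ?_⟩
  have hl := l.one_le_size
  have hn := n.one_le_size
  have h1 : l.size ^ (2 * r + 2) * n.size ≤ |l.nu - n.nu| ^ (2 * r + 3) := by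
    calc l.size ^ (2 * r + 2) * n.size
        ≤ (l.size + n.size) ^ (2 * r + 2) * (l.size + n.size) := by
          gcongr <;> linarith
      _ = (l.size + n.size) ^ (2 * r + 3) := by ring
      _ ≤ _ := pow_le_pow_left₀ (by linarith) (gap_nu hln) _
  have h2 : l.size ^ (2 * r + 2) * n.size * ‖fourierTest T χ (l.nu - n.nu)‖ ≤ C :=
    (mul_le_mul_of_nonneg_right h1 (norm_nonneg _)).trans (h _)
  rw [norm_mul, norm_pow, Complex.norm_real, Real.norm_eq_abs, mul_assoc, ← mul_inv,
    ← div_eq_mul_inv, le_div_iff₀ (by positivity)]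
  calc |l.nu| ^ r * ‖fourierTest T χ (l.nu - n.nu)‖ * (l.size ^ 2 * n.size)
      ≤ (3 * Real.pi ^ 2 * l.size ^ 2) ^ r * ‖fourierTest T χ (l.nu - n.nu)‖ *
          (l.size ^ 2 * n.size) := by
        gcongr
        exact l.abs_nu_le
    _ = (3 * Real.pi ^ 2) ^ r * (l.size ^ (2 * r + 2) * n.size *
          ‖fourierTest T χ (l.nu - n.nu)‖) := by
        rw [mul_pow, ← pow_mul, pow_add]; ring
    _ ≤ _ := mul_le_mul_of_nonneg_left h2 (by positivity)

open Classical in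
/-- The weighted off-diagonal entries of the Gram matrix. -/
def gramEntry (T : ℝ) (χ : ℝ → ℝ) (r : ℕ) (l n : Mode) : ℂ :=
  if l = n then 0 else (l.nu : ℂ) ^ r * fourierTest T χ (l.nu - n.nu)

lemma exists_gramEntry_bound (hT : 0 ≤ T) (hχ : IsTestFunction 0 T χ) (r : ℕ) :
    ∃ C : ℝ, 0 ≤ C ∧ ∀ l n : Mode,
      ‖gramEntry T χ r l n‖ ≤ C * (l.size ^ 2)⁻¹ * ‖invSize n‖ := by
  obtain ⟨C, hC, h⟩ := exists_row_bound hT hχ r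
  refine ⟨C, hC, fun l n => ?_⟩
  have hn := n.one_le_size
  rw [norm_invSize_apply, gramEntry]
  split_ifs with hln
  · rw [norm_zero]; positivity
  · exact h l n hln

lemma sum_gramEntry_le {r : ℕ} {C : ℝ} (h : ∀ l n : Mode,
      ‖gramEntry T χ r l n‖ ≤ C * (l.size ^ 2)⁻¹ * ‖invSize n‖) (l : Mode) (s : Finset Mode) :
    ∑ n ∈ s, ‖gramEntry T χ r l n‖ ^ 2 ≤ (C * (l.size ^ 2)⁻¹ * ‖invSize‖) ^ 2 := by
  refine (Finset.sum_le_sum fun n _ => pow_le_pow_left₀ (norm_nonneg _) (h l n) 2).trans ?_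
  simp only [mul_pow _ ‖_‖]
  rw [← Finset.mul_sum]
  exact mul_le_mul_of_nonneg_left (Seq.sum_norm_sq_le _ _) (by positivity)

/-- A row of the weighted off-diagonal Gram matrix. -/
def gramRow (hT : 0 ≤ T) (hχ : IsTestFunction 0 T χ) (r : ℕ) (l : Mode) : Seq Mode :=
  Seq.mk (gramEntry T χ r l)
    (Seq.memℓp_of_sum_le (sum_gramEntry_le (exists_gramEntry_bound hT hχ r).choose_spec.2 l))

lemma summable_gramRow (hT : 0 ≤ T) (hχ : IsTestFunction 0 T χ) (r : ℕ) :
    Summable fun l => ‖gramRow hT hχ r l‖ := by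
  obtain ⟨C, hC, h⟩ := exists_gramEntry_bound hT hχ r
  refine Summable.of_nonneg_of_le (fun _ => norm_nonneg _) (fun l => ?_)
    ((summable_inv_size_sq.mul_left C).mul_right ‖invSize‖)
  exact Seq.norm_le_of_sum_le (by positivity) (sum_gramEntry_le h l)

/-- The weighted off-diagonal Gram operator. -/
def gramOp (hT : 0 ≤ T) (hχ : IsTestFunction 0 T χ) (r : ℕ) : Seq Mode →L[ℂ] Seq Mode :=
  Seq.rowOp (gramRow hT hχ r)

lemma hasSum_gramOp (hT : 0 ≤ T) (hχ : IsTestFunction 0 T χ) (r : ℕ) (b : Seq Mode) (l : Mode) :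
    HasSum (fun n => gramEntry T χ r l n * b n) (gramOp hT hχ r b l) := by
  have h : HasSum (fun n => gramEntry T χ r l n * b n) (Seq.pair (gramRow hT hχ r l) b) :=
    Seq.hasSum_pair (gramRow hT hχ r l) b
  have h2 : gramOp hT hχ r b l = Seq.pair (gramRow hT hχ r l) b :=
    Seq.rowOp_apply (row := gramRow hT hχ r) (summable_gramRow hT hχ r) b l
  rw [h2]
  exact h

/-- The weight factors out of each row. Since every weighted operator is bounded, the unweighted one
gains arbitrarily many powers of ν. -/
lemma gramOp_apply (hT : 0 ≤ T) (hχ : IsTestFunction 0 T χ) (r : ℕ) (b : Seq Mode) (l : Mode) :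
    gramOp hT hχ r b l = (l.nu : ℂ) ^ r * gramOp hT hχ 0 b l := by
  refine (hasSum_gramOp hT hχ r b l).unique (hasSum_of_eq
    ((hasSum_gramOp hT hχ 0 b l).mul_left ((l.nu : ℂ) ^ r)) fun n => ?_)
  simp only [gramEntry]
  split_ifs <;> ring

lemma hasSum_gram (hT : 0 ≤ T) (hχ : IsTestFunction 0 T χ) (h1 : ∫ t, χ t = 1) (b : Seq Mode)
    (l : Mode) : HasSum (fun n : Mode => fourierTest T χ (l.nu - n.nu) * b n)
      (b l + gramOp hT hχ 0 b l) := by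
  classical
  refine hasSum_of_eq ((hasSum_ite_eq l (b l)).add (hasSum_gramOp hT hχ 0 b l)) fun n => ?_
  simp only [gramEntry]
  by_cases h : n = l
  · subst h
    simp [fourierTest_zero hχ h1]
  · simp [h, Ne.symm h]

/-- The Fourier series of a sequence in the kernel of the Gram operator vanishes on the support of
the weight. -/
lemma mul_tsum_exp_eq_zero (hχ : IsTestFunction 0 T χ) (h0 : ∀ t, 0 ≤ χ t) {v : Mode → ℂ}
    (hv : Summable fun n => ‖v n‖)
    (h : ∀ l : Mode, HasSum (fun n : Mode => fourierTest T χ (l.nu - n.nu) * v n) 0) (t : ℝ) :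
    (χ t : ℂ) * ∑' n, v n * Complex.exp (Complex.I * (-n.nu : ℝ) * t) = 0 := by
  set f : ℝ → ℂ := fun t => ∑' n, v n * Complex.exp (Complex.I * (-n.nu : ℝ) * t) with hf
  have hfc : Continuous f := by
    refine continuous_tsum (fun n => by fun_prop) hv fun n t => ?_
    rw [norm_mul, norm_exp_I_mul, mul_one]
  have hcf : ∀ t, (starRingEnd ℂ) (f t) =
      ∑' n, (starRingEnd ℂ) (v n) * Complex.exp (Complex.I * n.nu * t) := by
    intro t
    rw [hf, Complex.conj_tsum]
    refine tsum_congr fun n => ?_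
    rw [map_mul, ← Complex.exp_conj]
    congr 2
    simp
  have hF : Continuous fun t => (χ t : ℂ) * f t :=
    (Complex.continuous_ofReal.comp hχ.continuous).mul hfc
  have hl : ∀ l : Mode, ∫ t in Ioo 0 T, Complex.exp (Complex.I * l.nu * t) * ((χ t : ℂ) * f t) = 0 := by
    intro l
    have h2 := hasSum_mul_integral_exp (m := volume.restrict (Ioo 0 T)) hv (fun n => -n.nu)
      (integrableOn_Ioo_of_continuous (continuous_mul_exp hχ.continuous l.nu))
    have h3 := (hasSum_of_eq h2 fun n => ?_).unique (h l)
    · rw [← h3]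
      refine integral_congr_ae (Eventually.of_forall fun t => ?_)
      simp only [hf]; ring
    · rw [fourierTest, mul_comm]
      congr 1
      refine integral_congr_ae (Eventually.of_forall fun t => ?_)
      simp only
      rw [mul_left_comm, ← Complex.exp_add]
      congr 2
      push_cast; ring
  -- Integrating the conjugate series against χf gives ∫ χ|f|² as a combination of the vanishing
  -- moments of χf.
  have h4 := hasSum_mul_integral_exp (m := volume.restrict (Ioo 0 T))
    (c := fun n => (starRingEnd ℂ) (v n)) (by simpa using hv)
    nu (integrableOn_Ioo_of_continuous hF)
  simp only [hl, mul_zero, ← hcf] at h4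
  have h5 := h4.unique hasSum_zero
  have hg : Continuous fun t => χ t * ‖f t‖ ^ 2 := hχ.continuous.mul (hfc.norm.pow 2)
  have h6 : ∫ t, χ t * ‖f t‖ ^ 2 = 0 := by
    rw [← setIntegral_eq_integral_of_forall_compl_eq_zero (s := Ioo 0 T)
      fun t ht => by rw [hχ.eq_zero_of_notMem ht, zero_mul]]
    have h7 : ((∫ t in Ioo 0 T, χ t * ‖f t‖ ^ 2 : ℝ) : ℂ) = 0 := by
      rw [← integral_complex_ofReal, ← h5]
      refine integral_congr_ae (Eventually.of_forall fun t => ?_)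
      simp only
      rw [mul_left_comm, Complex.conj_mul']
      push_cast; ring
    exact_mod_cast h7
  have hint : Integrable fun t => χ t * ‖f t‖ ^ 2 :=
    hg.integrable_of_hasCompactSupport hχ.2.1.mul_right
  have h8 := (integral_eq_zero_iff_of_nonneg (fun t => mul_nonneg (h0 t) (by positivity)) hint).1 h6
  have h9 := (hg.ae_eq_iff_eq volume continuous_const).1 h8
  have h10 : χ t * ‖f t‖ ^ 2 = 0 := congrFun h9 t
  rcases mul_eq_zero.1 h10 with h11 | h11
  · rw [h11]; simp
  · have h12 : f t = 0 := by simpa using h11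
    change (χ t : ℂ) * f t = 0
    rw [h12, mul_zero]

/-- Since χ ≥ 0, each zero of χ is a minimum, so χ' vanishes there too; hence χf = 0 implies χ'f =
0. Taking moments brings the factor ν_l - ν_n, and subtraction from ν_l times the original relation
leaves ν_n v_n. -/
lemma hasSum_nu_mul (hT : 0 ≤ T) (hχ : IsTestFunction 0 T χ) (h0 : ∀ t, 0 ≤ χ t) {v : Mode → ℂ}
    (hv : Summable fun n => ‖v n‖)
    (h : ∀ l : Mode, HasSum (fun n : Mode => fourierTest T χ (l.nu - n.nu) * v n) 0) (l : Mode) :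
    HasSum (fun n : Mode => fourierTest T χ (l.nu - n.nu) * (n.nu * v n)) 0 := by
  have hz := mul_tsum_exp_eq_zero hχ h0 hv h
  have hd : ∀ t : ℝ, ((deriv χ t : ℝ) : ℂ) *
      ∑' n : Mode, v n * Complex.exp (Complex.I * (-n.nu : ℝ) * t) = 0 := by
    intro t
    rcases mul_eq_zero.1 (hz t) with h1 | h1
    · have h2 : IsLocalMin χ t := Eventually.of_forall fun y => by
        rw [Complex.ofReal_eq_zero.1 h1]; exact h0 y
      rw [h2.deriv_eq_zero]; simp
    · rw [h1, mul_zero]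
  have h2 := hasSum_mul_integral_exp (m := volume.restrict (Ioo 0 T)) hv (fun n : Mode => -n.nu)
    (integrableOn_Ioo_of_continuous (continuous_mul_exp hχ.deriv.continuous l.nu))
  have h3 : ∀ t : ℝ, (∑' n : Mode, v n * Complex.exp (Complex.I * (-n.nu : ℝ) * t)) *
      (((deriv χ t : ℝ) : ℂ) * Complex.exp (Complex.I * l.nu * t)) = 0 := by
    intro t
    rw [← mul_assoc, mul_comm (∑' n : Mode, _), hd, zero_mul]
  simp only [h3, integral_zero] at h2
  have h4 : ∀ n : Mode, v n * ∫ t in Ioo 0 T, Complex.exp (Complex.I * (-n.nu : ℝ) * t) *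
      (((deriv χ t : ℝ) : ℂ) * Complex.exp (Complex.I * l.nu * t)) =
      -(Complex.I * (l.nu - n.nu)) * (fourierTest T χ (l.nu - n.nu) * v n) := by
    intro n
    have h5 := fourierTest_deriv hT hχ (l.nu - n.nu)
    rw [fourierTest] at h5
    have h6 : ∀ t : ℝ, Complex.exp (Complex.I * (-n.nu : ℝ) * t) *
        (((deriv χ t : ℝ) : ℂ) * Complex.exp (Complex.I * l.nu * t)) =
        ((deriv χ t : ℝ) : ℂ) * Complex.exp (Complex.I * (l.nu - n.nu : ℝ) * t) := by
      intro t
      rw [mul_left_comm, ← Complex.exp_add]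
      congr 2
      push_cast; ring
    simp only [h6, h5]
    push_cast; ring
  have h7 := ((h l).mul_left (l.nu : ℂ)).sub (h2.mul_left Complex.I)
  rw [mul_zero, mul_zero, sub_zero] at h7
  refine hasSum_of_eq h7 fun n => ?_
  rw [h4]
  linear_combination ((l.nu : ℂ) - n.nu) * (fourierTest T χ (l.nu - n.nu) * v n) * Complex.I_sq

/-- The Gram operator is injective. -/
lemma eq_zero_of_gram_eq_zero (hT : 0 ≤ T) (hχ : IsTestFunction 0 T χ) (h0 : ∀ t, 0 ≤ χ t)
    (h1 : ∫ t, χ t = 1) {b : Seq Mode} (hb : gramOp hT hχ 0 b = -b) : b = 0 := by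
  classical
  let V : Submodule ℂ (Seq Mode) :=
    LinearMap.ker ((ContinuousLinearMap.id ℂ (Seq Mode) + gramOp hT hχ 0 :
      Seq Mode →L[ℂ] Seq Mode) : Seq Mode →ₗ[ℂ] Seq Mode)
  have hVc : IsClosed (V : Set (Seq Mode)) := ContinuousLinearMap.isClosed_ker _
  have hV : ∀ v, v ∈ V ↔ gramOp hT hχ 0 v = -v := fun v => by
    rw [eq_neg_iff_add_eq_zero, add_comm]; rfl
  have hVs : ∀ v ∈ V, ∀ l : Mode,
      HasSum (fun n : Mode => fourierTest T χ (l.nu - n.nu) * v n) 0 := by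
    intro v hv l
    have := hasSum_gram hT hχ h1 v l
    rwa [(hV v).1 hv, lp.coeFn_neg, Pi.neg_apply, add_neg_cancel] at this
  -- On the kernel v = -Kv, and K gains powers of ν; so the sequence ν_n v_n is again in ℓ², equal
  -- to -`gramOp` of weight one applied to v.
  have hnu : ∀ v ∈ V, ∀ n : Mode, gramOp hT hχ 1 v n = -(n.nu * v n) := by
    intro v hv n
    rw [gramOp_apply, (hV v).1 hv, lp.coeFn_neg, Pi.neg_apply, pow_one, mul_neg]
  have hinv : ∀ v ∈ V, -gramOp hT hχ 1 v ∈ V := by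
    intro v hv
    have hs : Summable fun n => ‖v n‖ := by
      refine Summable.of_nonneg_of_le (fun _ => norm_nonneg _) (fun n => ?_)
        (Seq.summable_norm_mul_norm (gramOp hT hχ 1 v) invSize).1
      rw [hnu v hv, norm_neg, norm_mul, norm_invSize_apply, Complex.norm_real, Real.norm_eq_abs]
      have h2 := n.size_le_abs_nu
      have h3 := n.one_le_size
      rw [← div_eq_mul_inv, le_div_iff₀ (by linarith), mul_comm]
      exact mul_le_mul_of_nonneg_right (by nlinarith) (norm_nonneg _)
    rw [hV]
    ext l
    have h2 := hasSum_nu_mul hT hχ h0 hs (hVs v hv) l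
    have h3 := hasSum_gram hT hχ h1 (-gramOp hT hχ 1 v) l
    have h4 := (hasSum_of_eq h3 fun n => by
      rw [lp.coeFn_neg, Pi.neg_apply, hnu v hv, neg_neg]).unique h2
    rw [lp.coeFn_neg, Pi.neg_apply, eq_neg_iff_add_eq_zero, add_comm]
    exact h4
  -- On the kernel the identity coincides with -K, hence is compact.
  have hfin : FiniteDimensional ℂ V := by
    refine FiniteDimensional.of_isCompactOperator_id ?_
    have hK : IsCompactOperator ((gramOp hT hχ 0 : Seq Mode →L[ℂ] Seq Mode) :
      Seq Mode →ₗ[ℂ] Seq Mode) := Seq.isCompactOperator_rowOp (summable_gramRow hT hχ 0)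
    have hmem : ∀ v ∈ V, ((gramOp hT hχ 0 : Seq Mode →L[ℂ] Seq Mode) :
        Seq Mode →ₗ[ℂ] Seq Mode) v ∈ V := fun v hv => by
      change gramOp hT hχ 0 v ∈ V
      rw [(hV v).1 hv]; exact V.neg_mem hv
    have h2 := (hK.restrict hmem hVc).neg
    have e : (id : V → V) = -⇑(((gramOp hT hχ 0 : Seq Mode →L[ℂ] Seq Mode) :
        Seq Mode →ₗ[ℂ] Seq Mode).restrict hmem) := by
      funext v
      apply Subtype.ext
      change (v : Seq Mode) = -gramOp hT hχ 0 v
      rw [(hV v).1 v.2, neg_neg]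
    rwa [e]
  by_contra hb0
  have hbV : b ∈ V := (hV b).2 hb
  have : Nontrivial V := ⟨⟨b, hbV⟩, 0, fun h => hb0 (congrArg Subtype.val h)⟩
  -- Multiplication by ν_n acts on a nonzero finite-dimensional complex space, so it has an
  -- eigenvector; the ν_n being distinct, that vector has one nonzero entry.
  obtain ⟨c, hc⟩ := Module.End.exists_eigenvalue
    (((-gramOp hT hχ 1 : Seq Mode →L[ℂ] Seq Mode) : Seq Mode →ₗ[ℂ] Seq Mode).restrict hinv)
  obtain ⟨v, hv⟩ := hc.exists_hasEigenvector
  have hv1 : ∀ n : Mode, (n.nu : ℂ) * (v : Seq Mode) n = c * (v : Seq Mode) n := by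
    intro n
    have h2 : -gramOp hT hχ 1 (v : Seq Mode) = c • (v : Seq Mode) :=
      congrArg Subtype.val hv.apply_eq_smul
    have h3 : (-gramOp hT hχ 1 (v : Seq Mode)) n = (c • (v : Seq Mode)) n := by rw [h2]
    rw [lp.coeFn_neg, Pi.neg_apply, hnu _ v.2, neg_neg] at h3
    exact h3
  obtain ⟨m, hm⟩ : ∃ m, (v : Seq Mode) m ≠ 0 := by
    by_contra! h2
    exact hv.2 (Subtype.ext (by ext n; exact h2 n))
  have hcm : (m.nu : ℂ) = c := mul_right_cancel₀ hm (hv1 m)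
  have h2 : ∀ n, n ≠ m → fourierTest T χ (m.nu - n.nu) * (v : Seq Mode) n = 0 := by
    intro n hn
    have h3 : ((n.nu : ℂ) - m.nu) * (v : Seq Mode) n = 0 := by rw [sub_mul, hv1 n, hcm, sub_self]
    rcases mul_eq_zero.1 h3 with h4 | h4
    · rw [sub_eq_zero] at h4
      exact absurd (nu_injective (by exact_mod_cast h4)) hn
    · rw [h4, mul_zero]
  -- The kernel relation at this mode reads χ̂(0)v_m = 0, while χ̂(0) = 1.
  have h3 := (hasSum_single m h2).unique (hVs v v.2 m)
  rw [sub_self, fourierTest_zero hχ h1, one_mul] at h3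
  exact hm h3

/-- The Gram operator has a bounded right inverse. -/
lemma exists_gram_rightInverse (hT : 0 ≤ T) (hχ : IsTestFunction 0 T χ) (h0 : ∀ t, 0 ≤ χ t)
    (h1 : ∫ t, χ t = 1) :
    ∃ H : Seq Mode →L[ℂ] Seq Mode, ∀ e, H e + gramOp hT hχ 0 (H e) = e := by
  have hK : IsCompactOperator (gramOp hT hχ 0) := by
    classical
    exact Seq.isCompactOperator_rowOp (summable_gramRow hT hχ 0)
  -- Fredholm alternative at -1: either I + K has a kernel or it is invertible.
  rcases hK.hasEigenvalue_or_mem_resolventSet (μ := -1) (by norm_num) with h | h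
  · obtain ⟨v, hv⟩ := h.exists_hasEigenvector
    refine absurd (eq_zero_of_gram_eq_zero hT hχ h0 h1 ?_) hv.2
    have := hv.apply_eq_smul
    rwa [neg_one_smul] at this
  · obtain ⟨S, hS⟩ := (spectrum.mem_resolventSet_iff.1 h).exists_right_inv
    refine ⟨-S, fun e => ?_⟩
    have h2 : (algebraMap ℂ (Seq Mode →L[ℂ] Seq Mode) (-1) - gramOp hT hχ 0) (S e) = e :=
      congrArg (fun A : Seq Mode →L[ℂ] Seq Mode => A e) hS
    have h3 : algebraMap ℂ (Seq Mode →L[ℂ] Seq Mode) (-1) (S e) = -S e := by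
      rw [Algebra.algebraMap_eq_smul_one]; simp
    rw [_root_.sub_apply, h3] at h2
    rwa [_root_.neg_apply, map_neg, ← sub_eq_add_neg]

end Gram

/-! ### Weighted estimates for the inverse of the Gram operator -/

section Synthesis

open Mode

lemma norm_nu_pow_inv_le (r : ℕ) (n : Mode) : ‖((n.nu : ℂ) ^ r)⁻¹‖ ≤ 1 := by
  rw [norm_inv, norm_pow, Complex.norm_real, Real.norm_eq_abs]
  exact inv_le_one_of_one_le₀ (one_le_pow₀ n.one_le_abs_nu)

/-- Multiplication by `ν^{-r}`. -/
def nuInv (r : ℕ) : Seq Mode →L[ℂ] Seq Mode :=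
  Seq.diag (fun n => ((n.nu : ℂ) ^ r)⁻¹) 1 (norm_nu_pow_inv_le r)

lemma nuInv_apply (r : ℕ) (x : Seq Mode) (n : Mode) : nuInv r x n = ((n.nu : ℂ) ^ r)⁻¹ * x n := rfl

lemma Seq.norm_le_of_norm_apply_le {ι : Type*} {x y : Seq ι} (h : ∀ i, ‖x i‖ ≤ ‖y i‖) :
    ‖x‖ ≤ ‖y‖ :=
  Seq.norm_le_of_sum_le (norm_nonneg _) fun s => (Finset.sum_le_sum fun i _ =>
    pow_le_pow_left₀ (norm_nonneg _) (h i) 2).trans (Seq.sum_norm_sq_le y s)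

lemma norm_nuInv_le_of_le {q r : ℕ} (h : q ≤ r) (x : Seq Mode) : ‖nuInv r x‖ ≤ ‖nuInv q x‖ := by
  refine Seq.norm_le_of_norm_apply_le fun n => ?_
  rw [nuInv_apply, nuInv_apply, norm_mul, norm_mul]
  refine mul_le_mul_of_nonneg_right ?_ (norm_nonneg _)
  rw [norm_inv, norm_inv, norm_pow, norm_pow, Complex.norm_real, Real.norm_eq_abs]
  have h1 := n.one_le_abs_nu
  exact inv_anti₀ (by positivity) (pow_le_pow_right₀ h1 h)

variable {T : ℝ} {χ : ℝ → ℝ}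

/-- Formally B = ν^R(I+K)^{-1}ν^{-R}. The identity (I+K)^{-1} = I - K(I+K)^{-1} and the smoothing of
K turn ν^R K into a bounded operator, so B is the identity plus a correction bounded in each weight
up to R. -/
lemma exists_weighted_rightInverse (hT : 0 ≤ T) (hχ : IsTestFunction 0 T χ) (h0 : ∀ t, 0 ≤ χ t)
    (h1 : ∫ t, χ t = 1) (R : ℕ) :
    ∃ B : Seq Mode →L[ℂ] Seq Mode,
      (∀ ε, nuInv R (B ε) + gramOp hT hχ 0 (nuInv R (B ε)) = nuInv R ε) ∧
      ∃ C : ℝ, 0 ≤ C ∧ ∀ r ≤ R, ∀ ε, ‖nuInv r (B ε)‖ ≤ C * ‖nuInv r ε‖ := by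
  obtain ⟨H, hH⟩ := exists_gram_rightInverse hT hχ h0 h1
  let B : Seq Mode →L[ℂ] Seq Mode :=
    ContinuousLinearMap.id ℂ (Seq Mode) - gramOp hT hχ R ∘L H ∘L nuInv R
  refine ⟨B, fun ε => ?_,
    1 + ∑ q ∈ Finset.range (R + 1), ‖gramOp hT hχ q‖ * ‖H‖, by positivity, fun r hr ε => ?_⟩
  · have e : nuInv R (B ε) =
        H (nuInv R ε) := by
      rw [eq_sub_of_add_eq (hH (nuInv R ε))]
      ext n
      change ((n.nu : ℂ) ^ R)⁻¹ * (ε n - gramOp hT hχ R (H (nuInv R ε)) n) =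
        ((n.nu : ℂ) ^ R)⁻¹ * ε n - gramOp hT hχ 0 (H (nuInv R ε)) n
      rw [gramOp_apply, mul_sub, inv_mul_cancel_left₀ (pow_ne_zero _ n.nu_ne_zero)]
    rw [e, hH]
  · have e : nuInv r (B ε) =
        nuInv r ε - gramOp hT hχ (R - r) (H (nuInv R ε)) := by
      ext n
      change ((n.nu : ℂ) ^ r)⁻¹ * (ε n - gramOp hT hχ R (H (nuInv R ε)) n) =
        ((n.nu : ℂ) ^ r)⁻¹ * ε n - gramOp hT hχ (R - r) (H (nuInv R ε)) n
      rw [gramOp_apply, gramOp_apply _ _ (R - r), mul_sub]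
      congr 1
      rw [← mul_assoc]
      congr 1
      rw [inv_mul_eq_iff_eq_mul₀ (pow_ne_zero _ n.nu_ne_zero), ← pow_add,
        Nat.add_sub_cancel' hr]
    rw [e, add_mul, one_mul]
    -- The correction is bounded by the weakest norm, that of weight R, and therefore by the norm of
    -- weight r.
    refine (norm_sub_le _ _).trans (add_le_add le_rfl ?_)
    have h2 : ‖gramOp hT hχ (R - r)‖ * ‖H‖ ≤
        ∑ q ∈ Finset.range (R + 1), ‖gramOp hT hχ q‖ * ‖H‖ :=
      Finset.single_le_sum (f := fun q => ‖gramOp hT hχ q‖ * ‖H‖) (fun q _ => by positivity)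
        (Finset.mem_range.2 (by omega))
    calc ‖gramOp hT hχ (R - r) (H (nuInv R ε))‖
        ≤ ‖gramOp hT hχ (R - r)‖ * (‖H‖ * ‖nuInv R ε‖) :=
          (ContinuousLinearMap.le_opNorm _ _).trans
            (mul_le_mul_of_nonneg_left (H.le_opNorm _) (norm_nonneg _))
      _ = ‖gramOp hT hχ (R - r)‖ * ‖H‖ * ‖nuInv R ε‖ := by ring
      _ ≤ _ := mul_le_mul h2 (norm_nuInv_le_of_le hr ε) (norm_nonneg _)
        (Finset.sum_nonneg fun q _ => by positivity)

/-! ### Synthesis operators -/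

/-- The exponential `e^{-iν_n t}`. -/
def modeExp (n : Mode) (t : ℝ) : ℂ := Complex.exp (Complex.I * (-n.nu : ℝ) * t)

lemma continuous_modeExp (n : Mode) : Continuous (modeExp n) := by
  unfold modeExp; fun_prop

lemma norm_modeExp (n : Mode) (t : ℝ) : ‖modeExp n t‖ = 1 := norm_exp_I_mul _ _

lemma conj_modeExp (n : Mode) (t : ℝ) :
    (starRingEnd ℂ) (modeExp n t) = Complex.exp (Complex.I * n.nu * t) := by
  rw [modeExp, ← Complex.exp_conj]; simp

lemma memLp_mul_modeExp {g : ℝ → ℝ} (hg : IsTestFunction 0 T g) (n : Mode) :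
    MemLp (fun t => (g t : ℂ) * modeExp n t) 2 (timeMeasure T) := by
  obtain ⟨M, hM, hgM⟩ := hg.exists_bound
  refine MemLp.of_bound ((Complex.continuous_ofReal.comp hg.continuous).mul
    (continuous_modeExp n)).aestronglyMeasurable M (Eventually.of_forall fun t => ?_)
  rw [norm_mul, norm_modeExp, mul_one, Complex.norm_real]
  exact hgM t

/-- Boundedness is the Bessel inequality in time for the integer multiples of π² given by the
frequencies. -/
lemma exists_analysis {g : ℝ → ℝ} (hg : IsTestFunction 0 T g) :
    ∃ A : Lp ℂ 2 (timeMeasure T) →L[ℂ] Seq Mode, ∀ F n,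
      A F n = ∫ t in Ioo 0 T, Complex.exp (Complex.I * n.nu * t) * ((g t : ℂ) * F t) := by
  obtain ⟨M, hM, hgM⟩ := hg.exists_bound
  obtain ⟨C, hC, hB⟩ := exists_time_bessel Mode.freq Mode.freq_injective T
  have hmem : ∀ F : Lp ℂ 2 (timeMeasure T), MemLp (fun t => (g t : ℂ) * F t) 2 (timeMeasure T) := by
    intro F
    refine MemLp.of_le_mul (g := F) (c := M) (Lp.memLp F)
      ((Complex.continuous_ofReal.comp hg.continuous).aestronglyMeasurable.mul
        (Lp.aestronglyMeasurable F)) (Eventually.of_forall fun t => ?_)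
    rw [norm_mul, Complex.norm_real]
    exact mul_le_mul_of_nonneg_right (hgM t) (norm_nonneg _)
  have hint : ∀ F : Lp ℂ 2 (timeMeasure T), ∀ n : Mode, Integrable (fun t : ℝ =>
      Complex.exp (Complex.I * n.nu * t) * ((g t : ℂ) * F t)) (timeMeasure T) := fun F n =>
    Integrable.bdd_mul (c := 1) ((hmem F).integrable one_le_two)
      (Continuous.aestronglyMeasurable (by fun_prop))
      (Eventually.of_forall fun t => (norm_exp_I_mul _ _).le)
  have hsq : ∀ F : Lp ℂ 2 (timeMeasure T), ∫ t in Ioo 0 T, ‖F t‖ ^ 2 = ‖F‖ ^ 2 := by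
    intro F
    have h1 : (inner ℂ F F : ℂ) = ((‖F‖ ^ 2 : ℝ) : ℂ) := by
      rw [inner_self_eq_norm_sq_to_K]; push_cast; rfl
    rw [L2.inner_def] at h1
    have h2 : ((∫ t in Ioo 0 T, ‖F t‖ ^ 2 : ℝ) : ℂ) = ((‖F‖ ^ 2 : ℝ) : ℂ) := by
      rw [← h1, ← integral_complex_ofReal]
      refine integral_congr_ae (Eventually.of_forall fun t => ?_)
      simp only
      rw [inner_self_eq_norm_sq_to_K]; push_cast; rfl
    exact_mod_cast h2
  have hsum : ∀ F : Lp ℂ 2 (timeMeasure T), ∀ s : Finset Mode, ∑ n ∈ s,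
      ‖∫ t in Ioo 0 T, Complex.exp (Complex.I * n.nu * t) * ((g t : ℂ) * F t)‖ ^ 2 ≤
        (Real.sqrt C * M * ‖F‖) ^ 2 := by
    intro F s
    refine (hB _ (hmem F) s).trans ?_
    rw [mul_pow, mul_pow, Real.sq_sqrt hC.le, mul_assoc]
    refine mul_le_mul_of_nonneg_left ?_ hC.le
    rw [← hsq, ← integral_const_mul]
    refine integral_mono_of_nonneg (Eventually.of_forall fun _ => by positivity)
      (((Lp.memLp F).integrable_norm_pow two_ne_zero).const_mul _) (Eventually.of_forall fun t => ?_)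
    simp only
    rw [norm_mul, mul_pow, Complex.norm_real]
    exact mul_le_mul_of_nonneg_right (pow_le_pow_left₀ (norm_nonneg _) (hgM t) 2) (by positivity)
  refine ⟨LinearMap.mkContinuous
    { toFun := fun F => Seq.mk _ (Seq.memℓp_of_sum_le (hsum F))
      map_add' := fun F G => ?_
      map_smul' := fun c F => ?_ } (Real.sqrt C * M) fun F => ?_, fun F n => rfl⟩
  · ext n
    rw [lp.coeFn_add, Pi.add_apply, Seq.mk_apply, Seq.mk_apply, Seq.mk_apply,
      ← integral_add (hint F n) (hint G n)]
    refine integral_congr_ae ?_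
    filter_upwards [Lp.coeFn_add F G] with t ht
    rw [ht, Pi.add_apply]; ring
  · ext n
    rw [lp.coeFn_smul, Pi.smul_apply, Seq.mk_apply, RingHom.id_apply, Seq.mk_apply, smul_eq_mul,
      ← integral_const_mul]
    refine integral_congr_ae ?_
    filter_upwards [Lp.coeFn_smul c F] with t ht
    rw [ht, Pi.smul_apply, smul_eq_mul]; ring
  · exact Seq.norm_le_of_sum_le (by positivity) (hsum F)

/-- The synthesis operator is the adjoint of the analysis operator, so it is bounded without further
estimates. -/
lemma exists_synthesis {g : ℝ → ℝ} (hg : IsTestFunction 0 T g) :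
    ∃ S : Seq Mode →L[ℂ] Lp ℂ 2 (timeMeasure T), ∀ n (c : ℂ),
      S (lp.single 2 n c) =ᵐ[timeMeasure T] fun t => c * ((g t : ℂ) * modeExp n t) := by
  obtain ⟨A, hA⟩ := exists_analysis hg
  refine ⟨A.adjoint, fun n c => ?_⟩
  have e : A.adjoint (lp.single 2 n c) = c • (memLp_mul_modeExp hg n).toLp _ := by
    refine ext_inner_right ℂ fun F => ?_
    rw [ContinuousLinearMap.adjoint_inner_left, lp.inner_single_left, inner_smul_left, hA,
      RCLike.inner_apply, mul_comm, L2.inner_def]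
    congr 1
    refine integral_congr_ae ?_
    filter_upwards [(memLp_mul_modeExp hg n).coeFn_toLp] with t ht
    rw [ht, RCLike.inner_apply, map_mul, conj_modeExp, Complex.conj_ofReal]
    ring
  rw [e]
  filter_upwards [Lp.coeFn_smul c ((memLp_mul_modeExp hg n).toLp _),
    (memLp_mul_modeExp hg n).coeFn_toLp] with t h1 h2
  rw [h1, Pi.smul_apply, h2, smul_eq_mul]

/-- The real mode `2 Re (c g e^{-iν_n t})`. -/
def realMode (g : ℝ → ℝ) (n : Mode) (c : ℂ) (t : ℝ) : ℝ := 2 * (c * ((g t : ℂ) * modeExp n t)).re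

lemma exists_realSynthesis {g : ℝ → ℝ} (hg : IsTestFunction 0 T g) :
    ∃ S : Seq Mode →L[ℝ] L2Time T, ∀ n (c : ℂ),
      S (lp.single 2 n c) =ᵐ[timeMeasure T] realMode g n c := by
  obtain ⟨S, hS⟩ := exists_synthesis hg
  refine ⟨(2 : ℝ) • (Complex.reCLM.compLpL 2 (timeMeasure T)) ∘L (S.restrictScalars ℝ),
    fun n c => ?_⟩
  change ((2 : ℝ) • Complex.reCLM.compLp (S (lp.single 2 n c)) : L2Time T) =ᵐ[timeMeasure T] _
  filter_upwards [Lp.coeFn_smul (2 : ℝ) (Complex.reCLM.compLp (S (lp.single 2 n c))),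
    Complex.reCLM.coeFn_compLp (S (lp.single 2 n c)), hS n c] with t h1 h2 h3
  rw [h1, Pi.smul_apply, h2, h3, smul_eq_mul]; rfl

end Synthesis

/-! ### Derivatives of synthesized controls -/

section Modes

open Mode

variable {T : ℝ} {χ : ℝ → ℝ}

lemma isTestFunction_realMode {g : ℝ → ℝ} (hg : IsTestFunction 0 T g) (n : Mode) (c : ℂ) :
    IsTestFunction 0 T (realMode g n c) := by
  have hs : Function.support (realMode g n c) ⊆ Function.support g := fun t ht ht' =>
    ht (by simp [realMode, ht'])
  refine ⟨?_, hg.2.1.mono hs, (closure_mono hs).trans hg.2.2⟩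
  have h1 : ContDiff ℝ ∞ (modeExp n) := by
    unfold modeExp
    exact ((contDiff_const.mul Complex.ofRealCLM.contDiff).cexp)
  have h2 : ContDiff ℝ ∞ fun t => c * ((g t : ℂ) * modeExp n t) :=
    contDiff_const.mul ((Complex.ofRealCLM.contDiff.comp hg.1).mul h1)
  exact contDiff_const.mul (Complex.reCLM.contDiff.comp h2)

lemma deriv_realMode {g : ℝ → ℝ} (hg : IsTestFunction 0 T g) (n : Mode) (c : ℂ) :
    deriv (realMode g n c) =
      fun t => realMode (deriv g) n c t + realMode g n (-Complex.I * (n.nu * c)) t := by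
  funext t
  have h1 : HasDerivAt (modeExp n) (-(Complex.I * n.nu) * modeExp n t) t := by
    refine (hasDerivAt_exp_I_mul (-n.nu) t).congr_deriv ?_
    rw [modeExp]; push_cast; ring
  have h2 := ((((hg.1.differentiable (by simp)) t).hasDerivAt.ofReal_comp.mul h1).const_mul c)
  have h3 := ((Complex.reCLM.hasFDerivAt.comp_hasDerivAt t h2).const_mul 2)
  refine h3.deriv.trans ?_
  simp only [realMode, Complex.reCLM_apply]
  rw [← mul_add, ← Complex.add_re]
  congr 2
  ring

lemma nuInv_single (R : ℕ) (n : Mode) (c : ℂ) :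
    nuInv R (lp.single 2 n c) = lp.single 2 n (((n.nu : ℂ) ^ R)⁻¹ * c) := by
  ext m
  rw [nuInv_apply]
  by_cases h : m = n
  · subst h; rw [lp.single_apply_self, lp.single_apply_self]
  · rw [lp.single_apply_ne _ _ _ h, lp.single_apply_ne _ _ _ h, mul_zero]

/-- The derivatives of a synthesized control are synthesized with the expected weights. -/
lemma exists_iteratedDeriv_synthesis (r : ℕ) : ∀ {g : ℝ → ℝ}, IsTestFunction 0 T g → ∀ R, r ≤ R →
    ∃ W : Seq Mode →L[ℝ] L2Time T, (∀ n (c : ℂ), W (lp.single 2 n c) =ᵐ[timeMeasure T]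
        iteratedDeriv r (realMode g n (((n.nu : ℂ) ^ R)⁻¹ * c))) ∧
      ∃ C : ℝ, 0 ≤ C ∧ ∀ β, ‖W β‖ ≤ C * ‖nuInv (R - r) β‖ := by
  induction r with
  | zero =>
    intro g hg R _
    obtain ⟨S, hS⟩ := exists_realSynthesis hg
    refine ⟨S ∘L (nuInv R).restrictScalars ℝ, fun n c => ?_, ‖S‖, norm_nonneg _,
      fun β => S.le_opNorm _⟩
    rw [iteratedDeriv_zero]
    change S (nuInv R (lp.single 2 n c)) =ᵐ[timeMeasure T] _
    rw [nuInv_single]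
    exact hS _ _
  | succ r ih =>
    intro g hg R hR
    -- Differentiation falls either on the envelope, which stays a test function, or on the
    -- exponential, which yields -iν and lowers the weight from R to R-1. Both terms have order r.
    obtain ⟨W₁, h1, C₁, hC₁, hb₁⟩ := ih hg.deriv R (by omega)
    obtain ⟨W₂, h2, C₂, hC₂, hb₂⟩ := ih hg (R - 1) (by omega)
    refine ⟨W₁ + W₂ ∘L ((-Complex.I) • ContinuousLinearMap.id ℂ (Seq Mode)).restrictScalars ℝ,
      fun n c => ?_, C₁ + C₂, by positivity, fun β => ?_⟩
    · have e : (-Complex.I) • (lp.single 2 n c : Seq Mode) = lp.single 2 n (-Complex.I * c) := by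
        rw [← smul_eq_mul, lp.single_smul]
      change W₁ (lp.single 2 n c) + W₂ ((-Complex.I) • (lp.single 2 n c : Seq Mode))
        =ᵐ[timeMeasure T] _
      rw [e, iteratedDeriv_succ', deriv_realMode hg]
      filter_upwards [Lp.coeFn_add (W₁ (lp.single 2 n c)) (W₂ (lp.single 2 n (-Complex.I * c))),
        h1 n c, h2 n (-Complex.I * c)] with t ht h1t h2t
      rw [ht, Pi.add_apply, h1t, h2t]
      have h3 : -Complex.I * (n.nu * (((n.nu : ℂ) ^ R)⁻¹ * c)) =
          ((n.nu : ℂ) ^ (R - 1))⁻¹ * (-Complex.I * c) := by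
        rw [show R = (R - 1) + 1 by omega, pow_succ, mul_inv, Nat.add_sub_cancel]
        field_simp [n.nu_ne_zero]
      rw [h3]
      exact (iteratedDeriv_fun_add
        ((isTestFunction_realMode hg.deriv n _).1.of_le (by exact_mod_cast le_top)).contDiffAt
        ((isTestFunction_realMode hg n _).1.of_le (by exact_mod_cast le_top)).contDiffAt).symm
    · change ‖W₁ β + W₂ ((-Complex.I) • β)‖ ≤ _
      have h3 : ‖nuInv (R - r) β‖ ≤ ‖nuInv (R - (r + 1)) β‖ := norm_nuInv_le_of_le (by omega) β
      have h4 : ‖nuInv (R - 1 - r) ((-Complex.I) • β)‖ = ‖nuInv (R - (r + 1)) β‖ := by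
        rw [map_smul, norm_smul, norm_neg, Complex.norm_I, one_mul, Nat.sub_sub, add_comm 1 r]
      rw [add_mul]
      refine (norm_add_le _ _).trans (add_le_add ?_ ?_)
      · exact (hb₁ β).trans (mul_le_mul_of_nonneg_left h3 hC₁)
      · exact (hb₂ _).trans (mul_le_mul_of_nonneg_left h4.le hC₂)

end Modes

/-! ### Primitives on `(0, T)` -/

section Primitive

variable {T : ℝ}

lemma integral_norm_le (hT : 0 ≤ T) (f : L2Time T) :
    ∫ t in Ioo 0 T, ‖f t‖ ≤ Real.sqrt T * ‖f‖ := by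
  have h := norm_integral_mul_sq_le (ν := timeMeasure T) (f := fun t => ((‖f t‖ : ℝ) : ℂ))
    (h := fun _ => 1) (Lp.memLp f).norm.ofReal (memLp_const 1)
  have e1 : ∫ t in Ioo 0 T, ((‖f t‖ : ℝ) : ℂ) * 1 = ((∫ t in Ioo 0 T, ‖f t‖ : ℝ) : ℂ) := by
    rw [← integral_complex_ofReal]; simp
  have e2 : ∫ t in Ioo 0 T, ‖((‖f t‖ : ℝ) : ℂ)‖ ^ 2 = ‖f‖ ^ 2 := by
    rw [← L2Time.integral_sq]; simp
  have e3 : ∫ _ in Ioo 0 T, ‖(1 : ℂ)‖ ^ 2 = T := by simp [hT]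
  rw [e1, e2, e3, Complex.norm_real] at h
  refine le_of_sq_le_sq ?_ (by positivity)
  rw [mul_pow, Real.sq_sqrt hT, mul_comm]
  rwa [Real.norm_eq_abs, sq_abs] at h

lemma integrable_l2Time (f : L2Time T) : Integrable f (timeMeasure T) :=
  (Lp.memLp f).integrable one_le_two

lemma intervalIntegrable_l2Time (f : L2Time T) (a b : ℝ) :
    IntervalIntegrable f (timeMeasure T) a b :=
  (integrable_l2Time f).intervalIntegrable

/-- The primitive vanishing at `0`. -/
def primFun (f : L2Time T) (t : ℝ) : ℝ := ∫ τ in (0 : ℝ)..t, f τ ∂(timeMeasure T)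

lemma continuous_primFun (f : L2Time T) : Continuous (primFun f) :=
  intervalIntegral.continuous_primitive (intervalIntegrable_l2Time f) 0

lemma norm_primFun_le (hT : 0 ≤ T) (f : L2Time T) (t : ℝ) :
    ‖primFun f t‖ ≤ Real.sqrt T * ‖f‖ := by
  refine le_trans ?_ (integral_norm_le hT f)
  rw [primFun]
  refine (intervalIntegral.norm_integral_le_integral_norm_uIoc).trans ?_
  exact setIntegral_le_integral (integrable_l2Time f).norm (Eventually.of_forall fun _ => norm_nonneg _)

lemma memLp_primFun (hT : 0 ≤ T) (f : L2Time T) : MemLp (primFun f) 2 (timeMeasure T) :=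
  MemLp.of_bound (continuous_primFun f).aestronglyMeasurable _
    (Eventually.of_forall (norm_primFun_le hT f))

lemma primFun_add (f g : L2Time T) (t : ℝ) : primFun (f + g) t = primFun f t + primFun g t := by
  rw [primFun, primFun, primFun, ← intervalIntegral.integral_add
    (intervalIntegrable_l2Time f _ _) (intervalIntegrable_l2Time g _ _)]
  refine intervalIntegral.integral_congr_ae ?_
  filter_upwards [Lp.coeFn_add f g] with t ht _
  rw [ht, Pi.add_apply]

lemma primFun_smul (c : ℝ) (f : L2Time T) (t : ℝ) : primFun (c • f) t = c * primFun f t := by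
  rw [primFun, primFun, ← intervalIntegral.integral_const_mul]
  refine intervalIntegral.integral_congr_ae ?_
  filter_upwards [Lp.coeFn_smul c f] with t ht _
  rw [ht, Pi.smul_apply, smul_eq_mul]

/-- The value at `t` of the primitive. -/
def primAt (hT : 0 ≤ T) (t : ℝ) : L2Time T →L[ℝ] ℝ :=
  LinearMap.mkContinuous
    { toFun := fun f => primFun f t
      map_add' := fun f g => primFun_add f g t
      map_smul' := fun c f => primFun_smul c f t } (Real.sqrt T) fun f => norm_primFun_le hT f t

/-- The primitive, as an operator. -/
def prim (hT : 0 ≤ T) : L2Time T →L[ℝ] L2Time T :=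
  LinearMap.mkContinuous
    { toFun := fun f => (memLp_primFun hT f).toLp _
      map_add' := fun f g => by
        rw [← MemLp.toLp_add]
        congr 1
        funext t; exact primFun_add f g t
      map_smul' := fun c f => by
        rw [RingHom.id_apply, ← MemLp.toLp_const_smul]
        congr 1
        funext t; exact primFun_smul c f t } T fun f => by
    refine le_of_sq_le_sq ?_ (by positivity)
    change ‖(memLp_primFun hT f).toLp _‖ ^ 2 ≤ _
    rw [← L2Time.integral_sq]
    have h1 : ∫ t in Ioo 0 T, ((memLp_primFun hT f).toLp _ : L2Time T) t ^ 2 =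
        ∫ t in Ioo 0 T, primFun f t ^ 2 := by
      refine integral_congr_ae ?_
      filter_upwards [(memLp_primFun hT f).coeFn_toLp] with t ht
      rw [ht]
    have h2 : ∫ t in Ioo 0 T, primFun f t ^ 2 ≤ ∫ _ in Ioo 0 T, (Real.sqrt T * ‖f‖) ^ 2 := by
      refine integral_mono_of_nonneg (Eventually.of_forall fun _ => by positivity)
        (integrable_const _) (Eventually.of_forall fun t => ?_)
      simp only
      rw [← sq_abs (primFun f t)]
      exact pow_le_pow_left₀ (abs_nonneg _) (norm_primFun_le hT f t) 2
    rw [h1]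
    refine h2.trans (le_of_eq ?_)
    rw [setIntegral_const, mul_pow, Real.sq_sqrt hT]
    simp [hT]
    ring

lemma prim_coeFn (hT : 0 ≤ T) (f : L2Time T) : prim hT f =ᵐ[timeMeasure T] primFun f :=
  (memLp_primFun hT f).coeFn_toLp

lemma intervalIntegral_timeMeasure {t : ℝ} (ht : t ∈ Icc 0 T) (g : ℝ → ℝ) :
    ∫ τ in (0 : ℝ)..t, g τ ∂(timeMeasure T) = ∫ τ in (0 : ℝ)..t, g τ := by
  rw [intervalIntegral.integral_of_le ht.1, intervalIntegral.integral_of_le ht.1,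
    Measure.restrict_restrict measurableSet_Ioc]
  refine setIntegral_congr_set ?_
  have h : (Ioc 0 t ∩ Ioo 0 T : Set ℝ) =ᵐ[volume] (Ioc 0 t ∩ Ioc 0 T : Set ℝ) :=
    (ae_eq_refl _).inter Ioo_ae_eq_Ioc
  rwa [inter_eq_left.2 (Ioc_subset_Ioc_right ht.2)] at h

/-- The iterated primitives of the statement are the iterates of the primitive operator. -/
lemma iterPrim_succ_eq (hT : 0 ≤ T) (f : L2Time T) (n : ℕ) :
    iterPrim f n =ᵐ[timeMeasure T] (prim hT ^ n) f ∧
      ∀ t ∈ Icc 0 T, iterPrim f (n + 1) t = primFun ((prim hT ^ n) f) t := by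
  have key : ∀ n, iterPrim f n =ᵐ[timeMeasure T] (prim hT ^ n) f →
      ∀ t ∈ Icc 0 T, iterPrim f (n + 1) t = primFun ((prim hT ^ n) f) t := by
    intro n hn t ht
    change ∫ τ in (0 : ℝ)..t, iterPrim f n τ = _
    rw [← intervalIntegral_timeMeasure ht, primFun]
    refine intervalIntegral.integral_congr_ae ?_
    filter_upwards [hn] with τ hτ _
    exact hτ
  have main : ∀ n, iterPrim f n =ᵐ[timeMeasure T] (prim hT ^ n) f := by
    intro n
    induction n with
    | zero => rfl
    | succ n ih =>
      have h1 := key n ih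
      rw [pow_succ']
      change _ =ᵐ[timeMeasure T] prim hT ((prim hT ^ n) f)
      filter_upwards [prim_coeFn hT ((prim hT ^ n) f), ae_restrict_mem measurableSet_Ioo]
        with t h2 h3
      rw [h2, h1 t ⟨h3.1.le, h3.2.le⟩]
  exact ⟨main n, key n (main n)⟩

/-- A test function as an element of `L²`. -/
def testL2 {θ : ℝ → ℝ} (hθ : IsTestFunction 0 T θ) : L2Time T := hθ.memLp.toLp _

lemma testL2_coeFn {θ : ℝ → ℝ} (hθ : IsTestFunction 0 T θ) : testL2 hθ =ᵐ[timeMeasure T] θ :=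
  MemLp.coeFn_toLp _

lemma primFun_deriv {θ : ℝ → ℝ} (hθ : IsTestFunction 0 T θ) {f : L2Time T}
    (hf : f =ᵐ[timeMeasure T] deriv θ) {t : ℝ} (ht : t ∈ Icc 0 T) : primFun f t = θ t := by
  have h1 : primFun f t = ∫ τ in (0 : ℝ)..t, deriv θ τ := by
    rw [← intervalIntegral_timeMeasure ht, primFun]
    refine intervalIntegral.integral_congr_ae ?_
    filter_upwards [hf] with τ hτ _
    exact hτ
  rw [h1, intervalIntegral.integral_deriv_eq_sub
    (fun x _ => (hθ.1.differentiable (by simp)) x) (hθ.deriv.continuous.intervalIntegrable _ _),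
    hθ.apply_left, sub_zero]

lemma prim_eq_of_deriv (hT : 0 ≤ T) {θ : ℝ → ℝ} (hθ : IsTestFunction 0 T θ) {f : L2Time T}
    (hf : f =ᵐ[timeMeasure T] deriv θ) : prim hT f =ᵐ[timeMeasure T] θ := by
  filter_upwards [prim_coeFn hT f, ae_restrict_mem measurableSet_Ioo] with t h2 h3
  rw [h2, primFun_deriv hθ hf ⟨h3.1.le, h3.2.le⟩]

lemma prim_pow_testL2 (hT : 0 ≤ T) {θ : ℝ → ℝ} (hθ : IsTestFunction 0 T θ) (r n : ℕ) :
    (prim hT ^ n) (testL2 (hθ.iteratedDeriv (r + n))) = testL2 (hθ.iteratedDeriv r) := by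
  induction n with
  | zero => rfl
  | succ n ih =>
    rw [← ih, pow_succ]
    change (prim hT ^ n) (prim hT (testL2 (hθ.iteratedDeriv (r + n + 1)))) = _
    congr 1
    refine Lp.ext ?_
    refine (prim_eq_of_deriv hT (hθ.iteratedDeriv (r + n)) ?_).trans (testL2_coeFn _).symm
    rw [← iteratedDeriv_succ]
    exact testL2_coeFn _

lemma primFun_testL2 (hT : 0 ≤ T) {θ : ℝ → ℝ} (hθ : IsTestFunction 0 T θ) :
    primFun (testL2 hθ) T = ∫ t, θ t := by
  have h : primFun (testL2 hθ) T = ∫ τ in (0 : ℝ)..T, θ τ := by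
    rw [← intervalIntegral_timeMeasure ⟨hT, le_rfl⟩, primFun]
    refine intervalIntegral.integral_congr_ae ?_
    filter_upwards [testL2_coeFn hθ] with τ hτ _
    exact hτ
  rw [h, intervalIntegral.integral_of_le hT, integral_Ioc_eq_integral_Ioo, hθ.integral_Ioo]

/-- There is a test function of integral one whose further iterated primitives vanish at `T`. -/
lemma exists_test_moments (hT : 0 < T) (k : ℕ) :
    ∃ (α : ℝ → ℝ) (hα : IsTestFunction 0 T α), primFun (testL2 hα) T = 1 ∧
      ∀ n, 1 ≤ n → n ≤ k → primFun ((prim hT.le ^ n) (testL2 hα)) T = 0 := by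
  induction k with
  | zero =>
    obtain ⟨θ, hθ, h1, -⟩ := exists_test_bump hT
    exact ⟨θ, hθ, by rw [primFun_testL2 hT.le, h1], fun n h1 h2 => by omega⟩
  | succ k ih =>
    obtain ⟨α, hα, h1, h2⟩ := ih
    set c := primFun ((prim hT.le ^ (k + 1)) (testL2 hα)) T with hc
    -- Subtracting c·α^{(k+1)} leaves the earlier conditions intact, since its lower primitives are
    -- derivatives of α and vanish at T. Its primitive of order k+1 is α itself, of integral one,
    -- which cancels the new moment c.
    have hβ := hα.add ((hα.iteratedDeriv (k + 1)).const_mul (-c))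
    have e : testL2 hβ = testL2 hα + (-c) • testL2 (hα.iteratedDeriv (k + 1)) := by
      refine Lp.ext ?_
      filter_upwards [testL2_coeFn hβ, testL2_coeFn hα, testL2_coeFn (hα.iteratedDeriv (k + 1)),
        Lp.coeFn_add (testL2 hα) ((-c) • testL2 (hα.iteratedDeriv (k + 1))),
        Lp.coeFn_smul (-c) (testL2 (hα.iteratedDeriv (k + 1)))] with t h3 h4 h5 h6 h7
      rw [h3, h6, Pi.add_apply, h7, Pi.smul_apply, h4, h5, smul_eq_mul]
    have hn : ∀ n, primFun ((prim hT.le ^ n) (testL2 hβ)) T =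
        primFun ((prim hT.le ^ n) (testL2 hα)) T -
          c * primFun ((prim hT.le ^ n) (testL2 (hα.iteratedDeriv (k + 1)))) T := by
      intro n
      rw [e, map_add, map_smul, primFun_add, primFun_smul]; ring
    have hlow : ∀ n ≤ k, primFun ((prim hT.le ^ n) (testL2 (hα.iteratedDeriv (k + 1)))) T = 0 := by
      intro n hnk
      have h3 := prim_pow_testL2 hT.le hα (k + 1 - n) n
      simp only [show k + 1 - n + n = k + 1 by omega] at h3
      rw [h3]
      refine (primFun_deriv (hα.iteratedDeriv (k - n)) ?_ ⟨hT.le, le_rfl⟩).trans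
        (hα.iteratedDeriv (k - n)).apply_right
      rw [← iteratedDeriv_succ, show k - n + 1 = k + 1 - n by omega]
      exact testL2_coeFn _
    refine ⟨_, hβ, ?_, fun n hn1 hn2 => ?_⟩
    · have := hn 0
      rw [hlow 0 (by omega), mul_zero, sub_zero] at this
      exact this.trans h1
    · rw [hn]
      rcases Nat.lt_or_ge k n with h3 | h3
      · have h4 : n = k + 1 := by omega
        subst h4
        have h5 := prim_pow_testL2 hT.le hα 0 (k + 1)
        simp only [zero_add] at h5
        have h6 : testL2 (hα.iteratedDeriv 0) = testL2 hα := by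
          congr 1
        rw [h5, h6, h1, mul_one, ← hc, sub_self]
      · rw [hlow n h3, h2 n hn1 h3, mul_zero, sub_zero]

end Primitive

/-! ### Controls synthesized from prescribed moments -/

section Controls

open Mode

variable {T : ℝ} {χ : ℝ → ℝ}

lemma exists_synthesis_family (hχ : IsTestFunction 0 T χ) (R : ℕ) :
    ∃ W : ℕ → Seq Mode →L[ℝ] L2Time T,
      (∀ r ≤ R, ∀ n (c : ℂ), W r (lp.single 2 n c) =ᵐ[timeMeasure T]
        iteratedDeriv r (realMode χ n (((n.nu : ℂ) ^ R)⁻¹ * c))) ∧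
      ∃ C : ℝ, 0 ≤ C ∧ ∀ r ≤ R, ∀ β, ‖W r β‖ ≤ C * ‖nuInv (R - r) β‖ := by
  have h : ∀ r, ∃ W : Seq Mode →L[ℝ] L2Time T, ∃ C : ℝ, 0 ≤ C ∧ (r ≤ R →
      (∀ n (c : ℂ), W (lp.single 2 n c) =ᵐ[timeMeasure T]
        iteratedDeriv r (realMode χ n (((n.nu : ℂ) ^ R)⁻¹ * c))) ∧
      ∀ β, ‖W β‖ ≤ C * ‖nuInv (R - r) β‖) := by
    intro r
    by_cases hr : r ≤ R
    · obtain ⟨W, h1, C, hC, h2⟩ := exists_iteratedDeriv_synthesis r hχ R hr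
      exact ⟨W, C, hC, fun _ => ⟨h1, h2⟩⟩
    · exact ⟨0, 0, le_rfl, fun h => absurd h hr⟩
  choose W C hC h using h
  refine ⟨W, fun r hr => (h r hr).1, ∑ r ∈ Finset.range (R + 1), C r,
    Finset.sum_nonneg fun r _ => hC r, fun r hr β => ((h r hr).2 β).trans ?_⟩
  exact mul_le_mul_of_nonneg_right (Finset.single_le_sum (f := C) (fun r _ => hC r)
    (Finset.mem_range.2 (by omega))) (norm_nonneg _)

lemma integral_eq_primFun (hT : 0 ≤ T) (f : L2Time T) : ∫ t in Ioo 0 T, f t = primFun f T := by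
  rw [primFun, intervalIntegral_timeMeasure ⟨hT, le_rfl⟩, intervalIntegral.integral_of_le hT,
    integral_Ioc_eq_integral_Ioo]

lemma integrable_exp_mul (ν : ℝ) (f : L2Time T) :
    Integrable (fun t : ℝ => Complex.exp (Complex.I * ν * t) * (f t : ℂ)) (timeMeasure T) :=
  (integrable_l2Time f).ofReal.bdd_mul (c := 1)
    (Continuous.aestronglyMeasurable (by fun_prop))
    (Eventually.of_forall fun t => (norm_exp_I_mul ν t).le)

/-- The moment of frequency `ν`. -/
def momentAt (hT : 0 ≤ T) (ν : ℝ) : L2Time T →L[ℝ] ℂ :=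
  LinearMap.mkContinuous
    { toFun := fun f => ∫ t in Ioo 0 T, Complex.exp (Complex.I * ν * t) * (f t : ℂ)
      map_add' := fun f g => by
        rw [← integral_add (integrable_exp_mul ν f) (integrable_exp_mul ν g)]
        refine integral_congr_ae ?_
        filter_upwards [Lp.coeFn_add f g] with t ht
        rw [ht, Pi.add_apply]; push_cast; ring
      map_smul' := fun c f => by
        rw [RingHom.id_apply, Complex.real_smul, ← integral_const_mul]
        refine integral_congr_ae ?_
        filter_upwards [Lp.coeFn_smul c f] with t ht
        rw [ht, Pi.smul_apply, smul_eq_mul]; push_cast; ring } (Real.sqrt T) fun f => by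
    refine le_trans ?_ (integral_norm_le hT f)
    refine (norm_integral_le_integral_norm _).trans (le_of_eq ?_)
    refine integral_congr_ae (Eventually.of_forall fun t => ?_)
    simp only
    rw [norm_mul, norm_exp_I_mul, one_mul, Complex.norm_real]

lemma momentAt_apply (hT : 0 ≤ T) (ν : ℝ) (f : L2Time T) :
    momentAt hT ν f = ∫ t in Ioo 0 T, Complex.exp (Complex.I * ν * t) * (f t : ℂ) := rfl

lemma momentAt_of_ae (hT : 0 ≤ T) (ν : ℝ) {f : L2Time T} {θ : ℝ → ℝ}
    (h : f =ᵐ[timeMeasure T] θ) : momentAt hT ν f = fourierTest T θ ν := by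
  rw [momentAt_apply, fourierTest]
  refine integral_congr_ae ?_
  filter_upwards [h] with t ht
  rw [ht, mul_comm]

/-- Taking real parts adds a conjugate wave, whose contribution at ν is the conjugate of what the
mode yields at -ν. -/
lemma fourierTest_realMode (hχ : IsTestFunction 0 T χ) (n : Mode) (c : ℂ) (ν : ℝ) :
    fourierTest T (realMode χ n c) ν = c * fourierTest T χ (ν - n.nu) +
      (starRingEnd ℂ) (c * fourierTest T χ (-ν - n.nu)) := by
  rw [map_mul, conj_fourierTest, fourierTest, fourierTest, fourierTest, ← integral_const_mul,
    ← integral_const_mul, ← integral_add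
    ((integrableOn_Ioo_of_continuous (continuous_mul_exp hχ.continuous _)).const_mul _)
    ((integrableOn_Ioo_of_continuous (continuous_mul_exp hχ.continuous _)).const_mul _)]
  refine integral_congr_ae (Eventually.of_forall fun t => ?_)
  simp only [realMode]
  have h2 : ((2 * (c * ((χ t : ℂ) * modeExp n t)).re : ℝ) : ℂ) =
      c * ((χ t : ℂ) * modeExp n t) + (starRingEnd ℂ) (c * ((χ t : ℂ) * modeExp n t)) := by
    rw [Complex.add_conj]
  rw [h2, map_mul, map_mul, Complex.conj_ofReal, modeExp, ← Complex.exp_conj, add_mul]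
  congr 1
  · rw [mul_assoc, mul_assoc, ← Complex.exp_add]
    congr 3; push_cast; ring
  · rw [mul_assoc, mul_assoc, ← Complex.exp_add]
    congr 3
    simp only [map_mul, Complex.conj_I, Complex.conj_ofReal]
    push_cast; ring

lemma gram_single (hT : 0 ≤ T) (hχ : IsTestFunction 0 T χ) (h1 : ∫ t, χ t = 1) (n l : Mode)
    (c : ℂ) : (lp.single 2 n c : Seq Mode) l + gramOp hT hχ 0 (lp.single 2 n c) l =
      c * fourierTest T χ (l.nu - n.nu) := by
  refine (hasSum_gram hT hχ h1 (lp.single 2 n c) l).unique ?_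
  convert hasSum_single n fun m hm => ?_ using 1
  · rw [lp.single_apply_self, mul_comm]
  · rw [lp.single_apply_ne _ _ _ hm, mul_zero]

/-- Moments of a synthesized control. -/
lemma momentAt_synthesis (hT : 0 ≤ T) (hχ : IsTestFunction 0 T χ) (h1 : ∫ t, χ t = 1) {r R : ℕ}
    {W : Seq Mode →L[ℝ] L2Time T} (hW : ∀ n (c : ℂ), W (lp.single 2 n c) =ᵐ[timeMeasure T]
        iteratedDeriv r (realMode χ n (((n.nu : ℂ) ^ R)⁻¹ * c))) (β : Seq Mode) (l : Mode) :
    momentAt hT l.nu (W β) = (-(Complex.I * l.nu)) ^ r *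
      ((nuInv R β + gramOp hT hχ 0 (nuInv R β)) l +
        (starRingEnd ℂ) ((nuInv R β + gramOp hT hχ 0 (nuInv R β)) l.opp)) := by
  let G : Seq Mode →L[ℂ] Seq Mode := (ContinuousLinearMap.id ℂ _ + gramOp hT hχ 0) ∘L nuInv R
  let A : Seq Mode →L[ℝ] ℂ := ((-(Complex.I * l.nu)) ^ r) •
    ((Seq.eval l ∘L G).restrictScalars ℝ +
      (Complex.conjCLE : ℂ →L[ℝ] ℂ) ∘L (Seq.eval l.opp ∘L G).restrictScalars ℝ)
  -- Both sides are continuous and real linear in β, so single modes suffice; there the Gram matrix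
  -- appears.
  have h : momentAt hT l.nu ∘L W = A := by
    refine Seq.eq_of_single _ _ fun n c => ?_
    change momentAt hT l.nu (W (lp.single 2 n c)) = (-(Complex.I * l.nu)) ^ r *
      ((nuInv R (lp.single 2 n c) l + gramOp hT hχ 0 (nuInv R (lp.single 2 n c)) l) +
        (starRingEnd ℂ) (nuInv R (lp.single 2 n c) l.opp +
          gramOp hT hχ 0 (nuInv R (lp.single 2 n c)) l.opp))
    rw [momentAt_of_ae hT _ (hW n c), fourierTest_iteratedDeriv hT (isTestFunction_realMode hχ n _),
      fourierTest_realMode hχ, nuInv_single, gram_single hT hχ h1, gram_single hT hχ h1, nu_opp]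
  exact congrArg (fun F : Seq Mode →L[ℝ] ℂ => F β) h

/-- On a single mode the two functions are a test function and its derivative; continuity extends
both identities to all β. -/
lemma prim_comp_synthesis (hT : 0 ≤ T) (hχ : IsTestFunction 0 T χ) {r R : ℕ}
    {W W' : Seq Mode →L[ℝ] L2Time T} (hW : ∀ n (c : ℂ), W (lp.single 2 n c) =ᵐ[timeMeasure T]
        iteratedDeriv r (realMode χ n (((n.nu : ℂ) ^ R)⁻¹ * c)))
    (hW' : ∀ n (c : ℂ), W' (lp.single 2 n c) =ᵐ[timeMeasure T]
        iteratedDeriv (r + 1) (realMode χ n (((n.nu : ℂ) ^ R)⁻¹ * c))) (β : Seq Mode) :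
    prim hT (W' β) = W β ∧ primFun (W' β) T = 0 := by
  have key : ∀ n (c : ℂ), W' (lp.single 2 n c) =ᵐ[timeMeasure T]
      deriv (iteratedDeriv r (realMode χ n (((n.nu : ℂ) ^ R)⁻¹ * c))) := fun n c => by
    rw [← iteratedDeriv_succ]; exact hW' n c
  have h1 : prim hT ∘L W' = W := by
    refine Seq.eq_of_single _ _ fun n c => Lp.ext ?_
    exact (prim_eq_of_deriv hT ((isTestFunction_realMode hχ n _).iteratedDeriv r) (key n c)).trans
      (hW n c).symm
  have h2 : primAt hT T ∘L W' = 0 := by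
    refine Seq.eq_of_single _ _ fun n c => ?_
    have h3 := (isTestFunction_realMode hχ n (((n.nu : ℂ) ^ R)⁻¹ * c)).iteratedDeriv r
    exact (primFun_deriv h3 (key n c) ⟨hT, le_rfl⟩).trans h3.apply_right
  exact ⟨congrArg (fun F : Seq Mode →L[ℝ] L2Time T => F β) h1,
    congrArg (fun F : Seq Mode →L[ℝ] ℝ => F β) h2⟩

/-- The tuple of a family of operators. -/
def tupleOp {k : ℕ} (W : Fin (k + 1) → Seq Mode →L[ℝ] L2Time T) : Seq Mode →L[ℝ] ControlTuple k T :=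
  ((PiLp.continuousLinearEquiv 2 ℝ fun _ : Fin (k + 1) => L2Time T).symm :
    (Fin (k + 1) → L2Time T) →L[ℝ] ControlTuple k T) ∘L ContinuousLinearMap.pi W

lemma iteratedDeriv_iteratedDeriv (i r : ℕ) (θ : ℝ → ℝ) :
    iteratedDeriv i (iteratedDeriv r θ) = iteratedDeriv (r + i) θ := by
  induction i with
  | zero => simp
  | succ i ih => rw [iteratedDeriv_succ, ih, ← add_assoc, iteratedDeriv_succ]

/-- Finite sums of modes give sums of tuples of derivatives of test functions, and the space is
closed. -/
lemma tupleOp_mem_H0 {k r R : ℕ} (hχ : IsTestFunction 0 T χ)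
    {W : Fin (k + 1) → Seq Mode →L[ℝ] L2Time T}
    (hW : ∀ i n (c : ℂ), W i (lp.single 2 n c) =ᵐ[timeMeasure T]
        iteratedDeriv (r + i) (realMode χ n (((n.nu : ℂ) ^ R)⁻¹ * c))) (β : Seq Mode) :
    tupleOp W β ∈ H0 k T := by
  classical
  have h1 := (lp.hasSum_single (p := 2) (by norm_num) β).map (tupleOp W) (tupleOp W).continuous
  refine (Submodule.isClosed_topologicalClosure _).mem_of_tendsto h1
    (Eventually.of_forall fun s => ?_)
  refine Submodule.sum_mem _ fun n _ => ?_
  refine Submodule.le_topologicalClosure _ (Submodule.subset_span ?_)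
  refine ⟨_, (isTestFunction_realMode hχ n (((n.nu : ℂ) ^ R)⁻¹ * β n)).iteratedDeriv r, fun i => ?_⟩
  rw [iteratedDeriv_iteratedDeriv]
  exact hW i n (β n)

/-- Synthesis of controls: prescribed moments, vanishing iterated primitives at the final time and
bounds in the whole scale of norms. -/
lemma exists_control_synthesis (hT : 0 < T) (k : ℕ) :
    ∃ M : Seq Mode →L[ℝ] H0 k T,
      (∀ ε, ∀ n ≤ k, primFun ((prim hT.le ^ n) (controlDeriv (M ε) 0)) T = 0) ∧
      (∀ ε (l : Mode), momentAt hT.le l.nu (controlDeriv (M ε) 0) =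
        (-(Complex.I * l.nu)) ^ (k + 1) *
          (nuInv (2 * k + 1) ε l + (starRingEnd ℂ) (nuInv (2 * k + 1) ε l.opp))) ∧
      ∃ C : ℝ, 0 ≤ C ∧
        (∀ ε (m : Fin (k + 1)), ‖controlDeriv (M ε) m‖ ≤ C * ‖nuInv (k - m) ε‖) ∧
        ∀ ε, ∀ n ≤ k + 1,
          ‖(prim hT.le ^ n) (controlDeriv (M ε) 0)‖ ≤ C * ‖nuInv (k + n) ε‖ := by
  obtain ⟨χ, hχ, h1, h0⟩ := exists_test_bump hT
  obtain ⟨W, hW, C, hC, hb⟩ := exists_synthesis_family hχ (2 * k + 1)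
  obtain ⟨B, hB, C', hC', hb'⟩ := exists_weighted_rightInverse hT.le hχ h0 h1 (2 * k + 1)
  -- The control is the derivative of order k+1 of the synthesized function. With R = 2k+1 total
  -- weights, its own k derivatives and its k+1 primitives are the orders 0 to 2k+1 of one family.
  let V : Fin (k + 1) → Seq Mode →L[ℝ] L2Time T := fun i => W (k + 1 + i)
  have hV : ∀ β, tupleOp V β ∈ H0 k T := tupleOp_mem_H0 hχ fun i => hW (k + 1 + i) (by omega)
  let M : Seq Mode →L[ℝ] H0 k T := (tupleOp V).codRestrict (H0 k T) hV ∘L B.restrictScalars ℝ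
  have hM : ∀ ε (m : Fin (k + 1)), controlDeriv (M ε) m = W (k + 1 + m) (B ε) := fun ε m => rfl
  have hM0 : ∀ ε, controlDeriv (M ε) 0 = W (k + 1) (B ε) := fun ε => hM ε 0
  have hstep : ∀ r ≤ 2 * k, ∀ β, prim hT.le (W (r + 1) β) = W r β ∧ primFun (W (r + 1) β) T = 0 :=
    fun r hr β => prim_comp_synthesis hT.le hχ (hW r (by omega)) (hW (r + 1) (by omega)) β
  have hpow : ∀ n ≤ k + 1, ∀ β, (prim hT.le ^ n) (W (k + 1) β) = W (k + 1 - n) β := by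
    intro n
    induction n with
    | zero => intro _ β; rfl
    | succ n ih =>
      intro hn β
      rw [pow_succ']
      change prim hT.le ((prim hT.le ^ n) (W (k + 1) β)) = _
      rw [ih (by omega), show k + 1 - n = (k + 1 - (n + 1)) + 1 by omega]
      exact (hstep _ (by omega) β).1
  have hbB : ∀ r ≤ 2 * k + 1, ∀ ε, ‖W r (B ε)‖ ≤ C * C' * ‖nuInv (2 * k + 1 - r) ε‖ := by
    intro r hr ε
    refine (hb r hr _).trans ?_
    rw [mul_assoc]
    exact mul_le_mul_of_nonneg_left (hb' _ (by omega) ε) hC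
  refine ⟨M, fun ε n hn => ?_, fun ε l => ?_, C * C', by positivity, fun ε m => ?_, fun ε n hn => ?_⟩
  · rw [hM0, hpow n (by omega), show k + 1 - n = (k - n) + 1 by omega]
    exact (hstep _ (by omega) _).2
  · rw [hM0, momentAt_synthesis hT.le hχ h1 (hW (k + 1) (by omega)), hB]
  · rw [hM]
    have := hbB (k + 1 + m) (by omega) ε
    rwa [show 2 * k + 1 - (k + 1 + m) = k - m by omega] at this
  · rw [hM0, hpow n hn]
    have := hbB (k + 1 - n) (by omega) ε
    rwa [show 2 * k + 1 - (k + 1 - n) = k + n by omega] at this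

/-- The control given by a test function. -/
lemma exists_control_of_test (k : ℕ) {α : ℝ → ℝ} (hα : IsTestFunction 0 T α) :
    ∃ A : H0 k T, controlDeriv A 0 = testL2 hα := by
  refine ⟨⟨WithLp.toLp 2 fun i : Fin (k + 1) => testL2 (hα.iteratedDeriv i), ?_⟩, ?_⟩
  · exact Submodule.le_topologicalClosure _ (Submodule.subset_span
      ⟨α, hα, fun i => testL2_coeFn (hα.iteratedDeriv i)⟩)
  · refine Lp.ext ((testL2_coeFn (hα.iteratedDeriv 0)).trans ?_)
    rw [iteratedDeriv_zero]
    exact (testL2_coeFn hα).symm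

end Controls

/-! ### Solution of the moment problem -/

section MomentProblem

/-- Decrease of the weights by `j^{2r}`. -/
def lower (r : ℕ) : Seq ℕ+ →L[ℂ] Seq ℕ+ :=
  Seq.diag (fun j => ((j : ℂ) ^ (2 * r))⁻¹) 1 (norm_natCast_pow_inv_le (2 * r))

lemma lower_apply (r : ℕ) (x : Seq ℕ+) (j : ℕ+) :
    lower r x j = ((j : ℂ) ^ (2 * r))⁻¹ * x j := rfl

/-- The weight of the first mode is 1, so this mode is controlled in every norm of the scale. -/
lemma norm_apply_one_le_lower (r : ℕ) (x : Seq ℕ+) : ‖x 1‖ ≤ ‖lower r x‖ := by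
  have h := Seq.norm_apply_le (lower r x) 1
  rwa [lower_apply, PNat.one_coe, Nat.cast_one, one_pow, inv_one, one_mul] at h

/-- The coordinates of the sequence `x`, placed on the positive frequencies. -/
def pullFun (x : ℕ+ → ℂ) (l : Mode) : ℂ := if l.2 then x (l.1 + 1) else 0

lemma sum_pullFun_le (x : Seq ℕ+) (s : Finset Mode) :
    ∑ l ∈ s, ‖pullFun x l‖ ^ 2 ≤ ‖x‖ ^ 2 := by
  classical
  have h1 : ∑ l ∈ s, ‖pullFun x l‖ ^ 2 = ∑ l ∈ s.filter fun l => l.2 = true, ‖x (l.1 + 1)‖ ^ 2 := by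
    rw [Finset.sum_filter]
    refine Finset.sum_congr rfl fun l _ => ?_
    rw [pullFun]; split_ifs <;> simp
  have h2 : Set.InjOn (fun l : Mode => l.1 + 1) (s.filter fun l => l.2 = true : Finset Mode) := by
    intro l hl m hm h
    have hl' := (Finset.mem_filter.1 hl).2
    have hm' := (Finset.mem_filter.1 hm).2
    exact Prod.ext (add_right_cancel h) (hl'.trans hm'.symm)
  rw [h1, ← Finset.sum_image (f := fun j => ‖x j‖ ^ 2) h2]
  exact Seq.sum_norm_sq_le x _

/-- The sequence `x`, placed on the positive frequencies, as an operator. -/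
def pull : Seq ℕ+ →L[ℂ] Seq Mode :=
  LinearMap.mkContinuous
    { toFun := fun x => Seq.mk (pullFun x) (Seq.memℓp_of_sum_le (C := ‖x‖ ^ 2) (sum_pullFun_le x))
      map_add' := fun x y => by
        ext l
        simp only [Seq.mk_apply, lp.coeFn_add, Pi.add_apply, pullFun]
        split_ifs <;> simp
      map_smul' := fun c x => by
        ext l
        simp only [Seq.mk_apply, lp.coeFn_smul, Pi.smul_apply, pullFun, RingHom.id_apply]
        split_ifs <;> simp } 1 fun x => by
    rw [one_mul]
    exact Seq.norm_le_of_sum_le (norm_nonneg _) (sum_pullFun_le x)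

lemma pull_apply (x : Seq ℕ+) (l : Mode) : pull x l = if l.2 then x (l.1 + 1) else 0 := rfl

lemma norm_pull_le (x : Seq ℕ+) : ‖pull x‖ ≤ ‖x‖ :=
  Seq.norm_le_of_sum_le (norm_nonneg _) (sum_pullFun_le x)

namespace Mode

/-- Up to constants |ν| and (size+1)² are comparable, so powers of one can be traded for powers of
the other. -/
lemma nu_pow_div_bound (k : ℕ) (l : Mode) (r : ℕ) :
    |l.nu| ^ k * (l.size + 1) ^ (2 * r) ≤
      (3 * Real.pi ^ 2) ^ k * ((l.size + 1) ^ (2 * k) * |l.nu| ^ r) := by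
  have h0 := one_le_size l
  have h1 : |l.nu| ^ k ≤ (3 * Real.pi ^ 2) ^ k * (l.size + 1) ^ (2 * k) := by
    rw [pow_mul, ← mul_pow]
    refine pow_le_pow_left₀ (abs_nonneg _) ((abs_nu_le l).trans ?_) k
    gcongr
    linarith
  have h2 : (l.size + 1) ^ (2 * r) ≤ |l.nu| ^ r := by
    rw [pow_mul]
    exact pow_le_pow_left₀ (by positivity) (size_le_abs_nu l) r
  calc _ ≤ ((3 * Real.pi ^ 2) ^ k * (l.size + 1) ^ (2 * k)) * |l.nu| ^ r := by gcongr
    _ = _ := by ring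

end Mode

open Mode

/-- The weights `i^{k+1} ν^k / (j+1)^{2k}`. -/
def momentWeight (k : ℕ) (l : Mode) : ℂ :=
  Complex.I ^ (k + 1) * (l.nu : ℂ) ^ k * (((l.1 + 1 : ℕ+) : ℂ) ^ (2 * k))⁻¹

lemma norm_momentWeight (k : ℕ) (l : Mode) :
    ‖momentWeight k l‖ = |l.nu| ^ k * ((l.size + 1) ^ (2 * k))⁻¹ := by
  have h : ‖((l.1 + 1 : ℕ+) : ℂ)‖ = l.size + 1 := by
    rw [Complex.norm_natCast, size]; push_cast; rfl
  rw [momentWeight, norm_mul, norm_mul, norm_pow, Complex.norm_I, one_pow, one_mul, norm_pow,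
    Complex.norm_real, Real.norm_eq_abs, norm_inv, norm_pow, h]

lemma norm_momentWeight_le (k : ℕ) (l : Mode) : ‖momentWeight k l‖ ≤ (3 * Real.pi ^ 2) ^ k := by
  have h0 := one_le_size l
  have h := nu_pow_div_bound k l 0
  rw [norm_momentWeight, ← div_eq_mul_inv, div_le_iff₀ (by positivity)]
  simpa using h

lemma norm_nuInv_momentWeight_le (k r : ℕ) (δ : Seq ℕ+) :
    ‖nuInv r (Seq.diag (momentWeight k) _ (norm_momentWeight_le k) (pull δ))‖ ≤
      (3 * Real.pi ^ 2) ^ k * ‖lower r δ‖ := by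
  have h : ‖nuInv r (Seq.diag (momentWeight k) _ (norm_momentWeight_le k) (pull δ))‖ ≤
      ‖(((3 * Real.pi ^ 2) ^ k : ℝ) : ℂ) • pull (lower r δ)‖ := by
    refine Seq.norm_le_of_norm_apply_le fun l => ?_
    rw [nuInv_apply, Seq.diag_apply, lp.coeFn_smul, Pi.smul_apply, smul_eq_mul, pull_apply,
      pull_apply]
    split_ifs
    · have h0 := one_le_size l
      have h1 := one_le_abs_nu l
      have h2 : ‖((l.1 + 1 : ℕ+) : ℂ)‖ = l.size + 1 := by
        rw [Complex.norm_natCast, size]; push_cast; rfl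
      have h4 : 0 < |l.nu| := by linarith
      rw [norm_mul, norm_mul, norm_mul, norm_momentWeight, lower_apply, norm_mul, norm_inv, norm_pow,
        Complex.norm_real, norm_inv, norm_pow, h2, Complex.norm_real,
        Real.norm_of_nonneg (r := (3 * Real.pi ^ 2) ^ k) (by positivity), Real.norm_eq_abs]
      have h3 : (|l.nu| ^ r)⁻¹ * (|l.nu| ^ k * ((l.size + 1) ^ (2 * k))⁻¹) ≤
          (3 * Real.pi ^ 2) ^ k * ((l.size + 1) ^ (2 * r))⁻¹ := by
        rw [← div_eq_mul_inv, ← div_eq_mul_inv, inv_mul_eq_div, div_div,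
          div_le_div_iff₀ (by positivity) (by positivity)]
        exact nu_pow_div_bound k l r
      calc _ = (|l.nu| ^ r)⁻¹ * (|l.nu| ^ k * ((l.size + 1) ^ (2 * k))⁻¹) * ‖δ (l.1 + 1)‖ := by ring
        _ ≤ _ := mul_le_mul_of_nonneg_right h3 (norm_nonneg _)
        _ = _ := by ring
    · simp
  refine h.trans ?_
  rw [norm_smul, Complex.norm_real, Real.norm_of_nonneg (by positivity)]
  exact mul_le_mul_of_nonneg_left (norm_pull_le _) (by positivity)

variable {T : ℝ}

/-- The rapid decay of the Fourier transform of α makes the sequence square summable; it serves to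
cancel the moments of the control α at the nonzero frequencies. -/
lemma exists_correction (hT : 0 ≤ T) {α : ℝ → ℝ} (hα : IsTestFunction 0 T α) (k : ℕ) :
    ∃ v : Seq Mode, ∀ l : Mode, v l =
      if l.2 then Complex.I ^ (k + 1) * (l.nu : ℂ) ^ k * fourierTest T α l.nu else 0 := by
  obtain ⟨C, hC, h⟩ := exists_fourierTest_bound hT hα (k + 1)
  let c : Mode → ℂ := fun l => if l.2 then
    (l.size : ℂ) * (Complex.I ^ (k + 1) * (l.nu : ℂ) ^ k * fourierTest T α l.nu) else 0
  have hc : ∀ l, ‖c l‖ ≤ C := by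
    intro l
    simp only [c]
    split_ifs
    · have h0 := one_le_size l
      have h1 : l.size ≤ |l.nu| := by nlinarith [size_le_abs_nu l]
      rw [norm_mul, norm_mul, norm_mul, norm_pow, Complex.norm_I, one_pow, one_mul, norm_pow,
        Complex.norm_real, Complex.norm_real, Real.norm_of_nonneg (by linarith), Real.norm_eq_abs]
      refine le_trans ?_ (h l.nu)
      rw [pow_succ', mul_assoc]
      exact mul_le_mul_of_nonneg_right h1 (by positivity)
    · simpa using hC
  refine ⟨Seq.diag c C hc invSize, fun l => ?_⟩
  have h0 : (l.size : ℂ) ≠ 0 := by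
    have := one_le_size l
    exact_mod_cast (by linarith : l.size ≠ 0)
  have h1 : invSize l = (l.size : ℂ)⁻¹ := by
    rw [← Complex.ofReal_inv]; rfl
  rw [Seq.diag_apply, h1]
  simp only [c]
  split_ifs
  · field_simp
  · simp

/-- Solution of the moment problem by controls with vanishing iterated primitives at the final
time, bounded in the whole scale of norms. -/
lemma exists_moment_solution (hT : 0 < T) (k : ℕ) :
    ∃ U : Seq ℕ+ →L[ℝ] H0 k T,
      (∀ δ (j : ℕ+), momentAt hT.le (nu (j, true)) (controlDeriv (U δ) 0) =
        (((j + 1 : ℕ+) : ℂ) ^ (2 * k))⁻¹ * δ (j + 1)) ∧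
      (∀ δ, primFun (controlDeriv (U δ) 0) T = (δ 1).re) ∧
      (∀ δ n, 1 ≤ n → n ≤ k → primFun ((prim hT.le ^ n) (controlDeriv (U δ) 0)) T = 0) ∧
      ∃ C : ℝ, 0 ≤ C ∧
        (∀ δ (m : Fin (k + 1)), ‖controlDeriv (U δ) m‖ ≤ C * ‖lower (k - m) δ‖) ∧
        ∀ δ, ∀ n ≤ k + 1,
          ‖(prim hT.le ^ n) (controlDeriv (U δ) 0)‖ ≤ C * ‖lower (k + n) δ‖ := by
  obtain ⟨M, hM0, hMm, C, hC, hb, hb'⟩ := exists_control_synthesis hT k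
  obtain ⟨α, hα, hα1, hα0⟩ := exists_test_moments hT k
  obtain ⟨A, hA⟩ := exists_control_of_test k hα
  obtain ⟨v, hv⟩ := exists_correction hT.le hα k
  let a : Seq ℕ+ →L[ℝ] ℝ := Complex.reCLM ∘L (Seq.eval 1).restrictScalars ℝ
  have ha : ∀ δ, a δ = (δ 1).re := fun δ => rfl
  -- Only the positive frequencies are loaded, so the conjugate contribution of the opposite mode
  -- drops out. The term in v removes the moments produced by the component Re(δ_1)·A.
  let E : Seq ℕ+ →L[ℝ] Seq Mode :=
    (Seq.diag (momentWeight k) _ (norm_momentWeight_le k) ∘L pull).restrictScalars ℝ - a.smulRight v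
  have hE : ∀ δ, E δ = Seq.diag (momentWeight k) _ (norm_momentWeight_le k) (pull δ) -
      (((δ 1).re : ℝ) : ℂ) • v := fun δ => rfl
  -- The vector v is fixed and |Re δ_1| is bounded by every weighted norm, so the correction
  -- respects the whole scale.
  have hEb : ∀ r δ, ‖nuInv r (E δ)‖ ≤ ((3 * Real.pi ^ 2) ^ k + ‖v‖) * ‖lower r δ‖ := by
    intro r δ
    have h0 : ‖nuInv r v‖ ≤ ‖v‖ := by
      have h1 := norm_nuInv_le_of_le (Nat.zero_le r) v
      have h2 : nuInv 0 v = v := by ext l; rw [nuInv_apply]; simp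
      rwa [h2] at h1
    rw [hE, map_sub, map_smul, add_mul]
    refine (norm_sub_le _ _).trans (add_le_add (norm_nuInv_momentWeight_le k r δ) ?_)
    rw [norm_smul, Complex.norm_real, mul_comm]
    exact mul_le_mul h0 ((Complex.abs_re_le_norm _).trans (norm_apply_one_le_lower r δ))
      (norm_nonneg _) (norm_nonneg _)
  let U : Seq ℕ+ →L[ℝ] H0 k T := a.smulRight A + M ∘L E
  have hU : ∀ δ m, controlDeriv (U δ) m =
      (δ 1).re • controlDeriv A m + controlDeriv (M (E δ)) m := fun δ m => rfl
  set CA : ℝ := ∑ m : Fin (k + 1), ‖controlDeriv A m‖ +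
    ∑ n ∈ Finset.range (k + 2), ‖(prim hT.le ^ n) (controlDeriv A 0)‖ with hCA
  have hCA0 : 0 ≤ CA := by positivity
  have hre : ∀ (δ : Seq ℕ+) (r : ℕ), ‖(δ 1).re‖ ≤ ‖lower r δ‖ := fun δ r =>
    (Complex.abs_re_le_norm _).trans (norm_apply_one_le_lower r δ)
  refine ⟨U, fun δ j => ?_, fun δ => ?_, fun δ n hn1 hn => ?_,
    CA + C * ((3 * Real.pi ^ 2) ^ k + ‖v‖), by positivity, fun δ m => ?_, fun δ n hn => ?_⟩
  · have hopp : E δ (opp (j, true)) = 0 := by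
      rw [hE, lp.coeFn_sub, Pi.sub_apply, Seq.diag_apply, lp.coeFn_smul, Pi.smul_apply, pull_apply,
        hv]
      simp [opp]
    have hpos : E δ (j, true) = Complex.I ^ (k + 1) * (nu (j, true) : ℂ) ^ k *
        ((((j + 1 : ℕ+) : ℂ) ^ (2 * k))⁻¹ * δ (j + 1) -
          (δ 1).re * fourierTest T α (nu (j, true))) := by
      rw [hE, lp.coeFn_sub, Pi.sub_apply, Seq.diag_apply, lp.coeFn_smul, Pi.smul_apply, pull_apply,
        hv, if_pos rfl, if_pos rfl, momentWeight, smul_eq_mul]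
      ring
    rw [hU, map_add, map_smul, hMm, hA, momentAt_of_ae hT.le _ (testL2_coeFn hα), nuInv_apply,
      nuInv_apply, hopp, mul_zero, map_zero, add_zero, hpos, Complex.real_smul]
    have h0 := nu_ne_zero (j, true)
    -- The weights i^{k+1}ν^k were chosen to undo the factor (-iν)^{k+1} of the k+1 derivatives and
    -- the factor ν^{-(2k+1)} of the synthesis.
    have h1 : (-(Complex.I * (nu (j, true) : ℂ))) ^ (k + 1) *
        (((nu (j, true) : ℂ) ^ (2 * k + 1))⁻¹ * (Complex.I ^ (k + 1) * (nu (j, true) : ℂ) ^ k)) =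
        1 := by
      rw [neg_pow, mul_pow, show 2 * k + 1 = k + (k + 1) by ring, pow_add _ k (k + 1)]
      have h2 : (-1 : ℂ) ^ (k + 1) * (Complex.I ^ (k + 1) * Complex.I ^ (k + 1)) = 1 := by
        rw [← mul_pow, ← mul_pow, Complex.I_mul_I]; simp
      have h3 := pow_ne_zero k h0
      have h4 := pow_ne_zero (k + 1) h0
      rw [mul_inv]
      calc _ = ((-1 : ℂ) ^ (k + 1) * (Complex.I ^ (k + 1) * Complex.I ^ (k + 1))) *
          (((nu (j, true) : ℂ) ^ k)⁻¹ * (nu (j, true) : ℂ) ^ k) *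
          (((nu (j, true) : ℂ) ^ (k + 1))⁻¹ * (nu (j, true) : ℂ) ^ (k + 1)) := by ring
        _ = 1 := by rw [h2, inv_mul_cancel₀ h3, inv_mul_cancel₀ h4]; ring
    linear_combination ((((j + 1 : ℕ+) : ℂ) ^ (2 * k))⁻¹ * δ (j + 1) -
          (δ 1).re * fourierTest T α (nu (j, true))) * h1
  · have h0 : primFun (controlDeriv (M (E δ)) 0) T = 0 := hM0 (E δ) 0 (Nat.zero_le k)
    rw [hU, primFun_add, primFun_smul, hA, hα1, h0, mul_one, add_zero]
  · rw [hU, map_add, map_smul, primFun_add, primFun_smul, hA, hα0 n hn1 hn, hM0 _ n hn, mul_zero,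
      add_zero]
  · rw [hU, add_mul]
    refine (norm_add_le _ _).trans (add_le_add ?_ ?_)
    · rw [norm_smul, mul_comm]
      refine mul_le_mul ?_ (hre δ _) (norm_nonneg _) hCA0
      have h1 := Finset.single_le_sum (f := fun m : Fin (k + 1) => ‖controlDeriv A m‖)
        (fun _ _ => norm_nonneg _) (Finset.mem_univ m)
      have h2 : 0 ≤ ∑ n ∈ Finset.range (k + 2), ‖(prim hT.le ^ n) (controlDeriv A 0)‖ := by
        positivity
      linarith
    · refine (hb _ m).trans ?_
      rw [mul_assoc]
      exact mul_le_mul_of_nonneg_left (hEb _ δ) hC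
  · rw [hU, map_add, map_smul, add_mul]
    refine (norm_add_le _ _).trans (add_le_add ?_ ?_)
    · rw [norm_smul, mul_comm]
      refine mul_le_mul ?_ (hre δ _) (norm_nonneg _) hCA0
      have h1 := Finset.single_le_sum
        (f := fun n : ℕ => ‖(prim hT.le ^ n) (controlDeriv A 0)‖)
        (fun _ _ => norm_nonneg _) (Finset.mem_range.2 (by omega : n < k + 2))
      have h2 : 0 ≤ ∑ m : Fin (k + 1), ‖controlDeriv A m‖ := by positivity
      linarith
    · refine (hb' _ n hn).trans ?_
      rw [mul_assoc]
      exact mul_le_mul_of_nonneg_left (hEb _ δ) hC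

end MomentProblem

/-! ### Right inverse of the differential -/

section RightInverse

variable {T c : ℝ} {N k s : ℕ} {J : Set ℕ+} {b : ℕ+ → ℝ}

open Classical in
/-- The inverse of the gain of the mode `j ∈ J`. -/
def invGain (J : Set ℕ+) (b : ℕ+ → ℝ) (N : ℕ) (j : ℕ+) : ℂ :=
  if j ∈ J then (Complex.I * (b j * (j : ℂ) ^ N))⁻¹ else 0

lemma norm_invGain_le (hc : 0 < c) (hb : ∀ j ∈ J, c / (j : ℝ) ^ N ≤ |b j|) (j : ℕ+) :
    ‖invGain J b N j‖ ≤ c⁻¹ := by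
  rw [invGain]
  split_ifs with h
  · have h1 := hb j h
    have h2 : (0 : ℝ) < (j : ℝ) ^ N := by positivity
    rw [div_le_iff₀ h2] at h1
    rw [norm_inv, norm_mul, Complex.norm_I, one_mul, norm_mul, Complex.norm_real, norm_pow,
      Complex.norm_natCast, Real.norm_eq_abs]
    exact inv_anti₀ hc h1
  · simpa using hc.le

lemma norm_invGain_mul_phase_le (hc : 0 < c) (hb : ∀ j ∈ J, c / (j : ℝ) ^ N ≤ |b j|) (T : ℝ)
    (j : ℕ+) : ‖invGain J b N j * phase j T‖ ≤ c⁻¹ := by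
  rw [norm_mul, norm_phase, mul_one]
  exact norm_invGain_le hc hb j

/-- The moments to be attained, from the initial and final data. -/
def momentData (hc : 0 < c) (hb : ∀ j ∈ J, c / (j : ℝ) ^ N ≤ |b j|) (T : ℝ) :
    (Seq ℕ+ × Seq ℕ+) →L[ℝ] Seq ℕ+ :=
  ((Seq.diag _ _ (norm_invGain_mul_phase_le hc hb T)).restrictScalars ℝ) ∘L
    ContinuousLinearMap.snd ℝ _ _ -
  ((Seq.diag _ _ (norm_invGain_le hc hb)).restrictScalars ℝ) ∘L ContinuousLinearMap.fst ℝ _ _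

lemma momentData_apply (hc : 0 < c) (hb : ∀ j ∈ J, c / (j : ℝ) ^ N ≤ |b j|) (x y : Seq ℕ+)
    (j : ℕ+) : momentData hc hb T (x, y) j = invGain J b N j * (phase j T * y j - x j) := by
  have h : momentData hc hb T (x, y) j =
    invGain J b N j * phase j T * y j - invGain J b N j * x j := rfl
  rw [h]; ring

lemma norm_lower_diag_le {g : ℕ+ → ℂ} {C : ℝ} (hC : 0 ≤ C) (hg : ∀ j, ‖g j‖ ≤ C) (r : ℕ)
    (x : Seq ℕ+) : ‖lower r (Seq.diag g C hg x)‖ ≤ C * ‖lower r x‖ := by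
  have h : ‖lower r (Seq.diag g C hg x)‖ ≤ ‖(C : ℂ) • lower r x‖ := by
    refine Seq.norm_le_of_norm_apply_le fun j => ?_
    rw [lower_apply, Seq.diag_apply, lp.coeFn_smul, Pi.smul_apply, smul_eq_mul, lower_apply,
      mul_left_comm, norm_mul, norm_mul (C : ℂ), Complex.norm_real, Real.norm_of_nonneg hC]
    exact mul_le_mul_of_nonneg_right (hg j) (norm_nonneg _)
  rwa [norm_smul, Complex.norm_real, Real.norm_of_nonneg hC] at h

lemma norm_lower_momentData_le (hc : 0 < c) (hb : ∀ j ∈ J, c / (j : ℝ) ^ N ≤ |b j|) (r : ℕ)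
    (x y : Seq ℕ+) :
    ‖lower r (momentData hc hb T (x, y))‖ ≤ c⁻¹ * (‖lower r x‖ + ‖lower r y‖) := by
  have h : momentData hc hb T (x, y) = Seq.diag _ _ (norm_invGain_mul_phase_le hc hb T) y -
    Seq.diag _ _ (norm_invGain_le hc hb) x := rfl
  rw [h, map_sub, mul_add, add_comm]
  exact (norm_sub_le _ _).trans (add_le_add
    (norm_lower_diag_le (inv_nonneg.2 hc.le) _ r y) (norm_lower_diag_le (inv_nonneg.2 hc.le) _ r x))

/-- Tangency makes x_1 and e^{iλ_1T}y_1 purely imaginary, and the gain i·b_1 is imaginary as well;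
the quotient is real. A real control can therefore realize this moment, which is its integral. -/
lemma ofReal_re_momentData_one (hc : 0 < c) (hb : ∀ j ∈ J, c / (j : ℝ) ^ N ≤ |b j|)
    {x y : Seq ℕ+} (hx : (x 1).re = 0) (hy : (phase 1 T * y 1).re = 0) :
    (((momentData hc hb T (x, y) 1).re : ℝ) : ℂ) = momentData hc hb T (x, y) 1 := by
  rw [← Complex.conj_eq_iff_re, momentData_apply, invGain]
  have h : ∀ z : ℂ, z.re = 0 → (starRingEnd ℂ) z = -z := fun z hz =>
    Complex.ext (by simp [hz]) (by simp)
  split_ifs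
  · rw [map_mul, map_inv₀, map_mul, map_sub, h _ hx, h _ hy]
    simp
    ring
  · simp

lemma phase_mul_phase_neg (j : ℕ+) (τ : ℝ) :
    phase (j + 1) τ * phase 1 (-τ) = Complex.exp (Complex.I * Mode.nu (j, true) * τ) := by
  rw [phase, phase, ← Complex.exp_add, Mode.nu, Mode.freq, eigenvalue, eigenvalue, if_pos rfl]
  congr 1
  push_cast
  ring

/-- The mode j = 1 has frequency zero and uses the integral of u; every other j is i+1 and uses the
frequency ν_i. -/
lemma moment_control (hT : 0 < T) {u : H0 k T} {δ : Seq ℕ+}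
    (h : ∀ j : ℕ+, momentAt hT.le (Mode.nu (j, true)) (controlDeriv u 0) =
        (((j + 1 : ℕ+) : ℂ) ^ (2 * k))⁻¹ * δ (j + 1))
    (h1 : (primFun (controlDeriv u 0) T : ℂ) = δ 1) (j : ℕ+) :
    ∫ τ in Ioo 0 T, phase j τ * phase 1 (-τ) * controlFun u τ =
      ((j : ℂ) ^ (2 * k))⁻¹ * δ j := by
  by_cases hj : j = 1
  · subst hj
    have h2 : ∀ τ, phase 1 τ * phase 1 (-τ) = 1 := fun τ => by
      rw [mul_comm, phase_neg_mul_phase]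
    simp only [h2, one_mul]
    rw [integral_complex_ofReal, controlFun, integral_eq_primFun hT.le, h1]
    simp
  · obtain ⟨i, rfl⟩ := PNat.exists_eq_succ_of_ne_one hj
    rw [← h i, momentAt_apply]
    simp only [phase_mul_phase_neg]
    rfl

/-- A control with the moments `momentData` steers the linearized system to the target. -/
lemma linearizedState_eq_of_moments (hc : 0 < c) (hb : ∀ j ∈ J, c / (j : ℝ) ^ N ≤ |b j|)
    (hs : s = N + 2 * k) {F : H0 k T →L[ℝ] Seq ℕ+}
    (hF : ∀ u j, F u j = (j : ℂ) ^ s * (phase j (-T) * (Complex.I *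
        (b j * ∫ τ in Ioo 0 T, phase j τ * phase 1 (-τ) * controlFun u τ))))
    {ψ₀ ψf : HSp s} (hfT : (phase 1 T * weightedReal s ψf 1).re = 0)
    (hfJ : ∀ j ∉ J, weightedReal s ψf j = 0) {u : H0 k T}
    (hu : ∀ j : ℕ+, ∫ τ in Ioo 0 T, phase j τ * phase 1 (-τ) * controlFun u τ =
      ((j : ℂ) ^ (2 * k))⁻¹ * momentData hc hb T (weightedReal s ψ₀, weightedReal s ψf) j) :
    linearizedState s T J F (ψ₀, u) = ψf := by
  classical
  have hz : ∀ j ∈ J, (Seq.rot T (weightedReal s ψ₀) + F u) j = weightedReal s ψf j := by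
    intro j hj
    have h1 : (j : ℂ) ^ N ≠ 0 := pnat_pow_ne_zero N j
    have h2 : (j : ℂ) ^ (2 * k) ≠ 0 := pnat_pow_ne_zero _ j
    have h3 : (b j : ℂ) ≠ 0 := by
      have h4 := hb j hj
      have h5 : 0 < c / (j : ℝ) ^ N := by positivity
      exact_mod_cast abs_pos.1 (h5.trans_le h4)
    have h6 := phase_neg_mul_phase j T
    -- Since s = N+2k, the weights j^s, j^{-2k} and j^{-N} cancel exactly together with the gain.
    have h7 : (j : ℂ) ^ s * (((j : ℂ) ^ (2 * k))⁻¹ * invGain J b N j) * (Complex.I * b j) = 1 := by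
      rw [invGain, if_pos hj, hs, pow_add]
      have h8 := Complex.I_ne_zero
      field_simp
    rw [lp.coeFn_add, Pi.add_apply, Seq.rot_apply, hF, hu, momentData_apply]
    linear_combination (phase j (-T) * (phase j T * weightedReal s ψf j - weightedReal s ψ₀ j)) * h7
      + weightedReal s ψf j * h6
  have hz' : ∀ j, (if j ∈ J then (Seq.rot T (weightedReal s ψ₀) + F u) j else 0) =
      weightedReal s ψf j := by
    intro j
    split_ifs with hj
    · exact hz j hj
    · exact (hfJ j hj).symm
  rw [linearizedState_apply, ContinuousLinearEquiv.symm_apply_eq]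
  ext j
  rw [tangentProj_apply, hz', hz', hfT, Complex.ofReal_zero, zero_mul, sub_zero]

lemma linearizedState_mem (F : H0 k T →L[ℝ] Seq ℕ+) (x : HSp s × H0 k T) :
    linearizedState s T J F x ∈ tangentSpaceJ s J (psi1 T) := by
  classical
  rw [linearizedState_apply]
  set z := Seq.rot T (weightedReal s x.1) + F x.2
  constructor
  · rw [toL2_weightedReal_symm, inner_psi1, coeff_ofWeighted, tangentProj_apply, if_pos rfl]
    set w : ℂ := if 1 ∈ J then z 1 else 0
    have h : phase 1 T * ((((1 : ℕ+) : ℂ) ^ s)⁻¹ * (w - ((phase 1 T * w).re : ℂ) * phase 1 (-T))) =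
        phase 1 T * w - ((phase 1 T * w).re : ℂ) := by
      rw [PNat.one_coe, Nat.cast_one, one_pow, inv_one, one_mul]
      linear_combination (-((phase 1 T * w).re : ℂ)) * phase_neg_mul_phase 1 T
    rw [h, Complex.sub_re, Complex.ofReal_re, sub_self]
  · rw [toL2_weightedReal_symm, mem_spanJ_iff]
    intro j hj
    rw [coeff_ofWeighted, tangentProj_apply, if_neg hj]
    by_cases h : j = 1
    · subst h; simp [hj]
    · simp [h]

/-- In coordinates of weight s, the norm of order s-2r divides the j-th entry by j^{2r}; negative
orders are allowed. -/
lemma hNorm_eq_norm_lower {σ : ℤ} {r : ℕ} (h : σ + 2 * r = s) (ψ : HSp s) :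
    hNorm σ ψ.toL2 = ‖lower r (weightedReal s ψ)‖ := by
  rw [hNorm, ← Real.sqrt_sq (norm_nonneg (lower r (weightedReal s ψ))),
    ← (Seq.hasSum_norm_sq _).tsum_eq]
  congr 1
  refine tsum_congr fun j => ?_
  have h0 : (j : ℝ) ≠ 0 := by positivity
  rw [lower_apply, weightedReal_apply, weightedEquiv_apply, norm_mul, norm_mul, norm_inv, norm_pow,
    norm_pow, Complex.norm_natCast, ← mul_assoc]
  have e : σ = (s : ℤ) - (2 * r : ℕ) := by push_cast; omega
  rw [e, zpow_sub₀ h0, zpow_natCast, zpow_natCast, div_eq_inv_mul]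

lemma re_weightedReal_one {ψ : HSp s} (h : ψ ∈ tangentSpace s (phiL2 1)) :
    (weightedReal s ψ 1).re = 0 := by
  rw [weightedReal_apply, weightedEquiv_apply, PNat.one_coe, Nat.cast_one, one_pow, one_mul]
  exact h

lemma re_phase_mul_weightedReal_one {ψ : HSp s} (h : ψ ∈ tangentSpaceJ s J (psi1 T)) :
    (phase 1 T * weightedReal s ψ 1).re = 0 := by
  rw [weightedReal_apply, weightedEquiv_apply, PNat.one_coe, Nat.cast_one, one_pow, one_mul,
    ← inner_psi1]
  exact h.1

lemma weightedReal_eq_zero {ψ : HSp s} (h : ψ ∈ tangentSpaceJ s J (psi1 T)) {j : ℕ+} (hj : j ∉ J) :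
    weightedReal s ψ j = 0 := by
  rw [weightedReal_apply, weightedEquiv_apply, mem_spanJ_iff.1 h.2 j hj, mul_zero]

lemma sqrt_integral_iterPrim (hT : 0 ≤ T) (f : L2Time T) (n : ℕ) :
    Real.sqrt (∫ t in (0 : ℝ)..T, iterPrim f n t ^ 2) = ‖(prim hT ^ n) f‖ := by
  rw [← Real.sqrt_sq (norm_nonneg ((prim hT ^ n) f)), ← L2Time.integral_sq,
    intervalIntegral.integral_of_le hT, integral_Ioc_eq_integral_Ioo]
  congr 1
  refine integral_congr_ae ?_
  filter_upwards [(iterPrim_succ_eq hT f n).1] with t ht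
  rw [ht]

end RightInverse

end BilinearSchrodinger

end

/-! ### Assembly of the proposition -/

open BilinearSchrodinger
theorem proposition4p2 (T : ℝ) (hT : 0 < T) (p k : ℕ) (J : Set ℕ+) (μ : ℝ → ℝ)
    (hμ : MemSobolev 0 1 (2 * (p + k) + 3) μ)
    (hμbc : ∀ n < p, DerivVanishesAtEndpoints 0 1 (2 * n + 1) μ)
    (hμJ : ∃ c : ℝ, 0 < c ∧ ∀ j ∈ J,
      c / (j : ℝ) ^ (2 * p + 3) ≤ |∫ x in Set.Ioo (0 : ℝ) 1, μ x * phi 1 x * phi j x|) :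
    DifferentiableAt ℝ (endPointMap T μ J (2 * (p + k) + 3) k) (phiH (2 * (p + k) + 3) 1, 0) ∧
    ∃ D : (tangentSpace (2 * (p + k) + 3) (phiL2 1) × H0 k T) →L[ℝ]
        (tangentSpace (2 * (p + k) + 3) (phiL2 1) ×
          tangentSpaceJ (2 * (p + k) + 3) J (psi1 T)),
      (∀ (ψ₀ : tangentSpace (2 * (p + k) + 3) (phiL2 1)) (u : H0 k T),
        fderiv ℝ (endPointMap T μ J (2 * (p + k) + 3) k) (phiH (2 * (p + k) + 3) 1, 0)
          ((ψ₀ : HSp (2 * (p + k) + 3)), u) =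
          (((D (ψ₀, u)).1 : HSp (2 * (p + k) + 3)), ((D (ψ₀, u)).2 : HSp (2 * (p + k) + 3)))) ∧
      ∃ R : (tangentSpace (2 * (p + k) + 3) (phiL2 1) ×
            tangentSpaceJ (2 * (p + k) + 3) J (psi1 T)) →L[ℝ]
          (tangentSpace (2 * (p + k) + 3) (phiL2 1) × H0 k T),
        (∀ y, D (R y) = y) ∧
        ∃ C : ℝ, 0 < C ∧ ∀ (ψ₀ : tangentSpace (2 * (p + k) + 3) (phiL2 1))
            (ψf : tangentSpaceJ (2 * (p + k) + 3) J (psi1 T)),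
          ∃ u : H0 k T, R (ψ₀, ψf) = (ψ₀, u) ∧
            (∀ n : ℕ, 2 ≤ n → n ≤ k + 1 → iterPrim (controlFun u) n T = 0) ∧
            (∀ m : Fin (k + 1),
              ‖controlDeriv u m‖ ≤
                C * (hNorm (2 * ((p : ℤ) + (m : ℕ)) + 3) (ψ₀ : HSp (2 * (p + k) + 3)).toL2 +
                  hNorm (2 * ((p : ℤ) + (m : ℕ)) + 3) (ψf : HSp (2 * (p + k) + 3)).toL2)) ∧
            ∀ n : ℕ, 1 ≤ n → n ≤ k + 1 →
              negNorm T n (controlFun u) ≤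
                C * (hNorm (2 * ((p : ℤ) - n) + 3) (ψ₀ : HSp (2 * (p + k) + 3)).toL2 +
                  hNorm (2 * ((p : ℤ) - n) + 3) (ψf : HSp (2 * (p + k) + 3)).toL2) := by
  obtain ⟨c, hc, hb⟩ := hμJ
  -- The weight 2p+3 is that of the multiplication estimate; the remaining 2k come from the
  -- regularity of the control in time.
  have hs : 2 * (p + k) + 3 = (2 * p + 3) + 2 * k := by ring
  obtain ⟨hm0, hm⟩ := isTame_wmul (by omega) hμ hμbc
  obtain ⟨F, hF, hderiv⟩ := hasFDerivAt_endPointMap (k := k) hT.le hm0 hm hs J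
  generalize hgen : 2 * (p + k) + 3 = s at *
  obtain ⟨U, hU, hU1, hU0, C, hC, hUm, hUn⟩ := exists_moment_solution hT k
  let D : (tangentSpace s (phiL2 1) × H0 k T) →L[ℝ]
      (tangentSpace s (phiL2 1) × tangentSpaceJ s J (psi1 T)) :=
    (ContinuousLinearMap.fst ℝ _ _).prod
      ((linearizedState s T J F ∘L
        ((tangentSpace s (phiL2 1)).subtypeL.prodMap (ContinuousLinearMap.id ℝ _))).codRestrict
          (tangentSpaceJ s J (psi1 T)) fun x => linearizedState_mem F _)
  let Y : (tangentSpace s (phiL2 1) × tangentSpaceJ s J (psi1 T)) →L[ℝ] Seq ℕ+ :=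
    momentData hc hb T ∘L
      (((weightedReal s : HSp s →L[ℝ] Seq ℕ+) ∘L (tangentSpace s (phiL2 1)).subtypeL).prodMap
        ((weightedReal s : HSp s →L[ℝ] Seq ℕ+) ∘L (tangentSpaceJ s J (psi1 T)).subtypeL))
  have hY : ∀ ψ₀ ψf, Y (ψ₀, ψf) = momentData hc hb T (weightedReal s ψ₀, weightedReal s ψf) :=
    fun _ _ => rfl
  -- In the constant, c⁻¹ comes from inverting the gains and the summand 1 pays for |u_1(T)| in the
  -- negative norms.
  refine ⟨hderiv.differentiableAt, D, fun ψ₀ u => ?_,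
    (ContinuousLinearMap.fst ℝ _ _).prod (U ∘L Y), ?_, (C + 1) * c⁻¹, by positivity,
    fun ψ₀ ψf => ?_⟩
  · rw [hderiv.fderiv]; rfl
  · rintro ⟨ψ₀, ψf⟩
    refine Prod.ext rfl (Subtype.ext ?_)
    change linearizedState s T J F ((ψ₀ : HSp s), U (Y (ψ₀, ψf))) = (ψf : HSp s)
    refine linearizedState_eq_of_moments hc hb hs hF (re_phase_mul_weightedReal_one ψf.2)
      (fun j hj => weightedReal_eq_zero ψf.2 hj) fun j => ?_
    rw [← hY]
    refine moment_control hT (hU _) ?_ j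
    rw [hU1, hY]
    exact ofReal_re_momentData_one hc hb (re_weightedReal_one ψ₀.2)
      (re_phase_mul_weightedReal_one ψf.2)
  · have hbound : ∀ r, ‖lower r (Y (ψ₀, ψf))‖ ≤ c⁻¹ *
        (‖lower r (weightedReal s (ψ₀ : HSp s))‖ + ‖lower r (weightedReal s (ψf : HSp s))‖) :=
      fun r => norm_lower_momentData_le hc hb r _ _
    refine ⟨U (Y (ψ₀, ψf)), rfl, fun n hn hn' => ?_, fun m => ?_, fun n hn hn' => ?_⟩
    -- The value u_{i+1}(T) is the primitive at T of the i-th iterate, so orders 2 to k+1 correspond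
    -- to 1 ≤ i ≤ k.
    · obtain ⟨i, rfl⟩ : ∃ i, n = i + 1 := ⟨n - 1, by omega⟩
      rw [controlFun, (iterPrim_succ_eq hT.le _ i).2 T ⟨hT.le, le_rfl⟩]
      exact hU0 _ i (by omega) (by omega)
    · have hr : 2 * ((p : ℤ) + (m : ℕ)) + 3 + 2 * ((k - m : ℕ) : ℤ) = (s : ℕ) := by omega
      rw [hNorm_eq_norm_lower hr, hNorm_eq_norm_lower hr, mul_assoc]
      exact (hUm _ m).trans (mul_le_mul (by linarith) (hbound _) (norm_nonneg _) (by linarith))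
    -- The n primitives lower the order by 2n below 2p+3, hence r = k+n.
    · have hr : 2 * ((p : ℤ) - n) + 3 + 2 * ((k + n : ℕ) : ℤ) = (s : ℕ) := by omega
      rw [hNorm_eq_norm_lower hr, hNorm_eq_norm_lower hr, mul_assoc]
      refine le_trans ?_ (mul_le_mul_of_nonneg_left (hbound _) (by linarith))
      rw [negNorm, controlFun, sqrt_integral_iterPrim hT.le,
        (iterPrim_succ_eq hT.le _ 0).2 T ⟨hT.le, le_rfl⟩, add_mul, one_mul, add_comm]
      refine add_le_add (hUn _ n hn') ?_
      -- The first primitive at T is the real part of the datum on the first mode, which every norm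
      -- of the scale controls.
      have h1 : primFun ((prim hT.le ^ 0) (controlDeriv (U (Y (ψ₀, ψf))) 0)) T =
          (Y (ψ₀, ψf) 1).re := hU1 _
      rw [h1]
      exact (Complex.abs_re_le_norm _).trans (norm_apply_one_le_lower _ _)
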